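/- **Conventions.** Topological groups are group objects in compactly generated Hausdorff spaces, and principal bundles are locally trivial. A space is *of CW type* if it has the homotopy type of a CW complex. For a topological group $M$, $M_\circ$ denotes the path component of the identity. For $p,q\ge 1$ the Samelson product $\pi_p(M_\circ)\times\pi_q(M_\circ)\to\pi_{p+q}(M_\circ)$ is induced by the commutator map $M_\circ\wedge M_\circ\to M_\circ$, $(a,b)\mapsto aba^{-1}b^{-1}$. The *rational Samelson Lie algebra* of $M_\circ$ is the graded $\mathbb{Q}$-vector space $\pi_*(M_\circ)\otimes\mathbb{Q}$, $*\ge 1$, with the $\mathbb{Q}$-bilinear extension of this product. Let $G$ be a topological group of CW type, $G^{\mathrm{ad}}$ the group $G$ with the conjugation action, and $PG=G/Z(G)$, which also acts on $G^{\mathrm{ad}}$ by conjugation. For a principal $G$-bundle $\zeta\colon T\to B$ over a compact Hausdorff space, the gauge group $\mathcal{G}(\zeta)$ is the group of sections of $T\times_G G^{\mathrm{ad}}\to B$ under fibrewise multiplication, with the function space topology. For a principal $PG$-bundle $\zeta\colon T\to B$, the projective gauge group $\mathcal{P}(\zeta)$ is the group of sections of $T\times_{PG}G^{\mathrm{ad}}\to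 B$. **Proposition.** Let $X$ be a compact metric space, and suppose $X=\varprojlim_{j\in J}X_j$ for an inverse system of finite CW complexes $X_j$ over a nonempty directed index set $J$, with bonding maps $p_{jm}\colon X_j\to X_m$ $(j\ge m)$ and projections $h_j\colon X\to X_j$. 1. Let $\zeta$ be a principal $G$-bundle over $X$. There are an index $m$ and a principal $G$-bundle $\zeta_m$ over $X_m$ with $\zeta\cong h_m^*\zeta_m$. For every such $m$, $\zeta_m$ and isomorphism, put $\zeta_j=p_{jm}^*\zeta_m$ for $j\ge m$. Then pullback of sections induces isomorphisms of groups $$\varinjlim_{j\ge m}\pi_n\big(\mathcal{G}(\zeta_j)_\circ\big)\;\xrightarrow{\ \cong\ }\;\pi_n\big(\mathcal{G}(\zeta)_\circ\big)\qquad(n\ge 1),$$ and after tensoring with $\mathbb{Q}$ these form an isomorphism of rational Samelson Lie algebras, i.e. a degreewise bijective $\mathbb{Q}$-linear map that preserves the Samelson products. Here the bracket on the left is the one induced on the direct limit by the Samelson products of the groups $\mathcal{G}(\zeta_j)_\circ$. 2. Suppose in addition that $PG$ is Hausdorff and of CW type, and let $\zeta$ be a principal $PG$-bundle over $X$. There are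 an index $m$ and a principal $PG$-bundle $\zeta_m$ over $X_m$ with $\zeta\cong h_m^*\zeta_m$. For every such $m$, $\zeta_m$ and isomorphism, with $\zeta_j=p_{jm}^*\zeta_m$ for $j\ge m$, pullback of sections induces isomorphisms of groups $$\varinjlim_{j\ge m}\pi_n\big(\mathcal{P}(\zeta_j)_\circ\big)\;\xrightarrow{\ \cong\ }\;\pi_n\big(\mathcal{P}(\zeta)_\circ\big)\qquad(n\ge 1),$$ and after tensoring with $\mathbb{Q}$ these form an isomorphism of rational Samelson Lie algebras. -/

import Mathlib

open scoped TensorProduct Topology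

universe u v w

namespace GaugeLimit

/-! ### Groups in compactly generated spaces -/

/-- `f` is continuous on every compact subset of its domain. For a Hausdorff domain this says that
`f` is continuous for the compactly generated topology associated with that of the domain. -/
def KContinuous {Y : Type*} {Z : Type*} [TopologicalSpace Y] [TopologicalSpace Z] (f : Y → Z) :
    Prop :=
  ∀ K : Set Y, IsCompact K → ContinuousOn f K

/-- Multiplication (on the compactly generated product) and inversion are continuous in the
compactly generated sense. A topological group, in the sense of a group object in compactly
generated Hausdorff spaces, is a group `G` with `T2Space G`, `CompactlyCoherentSpace G` and
`KGroup G`. -/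
class KGroup (M : Type*) [TopologicalSpace M] [Group M] : Prop where
  kcontinuous_mul : KContinuous fun p : M × M => p.1 * p.2
  kcontinuous_inv : KContinuous fun a : M => a⁻¹

/-- `Y` has the homotopy type of a CW complex. -/
def HasCWType (Y : Type u) [TopologicalSpace Y] : Prop :=
  ∃ (K : Type u) (_ : TopologicalSpace K) (_ : T2Space K)
    (_ : Topology.CWComplex (Set.univ : Set K)), Nonempty (ContinuousMap.HomotopyEquiv Y K)

/-- `Y` admits the structure of a finite CW complex. -/
def IsFiniteCW (Y : Type u) [TopologicalSpace Y] [T2Space Y] : Prop :=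
  ∃ _ : Topology.CWComplex (Set.univ : Set Y),
    Topology.RelCWComplex.Finite (Set.univ : Set Y)

theorem KContinuous.continuous_comp {W Y Z : Type*} [TopologicalSpace W] [TopologicalSpace Y]
    [TopologicalSpace Z] [CompactSpace W] {f : Y → Z} (hf : KContinuous f) {g : W → Y}
    (hg : Continuous g) : Continuous fun x => f (g x) :=
  (hf _ (isCompact_range hg)).comp_continuous hg fun x => Set.mem_range_self x

theorem KContinuous.comp_continuousOn {W Y Z : Type*} [TopologicalSpace W] [TopologicalSpace Y]
    [TopologicalSpace Z] {f : Y → Z} (hf : KContinuous f) {g : W → Y} {K : Set W}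
    (hK : IsCompact K) (hg : ContinuousOn g K) : ContinuousOn (fun x => f (g x)) K :=
  (hf _ (hK.image_of_continuousOn hg)).comp hg (Set.mapsTo_image g K)

theorem KContinuous.continuous {Y Z : Type*} [TopologicalSpace Y] [TopologicalSpace Z]
    [CompactlyCoherentSpace Y] {f : Y → Z} (hf : KContinuous f) : Continuous f :=
  (CompactlyCoherentSpace.isCoherentWith.continuous_iff).2 fun K hK => hf K hK

theorem kcontinuous_of_continuous {Y Z : Type*} [TopologicalSpace Y] [TopologicalSpace Z]
    {f : Y → Z} (hf : Continuous f) : KContinuous f := fun _ _ => hf.continuousOn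

instance continuousInv_of_kGroup (G : Type*) [TopologicalSpace G] [Group G]
    [CompactlyCoherentSpace G] [KGroup G] : ContinuousInv G :=
  ⟨(KGroup.kcontinuous_inv (M := G)).continuous⟩

/-- A (compactly generated) action of `S` on `F` through group automorphisms. -/
structure AutAction (S : Type*) (F : Type*) [TopologicalSpace S] [Group S] [TopologicalSpace F]
    [Group F] where
  toHom : S →* MulAut F
  kcontinuous : KContinuous fun p : S × F => toHom p.1 p.2

section Conj

variable (G : Type*) [TopologicalSpace G] [Group G]

/-- The action of `G` on `G` by conjugation, `g · x = g x g⁻¹`. -/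
def conjAction [KGroup G] : AutAction G G where
  toHom := MulAut.conj
  kcontinuous := by
    intro K hK
    have h1 : ContinuousOn (fun p : G × G => p.1 * p.2) K := KGroup.kcontinuous_mul K hK
    have h2 : ContinuousOn (fun p : G × G => p.1⁻¹) K :=
      KGroup.kcontinuous_inv.comp_continuousOn hK continuousOn_fst
    exact KGroup.kcontinuous_mul.comp_continuousOn hK (h1.prodMk h2)

/-- The projectivization `PG = G / Z(G)`, with the quotient topology. -/
abbrev PG : Type _ := G ⧸ Subgroup.center G

/-- Conjugation as a homomorphism `PG → Aut(G)`, `[g] · x = g x g⁻¹`. -/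
def projConjHom : PG G →* MulAut G :=
  QuotientGroup.lift (Subgroup.center G) MulAut.conj (by
    intro z hz
    ext x
    have := Subgroup.mem_center_iff.1 hz x
    simp [← this])

instance continuousInv_PG [ContinuousInv G] : ContinuousInv (PG G) :=
  ⟨continuous_quot_lift _ (by
    exact (continuous_quot_mk.comp (continuous_inv (G := G))))⟩

variable {G} in
theorem isOpenQuotientMap_PG [CompactlyCoherentSpace G] [KGroup G] :
    IsOpenQuotientMap (QuotientGroup.mk : G → PG G) where
  surjective := QuotientGroup.mk_surjective
  continuous := continuous_quot_mk
  isOpenMap := by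
    intro U hU
    have hq : Topology.IsQuotientMap (QuotientGroup.mk : G → PG G) := isQuotientMap_quot_mk
    rw [← hq.isOpen_preimage]
    have : (QuotientGroup.mk : G → PG G) ⁻¹' (QuotientGroup.mk '' U) =
        ⋃ z : Subgroup.center G, (fun x : G => x * (z : G)) ⁻¹' U := by
      ext x
      simp only [Set.mem_preimage, Set.mem_image, Set.mem_iUnion]
      constructor
      · rintro ⟨y, hy, hxy⟩
        refine ⟨⟨x⁻¹ * y, QuotientGroup.eq.1 hxy.symm⟩, by simpa using hy⟩
      · rintro ⟨z, hz⟩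
        exact ⟨_, hz, (QuotientGroup.eq.2 (by simp)).symm⟩
    rw [this]
    refine isOpen_iUnion fun z => hU.preimage ?_
    refine KContinuous.continuous fun K hK => ?_
    exact KGroup.kcontinuous_mul.comp_continuousOn (g := fun x : G => (x, (z : G))) hK (by fun_prop)

/-- The action of `PG` on `G` by conjugation. -/
def projConjAction [T2Space G] [CompactlyCoherentSpace G] [KGroup G] : AutAction (PG G) G where
  toHom := projConjHom G
  kcontinuous := by
    intro K hK
    have hL : IsCompact (Prod.snd '' K) := hK.image continuous_snd
    have : CompactSpace (Prod.snd '' K) := isCompact_iff_compactSpace.1 hL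
    have h1 : Continuous fun p : G × (Prod.snd '' K) => MulAut.conj p.1 (p.2 : G) := by
      have hc : ∀ x : G, Continuous fun y : (Prod.snd '' K) => MulAut.conj x (y : G) := fun x =>
        ((conjAction G).kcontinuous).continuous_comp
          (g := fun y : (Prod.snd '' K) => (x, (y : G))) (by fun_prop)
      let c : G → C((Prod.snd '' K), G) := fun x => ⟨_, hc x⟩
      have hcc : Continuous c := by
        refine KContinuous.continuous fun L hL => ?_
        have : CompactSpace L := isCompact_iff_compactSpace.1 hL
        rw [continuousOn_iff_continuous_domRestrict]
        refine ContinuousMap.continuous_of_continuous_uncurry _ ?_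
        exact ((conjAction G).kcontinuous).continuous_comp
          (g := fun p : L × (Prod.snd '' K) => ((p.1 : G), (p.2 : G))) (by fun_prop)
      exact ContinuousMap.continuous_uncurry_of_continuous ⟨c, hcc⟩
    have h2 : Continuous fun p : PG G × (Prod.snd '' K) => projConjHom G p.1 (p.2 : G) := by
      have hq := (isOpenQuotientMap_PG (G := G)).prodMap
        (IsOpenQuotientMap.id (X := (Prod.snd '' K)))
      rw [hq.isQuotientMap.continuous_iff]
      exact h1
    rw [continuousOn_iff_continuous_domRestrict]
    exact h2.comp (f := fun p : K => ((p : PG G × G).1,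
      (⟨(p : PG G × G).2, Set.mem_image_of_mem _ p.2⟩ : (Prod.snd '' K)))) (by fun_prop)

end Conj

/-! ### Principal bundles -/

/-- A principal `S`-bundle over `B`: a space with a right action of `S` and a projection to `B`
which is locally, and equivariantly, the product projection `U × S → U`. (All bases in use are
compact Hausdorff, so that `U × S` is already compactly generated when `S` is.) -/
structure PrincipalBundle (S : Type u) [TopologicalSpace S] [Group S] (B : Type u)
    [TopologicalSpace B] where
  Total : Type u
  [top : TopologicalSpace Total]
  proj : C(Total, B)
  act : Total → S → Total
  act_one : ∀ t, act t 1 = t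
  act_mul : ∀ t s s', act t (s * s') = act (act t s) s'
  proj_act : ∀ t s, proj (act t s) = proj t
  exists_triv : ∀ b : B, ∃ U : Set B, IsOpen U ∧ b ∈ U ∧
    ∃ e : (proj ⁻¹' U) ≃ₜ U × S, (∀ t, ((e t).1 : B) = proj t) ∧
      ∀ (t : proj ⁻¹' U) (s : S),
        e ⟨act t s, by rw [Set.mem_preimage, proj_act]; exact t.2⟩ = ((e t).1, (e t).2 * s)

attribute [instance] PrincipalBundle.top

namespace PrincipalBundle

variable {S : Type u} [TopologicalSpace S] [Group S] {B B' B'' : Type u} [TopologicalSpace B]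
  [TopologicalSpace B'] [TopologicalSpace B'']

/-- A map of principal `S`-bundles covering `f`: a continuous equivariant map of total spaces over
`f`. Such a map identifies `ζ'` with the pullback of `ζ` along `f`. -/
structure Hom (ζ' : PrincipalBundle S B') (ζ : PrincipalBundle S B) (f : C(B', B)) where
  toMap : C(ζ'.Total, ζ.Total)
  proj_map : ∀ t, ζ.proj (toMap t) = f (ζ'.proj t)
  map_act : ∀ t s, toMap (ζ'.act t s) = ζ.act (toMap t) s

/-- The pullback of a principal bundle along `f`, with total space
`{(x, t) | f x = proj t}` inside the product. -/
def pullback (ζ : PrincipalBundle S B) (f : C(B', B)) : PrincipalBundle S B' where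
  Total := {p : B' × ζ.Total // f p.1 = ζ.proj p.2}
  proj := ⟨fun p => p.1.1, by fun_prop⟩
  act p s := ⟨(p.1.1, ζ.act p.1.2 s), by rw [ζ.proj_act]; exact p.2⟩
  act_one p := by simp [ζ.act_one]
  act_mul p s s' := by simp [ζ.act_mul]
  proj_act p s := rfl
  exists_triv b := by
    obtain ⟨U, hU, hb, e, he1, he2⟩ := ζ.exists_triv (f b)
    refine ⟨f ⁻¹' U, hU.preimage f.continuous, hb, ?_⟩
    refine ⟨{ toFun := fun p => (⟨p.1.1.1, p.2⟩, (e ⟨p.1.1.2, by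
                rw [Set.mem_preimage, ← p.1.2]; exact p.2⟩).2)
              invFun := fun q => ⟨⟨(q.1.1, (e.symm (⟨f q.1.1, q.1.2⟩, q.2)).1), by
                have := he1 (e.symm (⟨f q.1.1, q.1.2⟩, q.2)); simpa using this⟩, q.1.2⟩
              left_inv := ?_
              right_inv := ?_
              continuous_toFun := by fun_prop
              continuous_invFun := by fun_prop }, ?_, ?_⟩
    · rintro ⟨⟨⟨x, t⟩, hxt⟩, hx⟩
      have ht : t ∈ ζ.proj ⁻¹' U := by
        have : f x ∈ U := hx
        simpa [← hxt] using this
      have hxt' : f x = ζ.proj t := hxt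
      have : ((⟨f x, hx⟩ : U), (e ⟨t, ht⟩).2) = e ⟨t, ht⟩ := by
        refine Prod.ext (Subtype.ext ?_) rfl
        rw [he1]; exact hxt'
      have h3 : ((e.symm (⟨f x, hx⟩, (e ⟨t, ht⟩).2)) : ζ.Total) = t := by
        rw [this]; simp
      exact Subtype.ext (Subtype.ext (Prod.ext rfl h3))
    · rintro ⟨x, s⟩
      simp
    · intro p; rfl
    · intro p s
      have hm : p.1.1.2 ∈ ζ.proj ⁻¹' U := by rw [Set.mem_preimage, ← p.1.2]; exact p.2
      have h3 := congrArg Prod.snd (he2 ⟨p.1.1.2, hm⟩ s)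
      exact Prod.ext rfl h3

/-- The canonical map from the pullback along `f` to the pullback along `g`, covering `k`, where
`f = g ∘ k`. -/
def pullbackMap (ζ : PrincipalBundle S B) (f : C(B'', B)) (g : C(B', B)) (k : C(B'', B'))
    (h : ∀ x, g (k x) = f x) : Hom (ζ.pullback f) (ζ.pullback g) k where
  toMap := ⟨fun p => ⟨(k p.1.1, p.1.2), by rw [← p.2]; exact h _⟩, by fun_prop⟩
  proj_map _ := rfl
  map_act _ _ := rfl

/-- The map to the pullback along `g` that is induced by a bundle map covering `f = g ∘ k`. -/
def Hom.toPullback {ζ' : PrincipalBundle S B''} {ζ : PrincipalBundle S B} {f : C(B'', B)}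
    (Φ : Hom ζ' ζ f) (g : C(B', B)) (k : C(B'', B')) (h : ∀ x, g (k x) = f x) :
    Hom ζ' (ζ.pullback g) k where
  toMap := ⟨fun t => ⟨(k (ζ'.proj t), Φ.toMap t), by rw [Φ.proj_map]; exact h _⟩, by fun_prop⟩
  proj_map _ := rfl
  map_act t s := Subtype.ext (Prod.ext (congrArg k (ζ'.proj_act t s)) (Φ.map_act t s))

/-! Local sections together with the corresponding fibre coordinate. -/

structure IsLocTriv (ζ : PrincipalBundle S B) (C : Set B) (σ : B → ζ.Total) (c : ζ.Total → S) :
    Prop where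
  isClosed : IsClosed C
  continuousOn_sec : ContinuousOn σ C
  proj_sec : ∀ b ∈ C, ζ.proj (σ b) = b
  continuousOn_coord : ContinuousOn c (ζ.proj ⁻¹' C)
  act_coord : ∀ t, ζ.proj t ∈ C → ζ.act (σ (ζ.proj t)) (c t) = t

theorem exists_isLocTriv [RegularSpace B] (ζ : PrincipalBundle S B) (b : B) :
    ∃ C ∈ 𝓝 b, ∃ σ c, ζ.IsLocTriv C σ c := by
  classical
  obtain ⟨U, hU, hb, e, he1, he2⟩ := ζ.exists_triv b
  obtain ⟨C, hC, hCc, hCU⟩ := exists_mem_nhds_isClosed_subset (hU.mem_nhds hb)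
  have t0 : ζ.Total := (e.symm (⟨b, hb⟩, 1)).1
  refine ⟨C, hC, fun x => if h : x ∈ U then (e.symm (⟨x, h⟩, 1)).1 else t0,
    fun t => if h : ζ.proj t ∈ U then (e ⟨t, h⟩).2 else 1, hCc, ?_, ?_, ?_, ?_⟩
  · refine ContinuousOn.mono ?_ hCU
    rw [continuousOn_iff_continuous_domRestrict]
    have : Continuous fun x : U => ((e.symm (x, 1)) : ζ.Total) := by fun_prop
    refine this.congr fun x => ?_
    simp [Set.domRestrict]
  · intro x hx
    have := he1 (e.symm (⟨x, hCU hx⟩, 1))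
    simpa [hCU hx] using this.symm
  · refine ContinuousOn.mono (s := ζ.proj ⁻¹' U) ?_ (Set.preimage_mono hCU)
    rw [continuousOn_iff_continuous_domRestrict]
    have : Continuous fun x : ζ.proj ⁻¹' U => (e x).2 := by fun_prop
    refine this.congr fun x => ?_
    have hx : ζ.proj x.1 ∈ U := x.2
    simp [Set.domRestrict, hx]
  · intro t ht
    have htU := hCU ht
    simp only [htU, dif_pos]
    have h1 := he2 (e.symm (⟨ζ.proj t, htU⟩, 1)) (e ⟨t, htU⟩).2
    have h2 : e ⟨ζ.act (e.symm (⟨ζ.proj t, htU⟩, 1)).1 (e ⟨t, htU⟩).2, by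
        rw [Set.mem_preimage, ζ.proj_act]; exact (e.symm (⟨ζ.proj t, htU⟩, 1)).2⟩ = e ⟨t, htU⟩ := by
      rw [h1]
      refine Prod.ext (Subtype.ext ?_) (by simp)
      simp [he1 ⟨t, htU⟩]
    exact congrArg Subtype.val (e.injective h2)

theorem proj_surjective (ζ : PrincipalBundle S B) : Function.Surjective ζ.proj := by
  intro b
  obtain ⟨U, hU, hb, e, he1, he2⟩ := ζ.exists_triv b
  refine ⟨(e.symm (⟨b, hb⟩, 1)).1, ?_⟩
  have := he1 (e.symm (⟨b, hb⟩, 1))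
  simpa using this.symm

theorem exists_act (ζ : PrincipalBundle S B) {t t' : ζ.Total} (h : ζ.proj t = ζ.proj t') :
    ∃ s, ζ.act t s = t' := by
  obtain ⟨U, hU, hb, e, he1, he2⟩ := ζ.exists_triv (ζ.proj t)
  have hb' : ζ.proj t' ∈ U := h ▸ hb
  refine ⟨(e ⟨t, hb⟩).2⁻¹ * (e ⟨t', hb'⟩).2, ?_⟩
  have h1 := he2 ⟨t, hb⟩ ((e ⟨t, hb⟩).2⁻¹ * (e ⟨t', hb'⟩).2)
  refine congrArg Subtype.val (e.injective (a₂ := ⟨t', hb'⟩) (h1.trans ?_))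
  refine Prod.ext (Subtype.ext ?_) (by simp)
  rw [he1, he1]; exact h

theorem act_inj (ζ : PrincipalBundle S B) {t : ζ.Total} {s : S} (h : ζ.act t s = t) : s = 1 := by
  obtain ⟨U, hU, hb, e, he1, he2⟩ := ζ.exists_triv (ζ.proj t)
  have h1 := he2 ⟨t, hb⟩ s
  have h2 := congrArg Prod.snd h1
  simp only [h] at h2
  simpa using h2.symm

end PrincipalBundle

/-! ### Associated bundles of groups -/

section Assoc

variable {S F : Type u} [TopologicalSpace S] [Group S] [TopologicalSpace F] [Group F]
  {B B' : Type u} [TopologicalSpace B] [TopologicalSpace B']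
  (ζ : PrincipalBundle S B) (a : AutAction S F)

/-- The relation `(t s, x) ∼ (t, s · x)` on `T × F`. -/
def assocSetoid : Setoid (ζ.Total × F) where
  r p q := ∃ s : S, q.1 = ζ.act p.1 s ∧ p.2 = a.toHom s q.2
  iseqv :=
    ⟨fun p => ⟨1, by simp [ζ.act_one]⟩,
     fun {p q} ⟨s, h1, h2⟩ => ⟨s⁻¹, by rw [h1, ← ζ.act_mul, mul_inv_cancel, ζ.act_one], by
      rw [h2, map_inv, MulAut.inv_apply_self]⟩,
     fun {p q r} ⟨s, h1, h2⟩ ⟨s', h3, h4⟩ => ⟨s * s', by rw [h3, h1, ζ.act_mul], by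
      rw [h2, h4, map_mul, MulAut.mul_apply]⟩⟩

/-- The total space `T ×_S F` of the associated bundle. -/
def Assoc : Type u := Quotient (assocSetoid ζ a)

namespace Assoc

variable {ζ}

/-- The class `[t, x]`. -/
def mk (t : ζ.Total) (x : F) : Assoc ζ a := Quotient.mk (assocSetoid ζ a) (t, x)

/-- The quotient topology of the compactly generated product `T × F`. -/
noncomputable instance : TopologicalSpace (Assoc ζ a) :=
  TopologicalSpace.coinduced
    (fun p : CompactCoherentification (ζ.Total × F) =>
      mk a ((CompactCoherentification.mk _).symm p).1 ((CompactCoherentification.mk _).symm p).2)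
    inferInstance

variable {a}

/-- The bundle projection `[t, x] ↦ proj t`. -/
def proj (p : Assoc ζ a) : B :=
  Quotient.lift (fun q : ζ.Total × F => ζ.proj q.1)
    (by rintro p q ⟨s, h, _⟩; simp [h, ζ.proj_act]) p

@[simp] theorem proj_mk (t : ζ.Total) (x : F) : proj (mk a t x) = ζ.proj t := rfl

theorem mk_act (t : ζ.Total) (s : S) (x : F) : mk a (ζ.act t s) x = mk a t (a.toHom s x) :=
  (Quotient.sound (s := assocSetoid ζ a) ⟨s, rfl, rfl⟩).symm

theorem mk_inj {t : ζ.Total} {x y : F} (h : mk a t x = mk a t y) : x = y := by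
  obtain ⟨s, h1, h2⟩ := Quotient.exact (s := assocSetoid ζ a) h
  have := ζ.act_inj (Eq.symm h1)
  simpa [this] using h2

theorem exists_mk (p : Assoc ζ a) (t : ζ.Total) (h : proj p = ζ.proj t) :
    ∃ x, p = mk a t x := by
  obtain ⟨⟨t', x⟩, rfl⟩ := Quotient.exists_rep p
  obtain ⟨s, rfl⟩ := ζ.exists_act (t := t) (t' := t') h.symm
  exact ⟨_, mk_act t s x⟩

open Classical in
/-- The coordinate of `p` in the fibre of `t`: the unique `x` with `p = [t, x]`. -/
noncomputable def coord (t : ζ.Total) (p : Assoc ζ a) : F :=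
  if h : ∃ x, p = mk a t x then h.choose else 1

theorem mk_coord (t : ζ.Total) (p : Assoc ζ a) (h : proj p = ζ.proj t) :
    mk a t (coord t p) = p := by
  have h' := exists_mk p t h
  rw [coord, dif_pos h']
  exact h'.choose_spec.symm

@[simp] theorem coord_mk (t : ζ.Total) (x : F) : coord t (mk a t x) = x :=
  mk_inj (mk_coord t (mk a t x) rfl)

theorem coord_act (t : ζ.Total) (s : S) (p : Assoc ζ a) (h : proj p = ζ.proj t) :
    coord (ζ.act t s) p = a.toHom s⁻¹ (coord t p) := by
  obtain ⟨x, rfl⟩ := exists_mk p t h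
  have : mk a t x = mk a (ζ.act t s) (a.toHom s⁻¹ x) := by
    rw [mk_act, map_inv, MulAut.apply_inv_self]
  rw [coord_mk, this, coord_mk]

theorem eq_of_coord {p q : Assoc ζ a} (t : ζ.Total) (hp : proj p = ζ.proj t)
    (hq : proj q = ζ.proj t) (h : coord t p = coord t q) : p = q := by
  rw [← mk_coord t p hp, ← mk_coord t q hq, h]

variable (ζ) in
/-- A point of the total space over `b`. -/
noncomputable def pt (b : B) : ζ.Total := Function.surjInv ζ.proj_surjective b

variable (ζ) in
@[simp] theorem proj_pt (b : B) : ζ.proj (pt ζ b) = b := Function.surjInv_eq _ b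

variable (ζ) in
theorem pt_act (t : ζ.Total) : ∃ s, ζ.act (pt ζ (ζ.proj t)) s = t := ζ.exists_act (by simp)

variable (a) in
/-- The unit of the fibre over `b`. -/
noncomputable def fone (b : B) : Assoc ζ a := mk a (pt ζ b) 1

/-- The fibrewise multiplication `[t, x] [t, y] = [t, x y]`. -/
noncomputable def fmul (p q : Assoc ζ a) : Assoc ζ a :=
  mk a (pt ζ (proj p)) (coord (pt ζ (proj p)) p * coord (pt ζ (proj p)) q)

/-- The fibrewise inverse `[t, x]⁻¹ = [t, x⁻¹]`. -/
noncomputable def finv (p : Assoc ζ a) : Assoc ζ a :=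
  mk a (pt ζ (proj p)) (coord (pt ζ (proj p)) p)⁻¹

@[simp] theorem proj_fone (b : B) : proj (fone (ζ := ζ) a b) = b := by simp [fone]
@[simp] theorem proj_fmul (p q : Assoc ζ a) : proj (fmul p q) = proj p := by simp [fmul]
@[simp] theorem proj_finv (p : Assoc ζ a) : proj (finv p) = proj p := by simp [finv]

theorem fone_proj (t : ζ.Total) : fone a (ζ.proj t) = mk a t 1 := by
  obtain ⟨s, hs⟩ := pt_act ζ t
  rw [fone]
  conv_rhs => rw [← hs, mk_act, map_one]

theorem fmul_mk (t : ζ.Total) (x y : F) : fmul (mk a t x) (mk a t y) = mk a t (x * y) := by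
  obtain ⟨s, hs⟩ := pt_act ζ t
  simp only [fmul, proj_mk]
  rw [← hs]
  simp only [ζ.proj_act, proj_pt, mk_act, coord_mk, map_mul]

theorem finv_mk (t : ζ.Total) (x : F) : finv (mk a t x) = mk a t x⁻¹ := by
  obtain ⟨s, hs⟩ := pt_act ζ t
  simp only [finv, proj_mk]
  rw [← hs]
  simp only [ζ.proj_act, proj_pt, mk_act, coord_mk, map_inv]

theorem coord_fmul (t : ζ.Total) (p q : Assoc ζ a) (hp : proj p = ζ.proj t)
    (hq : proj q = ζ.proj t) : coord t (fmul p q) = coord t p * coord t q := by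
  obtain ⟨x, rfl⟩ := exists_mk p t hp
  obtain ⟨y, rfl⟩ := exists_mk q t hq
  simp [fmul_mk]

theorem coord_finv (t : ζ.Total) (p : Assoc ζ a) (hp : proj p = ζ.proj t) :
    coord t (finv p) = (coord t p)⁻¹ := by
  obtain ⟨x, rfl⟩ := exists_mk p t hp
  simp [finv_mk]

/-! Continuity in local coordinates. -/

theorem continuous_proj : Continuous (proj : Assoc ζ a → B) := by
  refine continuous_coinduced_dom.2 ?_
  exact (ζ.proj.continuous.comp continuous_fst).comp CompactCoherentification.continuous_mk_symm

theorem isClosed_iff {A : Set (Assoc ζ a)} : IsClosed A ↔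
    ∀ K : Set (ζ.Total × F), IsCompact K →
      IsClosed (Subtype.val ⁻¹' {p : ζ.Total × F | mk a p.1 p.2 ∈ A} : Set K) := by
  rw [isClosed_coinduced, CompactCoherentification.isClosed_iff]
  rfl

theorem continuousOn_mk {Z : Type*} [TopologicalSpace Z] {K : Set Z} (hK : IsCompact K)
    {t : Z → ζ.Total} {x : Z → F} (ht : ContinuousOn t K) (hx : ContinuousOn x K) :
    ContinuousOn (fun z => mk a (t z) (x z)) K := by
  have h1 : ContinuousOn (fun z => CompactCoherentification.mk (ζ.Total × F) (t z, x z)) K :=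
    (CompactCoherentification.continuousOn_rng_of_isCompact hK).2 (ht.prodMk hx)
  have h2 : Continuous (fun p : CompactCoherentification (ζ.Total × F) =>
      mk a ((CompactCoherentification.mk _).symm p).1
        ((CompactCoherentification.mk _).symm p).2) := continuous_coinduced_rng
  exact h2.comp_continuousOn h1

theorem continuousOn_coord {C : Set B} {σ : B → ζ.Total} {c : ζ.Total → S}
    (h : ζ.IsLocTriv C σ c) :
    ContinuousOn (fun p : Assoc ζ a => coord (σ (proj p)) p) (proj ⁻¹' C) := by
  rw [continuousOn_iff_isClosed]
  intro A hA
  refine ⟨_, ?_, (Set.inter_eq_left.2 Set.inter_subset_right).symm⟩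
  rw [isClosed_iff]
  intro K hK
  have hβ : ∀ p : ζ.Total × F, ζ.proj p.1 ∈ C →
      coord (σ (proj (mk a p.1 p.2))) (mk a p.1 p.2) = a.toHom (c p.1) p.2 := by
    intro p hp
    rw [proj_mk]
    conv_lhs => rw [← h.act_coord p.1 hp]
    rw [mk_act]
    simp only [ζ.proj_act, h.proj_sec _ hp, coord_mk]
  have hD : IsClosed {p : ζ.Total × F | ζ.proj p.1 ∈ C} :=
    h.isClosed.preimage (ζ.proj.continuous.comp continuous_fst)
  have hK' : IsCompact (K ∩ {p : ζ.Total × F | ζ.proj p.1 ∈ C}) := hK.inter_right hD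
  have hcont : ContinuousOn (fun p : ζ.Total × F => a.toHom (c p.1) p.2)
      (K ∩ {p : ζ.Total × F | ζ.proj p.1 ∈ C}) := by
    refine a.kcontinuous.comp_continuousOn (g := fun p : ζ.Total × F => (c p.1, p.2)) hK' ?_
    refine ContinuousOn.prodMk ?_ continuousOn_snd
    exact h.continuousOn_coord.comp continuousOn_fst fun p hp => hp.2
  obtain ⟨u, hu, hu'⟩ := continuousOn_iff_isClosed.1 hcont A hA
  have : IsClosed (Subtype.val ⁻¹' (u ∩ {p : ζ.Total × F | ζ.proj p.1 ∈ C}) : Set K) :=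
    (hu.inter hD).preimage continuous_subtype_val
  convert! this using 1
  ext ⟨p, hp⟩
  simp only [Set.mem_preimage, Set.mem_ofPred_eq, Set.mem_inter_iff, proj_mk]
  constructor
  · rintro ⟨h1, h2⟩
    rw [← proj_mk (a := a) p.1 p.2, hβ p h2] at h1
    have : p ∈ u ∩ (K ∩ {p : ζ.Total × F | ζ.proj p.1 ∈ C}) := hu' ▸ ⟨h1, hp, h2⟩
    exact ⟨this.1, h2⟩
  · rintro ⟨h1, h2⟩
    have : p ∈ (fun p : ζ.Total × F => a.toHom (c p.1) p.2) ⁻¹' A ∩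
        (K ∩ {p : ζ.Total × F | ζ.proj p.1 ∈ C}) := by rw [hu']; exact ⟨h1, hp, h2⟩
    refine ⟨?_, h2⟩
    rw [← proj_mk (a := a) p.1 p.2, hβ p h2]
    exact this.1

theorem continuous_of_coord {Z : Type*} [TopologicalSpace Z] [CompactSpace Z] {f : Z → B}
    (hf : Continuous f) {α : Z → Assoc ζ a} (hα : ∀ z, proj (α z) = f z)
    (h : ∀ b, ∃ C ∈ 𝓝 b, ∃ σ c, ζ.IsLocTriv C σ c ∧
      ContinuousOn (fun z => coord (σ (f z)) (α z)) (f ⁻¹' C)) : Continuous α := by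
  rw [continuous_iff_continuousAt]
  intro z
  obtain ⟨C, hC, σ, c, hl, hcont⟩ := h (f z)
  have hK : IsCompact (f ⁻¹' C) := (hl.isClosed.preimage hf).isCompact
  have h1 : ContinuousOn (fun z => mk a (σ (f z)) (coord (σ (f z)) (α z))) (f ⁻¹' C) :=
    continuousOn_mk hK (hl.continuousOn_sec.comp hf.continuousOn fun _ hz => hz) hcont
  have h2 : ContinuousOn α (f ⁻¹' C) := h1.congr fun z hz =>
    (mk_coord _ _ (by rw [hα, hl.proj_sec _ hz])).symm
  exact h2.continuousAt (hf.continuousAt.preimage_mem_nhds hC)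

theorem continuousOn_coord_comp {Z : Type*} [TopologicalSpace Z] {f : Z → B}
    {α : Z → Assoc ζ a} (hα : ∀ z, proj (α z) = f z) (hc : Continuous α)
    {C : Set B} {σ : B → ζ.Total} {c : ζ.Total → S} (h : ζ.IsLocTriv C σ c) :
    ContinuousOn (fun z => coord (σ (f z)) (α z)) (f ⁻¹' C) := by
  have := (continuousOn_coord (a := a) h).comp (f := α) (s := f ⁻¹' C) hc.continuousOn
    (fun z hz => by simpa [hα] using hz)
  refine this.congr fun z _ => ?_
  simp [hα]

theorem continuous_fmul [RegularSpace B] [KGroup F] {Z : Type*} [TopologicalSpace Z] [CompactSpace Z]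
    {α β : Z → Assoc ζ a} (h : ∀ z, proj (α z) = proj (β z)) (hα : Continuous α)
    (hβ : Continuous β) : Continuous fun z => fmul (α z) (β z) := by
  have hf : Continuous fun z => proj (α z) := continuous_proj.comp hα
  refine continuous_of_coord hf (by simp) fun b => ?_
  obtain ⟨C, hC, σ, c, hl⟩ := ζ.exists_isLocTriv b
  refine ⟨C, hC, σ, c, hl, ?_⟩
  have h1 := continuousOn_coord_comp (f := fun z => proj (α z)) (fun z => rfl) hα hl
  have h2 := continuousOn_coord_comp (f := fun z => proj (α z)) (fun z => (h z).symm) hβ hl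
  have h3 := KGroup.kcontinuous_mul.comp_continuousOn (hl.isClosed.preimage hf).isCompact
    (h1.prodMk h2)
  refine h3.congr fun z hz => ?_
  have hz' : proj (α z) = ζ.proj (σ (proj (α z))) := (hl.proj_sec _ hz).symm
  exact coord_fmul _ _ _ hz' ((h z).symm.trans hz')

theorem continuous_finv [RegularSpace B] [KGroup F] {Z : Type*} [TopologicalSpace Z] [CompactSpace Z]
    {α : Z → Assoc ζ a} (hα : Continuous α) : Continuous fun z => finv (α z) := by
  have hf : Continuous fun z => proj (α z) := continuous_proj.comp hα
  refine continuous_of_coord hf (by simp) fun b => ?_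
  obtain ⟨C, hC, σ, c, hl⟩ := ζ.exists_isLocTriv b
  refine ⟨C, hC, σ, c, hl, ?_⟩
  have h1 := continuousOn_coord_comp (f := fun z => proj (α z)) (fun z => rfl) hα hl
  have h3 := KGroup.kcontinuous_inv.comp_continuousOn (hl.isClosed.preimage hf).isCompact h1
  refine h3.congr fun z hz => ?_
  exact coord_finv _ _ (hl.proj_sec _ hz).symm

variable (ζ a) in
theorem continuous_fone [RegularSpace B] [CompactSpace B] : Continuous fun b => fone (ζ := ζ) a b := by
  refine continuous_of_coord continuous_id (by simp) fun b => ?_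
  obtain ⟨C, hC, σ, c, hl⟩ := ζ.exists_isLocTriv b
  refine ⟨C, hC, σ, c, hl, ?_⟩
  refine (continuousOn_const (c := (1 : F))).congr fun z hz => ?_
  have hz' : z = ζ.proj (σ z) := (hl.proj_sec _ hz).symm
  have : fone (ζ := ζ) a z = mk a (σ z) 1 := by rw [← fone_proj, ← hz']
  simp [this]

/-- The inverse of the isomorphism of fibres induced by a bundle map: `[Φ t, x] ↦ [t, x]`. -/
noncomputable def fpull {ζ' : PrincipalBundle S B'} {f : C(B', B)} (Φ : ζ'.Hom ζ f) (b : B')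
    (p : Assoc ζ a) : Assoc ζ' a :=
  mk a (pt ζ' b) (coord (Φ.toMap (pt ζ' b)) p)

@[simp] theorem proj_fpull {ζ' : PrincipalBundle S B'} {f : C(B', B)} (Φ : ζ'.Hom ζ f) (b : B')
    (p : Assoc ζ a) : proj (fpull Φ b p) = b := by simp [fpull]

theorem fpull_mk {ζ' : PrincipalBundle S B'} {f : C(B', B)} (Φ : ζ'.Hom ζ f) (t : ζ'.Total)
    (x : F) : fpull Φ (ζ'.proj t) (mk a (Φ.toMap t) x) = mk a t x := by
  obtain ⟨s, hs⟩ := pt_act ζ' t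
  rw [fpull]
  rw [← hs]
  simp only [ζ'.proj_act, proj_pt, Φ.map_act, mk_act, coord_mk]

theorem coord_fpull {ζ' : PrincipalBundle S B'} {f : C(B', B)} (Φ : ζ'.Hom ζ f) (t : ζ'.Total)
    (p : Assoc ζ a) (hp : proj p = f (ζ'.proj t)) :
    coord t (fpull Φ (ζ'.proj t) p) = coord (Φ.toMap t) p := by
  obtain ⟨x, rfl⟩ := exists_mk p (Φ.toMap t) (by rw [hp, Φ.proj_map])
  simp [fpull_mk]

theorem continuous_fpull [RegularSpace B] [RegularSpace B'] [ContinuousInv S] {ζ' : PrincipalBundle S B'}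
    {f : C(B', B)} (Φ : ζ'.Hom ζ f) {Z : Type*} [TopologicalSpace Z] [CompactSpace Z] {g : Z → B'}
    (hg : Continuous g) {α : Z → Assoc ζ a} (hα : ∀ z, proj (α z) = f (g z)) (hc : Continuous α) :
    Continuous fun z => fpull Φ (g z) (α z) := by
  refine continuous_of_coord hg (by simp) fun b => ?_
  obtain ⟨C', hC', σ', c', hl'⟩ := ζ'.exists_isLocTriv b
  obtain ⟨C, hC, σ, c, hl⟩ := ζ.exists_isLocTriv (f b)
  have hsub : ζ'.IsLocTriv (C' ∩ f ⁻¹' C) σ' c' :=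
    ⟨hl'.isClosed.inter (hl.isClosed.preimage f.continuous),
      hl'.continuousOn_sec.mono Set.inter_subset_left, fun x hx => hl'.proj_sec x hx.1,
      hl'.continuousOn_coord.mono fun x hx => hx.1, fun t ht => hl'.act_coord t ht.1⟩
  refine ⟨C' ∩ f ⁻¹' C, Filter.inter_mem hC' (f.continuous.continuousAt.preimage_mem_nhds hC),
    σ', c', hsub, ?_⟩
  have hK : IsCompact (g ⁻¹' (C' ∩ f ⁻¹' C)) := (hsub.isClosed.preimage hg).isCompact
  have h1 : ContinuousOn (fun z => coord (σ (f (g z))) (α z)) (g ⁻¹' (C' ∩ f ⁻¹' C)) :=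
    (continuousOn_coord_comp (f := fun z => f (g z)) hα hc hl).mono fun z hz => hz.2
  have h2 : ContinuousOn (fun z => Φ.toMap (σ' (g z))) (g ⁻¹' (C' ∩ f ⁻¹' C)) :=
    Φ.toMap.continuous.comp_continuousOn
      (hl'.continuousOn_sec.comp hg.continuousOn fun z hz => hz.1)
  have hp : ∀ z ∈ g ⁻¹' (C' ∩ f ⁻¹' C), ζ.proj (Φ.toMap (σ' (g z))) = f (g z) := by
    intro z hz
    rw [Φ.proj_map, hl'.proj_sec _ hz.1]
  have h3 : ContinuousOn (fun z => c (Φ.toMap (σ' (g z)))) (g ⁻¹' (C' ∩ f ⁻¹' C)) :=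
    hl.continuousOn_coord.comp h2 fun z hz => by
      rw [Set.mem_preimage, hp z hz]; exact hz.2
  have h4 := a.kcontinuous.comp_continuousOn hK ((continuous_inv.comp_continuousOn h3).prodMk h1)
  refine h4.congr fun z hz => ?_
  have e1 : g z = ζ'.proj (σ' (g z)) := (hl'.proj_sec _ hz.1).symm
  have e2 : coord (σ' (g z)) (fpull Φ (g z) (α z)) = coord (Φ.toMap (σ' (g z))) (α z) := by
    conv_lhs => rw [show fpull Φ (g z) (α z) = fpull Φ (ζ'.proj (σ' (g z))) (α z) by rw [← e1]]
    exact coord_fpull Φ _ _ (by rw [hα, ← e1])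
  have e3 : ζ.act (σ (f (g z))) (c (Φ.toMap (σ' (g z)))) = Φ.toMap (σ' (g z)) := by
    have := hl.act_coord (Φ.toMap (σ' (g z))) (by rw [hp z hz]; exact hz.2)
    rwa [hp z hz] at this
  show coord (σ' (g z)) (fpull Φ (g z) (α z)) = _
  rw [e2]
  conv_lhs => rw [← e3]
  exact coord_act _ _ _ (by rw [hα, hl.proj_sec _ hz.2])

end Assoc

end Assoc

/-! ### Groups of sections -/

section Sections

variable {S F : Type u} [TopologicalSpace S] [Group S] [TopologicalSpace F] [Group F]
  {B B' : Type u} [TopologicalSpace B] [TopologicalSpace B']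

/-- The space of continuous sections of `T ×_S F → B`, with the compact-open topology. (The
compactly generated topology associated with it has the same continuous maps from cubes, hence the
same path components and homotopy groups.) -/
structure SectionGroup (ζ : PrincipalBundle S B) (a : AutAction S F) : Type u where
  toMap : C(B, Assoc ζ a)
  proj_toMap : ∀ b, Assoc.proj (toMap b) = b

namespace SectionGroup

variable {ζ : PrincipalBundle S B} {a : AutAction S F}

noncomputable instance : TopologicalSpace (SectionGroup ζ a) := 
  TopologicalSpace.induced toMap inferInstance

theorem continuous_toMap : Continuous (toMap : SectionGroup ζ a → C(B, Assoc ζ a)) :=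
  continuous_induced_dom

theorem ext {σ τ : SectionGroup ζ a} (h : ∀ b, σ.1 b = τ.1 b) : σ = τ := by
  cases σ; cases τ; congr; exact ContinuousMap.ext h

/-- Sections are equal if their coordinates are. -/
theorem ext_coord {σ τ : SectionGroup ζ a}
    (h : ∀ t : ζ.Total, Assoc.coord t (σ.1 (ζ.proj t)) = Assoc.coord t (τ.1 (ζ.proj t))) :
    σ = τ := by
  refine ext fun b => ?_
  have := h (Assoc.pt ζ b)
  rw [Assoc.proj_pt] at this
  exact Assoc.eq_of_coord (Assoc.pt ζ b) (by simp [σ.2]) (by simp [τ.2]) this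

variable [CompactSpace B] [T2Space B]

noncomputable instance : One (SectionGroup ζ a) where
  one := ⟨⟨fun b => Assoc.fone a b, Assoc.continuous_fone ζ a⟩, fun b => by simp⟩

theorem one_apply (b : B) : (1 : SectionGroup ζ a).1 b = Assoc.fone a b := rfl

theorem coord_one (t : ζ.Total) :
    Assoc.coord t ((1 : SectionGroup ζ a).1 (ζ.proj t)) = 1 := by
  rw [one_apply, Assoc.fone_proj, Assoc.coord_mk]

variable [KGroup F]

noncomputable instance : Mul (SectionGroup ζ a) where
  mul σ τ := ⟨⟨fun b => Assoc.fmul (σ.1 b) (τ.1 b),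
    Assoc.continuous_fmul (fun b => by rw [σ.2, τ.2]) σ.1.continuous τ.1.continuous⟩,
    fun b => by simp [σ.2]⟩

noncomputable instance : Inv (SectionGroup ζ a) where
  inv σ := ⟨⟨fun b => Assoc.finv (σ.1 b), Assoc.continuous_finv σ.1.continuous⟩,
    fun b => by simp [σ.2]⟩

theorem mul_apply (σ τ : SectionGroup ζ a) (b : B) :
    (σ * τ).1 b = Assoc.fmul (σ.1 b) (τ.1 b) := rfl

theorem inv_apply (σ : SectionGroup ζ a) (b : B) : (σ⁻¹).1 b = Assoc.finv (σ.1 b) := rfl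

theorem coord_mul (σ τ : SectionGroup ζ a) (t : ζ.Total) :
    Assoc.coord t ((σ * τ).1 (ζ.proj t)) =
      Assoc.coord t (σ.1 (ζ.proj t)) * Assoc.coord t (τ.1 (ζ.proj t)) :=
  Assoc.coord_fmul _ _ _ (σ.2 _) (τ.2 _)

theorem coord_inv (σ : SectionGroup ζ a) (t : ζ.Total) :
    Assoc.coord t ((σ⁻¹).1 (ζ.proj t)) = (Assoc.coord t (σ.1 (ζ.proj t)))⁻¹ :=
  Assoc.coord_finv _ _ (σ.2 _)

/-- Sections form a group under fibrewise multiplication. -/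
noncomputable instance : Group (SectionGroup ζ a) where
  mul_assoc σ τ ρ := ext_coord fun t => by simp only [coord_mul, mul_assoc]
  one_mul σ := ext_coord fun t => by rw [coord_mul, coord_one, one_mul]
  mul_one σ := ext_coord fun t => by rw [coord_mul, coord_one, mul_one]
  inv_mul_cancel σ := ext_coord fun t => by rw [coord_mul, coord_inv, coord_one, inv_mul_cancel]

instance : KGroup (SectionGroup ζ a) where
  kcontinuous_mul := by
    intro K hK
    have : CompactSpace K := isCompact_iff_compactSpace.1 hK
    rw [continuousOn_iff_continuous_domRestrict]
    refine continuous_induced_rng.2 (ContinuousMap.continuous_of_continuous_uncurry _ ?_)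
    refine Assoc.continuous_fmul (Z := K × B) (α := fun z => z.1.1.1.1 z.2)
      (β := fun z => z.1.1.2.1 z.2) (fun z => by rw [z.1.1.1.2, z.1.1.2.2]) ?_ ?_
    · exact continuous_eval.comp (((SectionGroup.continuous_toMap.comp continuous_fst).comp
        (continuous_subtype_val.comp continuous_fst)).prodMk continuous_snd)
    · exact continuous_eval.comp (((SectionGroup.continuous_toMap.comp continuous_snd).comp
        (continuous_subtype_val.comp continuous_fst)).prodMk continuous_snd)
  kcontinuous_inv := by
    intro K hK
    have : CompactSpace K := isCompact_iff_compactSpace.1 hK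
    rw [continuousOn_iff_continuous_domRestrict]
    refine continuous_induced_rng.2 (ContinuousMap.continuous_of_continuous_uncurry _ ?_)
    refine Assoc.continuous_finv (Z := K × B) (α := fun z => z.1.1.1 z.2) ?_
    exact continuous_eval.comp ((SectionGroup.continuous_toMap.comp
        (continuous_subtype_val.comp continuous_fst)).prodMk continuous_snd)

end SectionGroup

end Sections

/-- A group homomorphism that is continuous in the compactly generated sense. -/
structure KHom (M N : Type*) [TopologicalSpace M] [Group M] [TopologicalSpace N] [Group N] extends
    M →* N where
  kcontinuous : KContinuous toFun

/-- Pullback of sections along a bundle map `Φ` covering `f`: the value of `pull Φ σ` at `proj t` is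
`[t, x]` if that of `σ` at `f (proj t)` is `[Φ t, x]`. -/
noncomputable def SectionGroup.pull {S F : Type u} [TopologicalSpace S] [Group S] [ContinuousInv S]
    [TopologicalSpace F] [Group F] [KGroup F] {B B' : Type u} [TopologicalSpace B]
    [CompactSpace B] [T2Space B] [TopologicalSpace B'] [CompactSpace B'] [T2Space B']
    {ζ' : PrincipalBundle S B'} {ζ : PrincipalBundle S B} (a : AutAction S F) {f : C(B', B)}
    (Φ : ζ'.Hom ζ f) : KHom (SectionGroup ζ a) (SectionGroup ζ' a) where
  toFun σ := ⟨⟨fun b => Assoc.fpull Φ b (σ.1 (f b)),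
    Assoc.continuous_fpull Φ continuous_id (fun b => σ.2 _) (σ.1.continuous.comp f.continuous)⟩,
    fun b => by simp⟩
  map_one' := SectionGroup.ext_coord fun t => by
    refine (Assoc.coord_fpull Φ t _ (by rw [SectionGroup.one_apply, Assoc.proj_fone])).trans ?_
    rw [SectionGroup.coord_one, ← Φ.proj_map, SectionGroup.coord_one]
  map_mul' σ τ := SectionGroup.ext_coord fun t => by
    refine (Assoc.coord_fpull Φ t _ ((σ * τ).2 _)).trans ?_
    rw [SectionGroup.coord_mul]
    refine Eq.trans ?_ (congrArg₂ (· * ·) (Assoc.coord_fpull Φ t _ (σ.2 _))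
      (Assoc.coord_fpull Φ t _ (τ.2 _))).symm
    simp only [← Φ.proj_map]
    rw [SectionGroup.coord_mul]
  kcontinuous := by
    intro K hK
    have : CompactSpace K := isCompact_iff_compactSpace.1 hK
    rw [continuousOn_iff_continuous_domRestrict]
    refine continuous_induced_rng.2 (ContinuousMap.continuous_of_continuous_uncurry _ ?_)
    refine Assoc.continuous_fpull Φ (Z := K × B') (g := fun z => z.2)
      (α := fun z => z.1.1.1 (f z.2)) continuous_snd (fun z => z.1.1.2 _) ?_
    exact continuous_eval.comp ((SectionGroup.continuous_toMap.comp
        (continuous_subtype_val.comp continuous_fst)).prodMk (f.continuous.comp continuous_snd))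

/-! ### Homotopy groups and Samelson products -/

section Homotopy

variable {M N : Type u} [TopologicalSpace M] [Group M] [TopologicalSpace N] [Group N]

theorem KGroup.continuous_mul_of_compact [KGroup M] {W : Type*} [TopologicalSpace W]
    [CompactSpace W] {f g : W → M} (hf : Continuous f) (hg : Continuous g) :
    Continuous fun x => f x * g x :=
  (KGroup.kcontinuous_mul (M := M)).continuous_comp (hf.prodMk hg)

theorem KGroup.continuous_inv_of_compact [KGroup M] {W : Type*} [TopologicalSpace W]
    [CompactSpace W] {f : W → M} (hf : Continuous f) : Continuous fun x => (f x)⁻¹ :=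
  (KGroup.kcontinuous_inv (M := M)).continuous_comp hf

theorem KGroup.continuous_commutator_of_compact [KGroup M] {W : Type*} [TopologicalSpace W]
    [CompactSpace W] {f g : W → M} (hf : Continuous f) (hg : Continuous g) :
    Continuous fun x => f x * g x * (f x)⁻¹ * (g x)⁻¹ := by
  exact continuous_mul_of_compact (continuous_mul_of_compact (continuous_mul_of_compact hf hg)
    (continuous_inv_of_compact hf)) (continuous_inv_of_compact hg)

variable (M) in
/-- The identity component `M_∘`: the path component of `1`. -/
def idComponent [KGroup M] : Subgroup M where
  carrier := {x | Joined 1 x}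
  one_mem' := Joined.refl 1
  mul_mem' := by
    rintro x y ⟨p⟩ ⟨q⟩
    exact ⟨⟨⟨fun t => p t * q t, KGroup.continuous_mul_of_compact p.continuous q.continuous⟩,
      by simp, by simp⟩⟩
  inv_mem' := by
    rintro x ⟨p⟩
    exact ⟨⟨⟨fun t => (p t)⁻¹, KGroup.continuous_inv_of_compact p.continuous⟩, by simp, by simp⟩⟩

instance [KGroup M] (H : Subgroup M) : KGroup H where
  kcontinuous_mul K hK := by
    rw [continuousOn_iff_continuous_domRestrict]
    have : CompactSpace K := isCompact_iff_compactSpace.1 hK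
    refine Continuous.subtype_mk (p := fun x => x ∈ H)
      (f := fun z : K => (z.1.1 : M) * (z.1.2 : M)) ?_ _
    exact KGroup.continuous_mul_of_compact (by fun_prop) (by fun_prop)
  kcontinuous_inv K hK := by
    rw [continuousOn_iff_continuous_domRestrict]
    have : CompactSpace K := isCompact_iff_compactSpace.1 hK
    refine Continuous.subtype_mk (p := fun x => x ∈ H) (f := fun z : K => (z.1 : M)⁻¹) ?_ _
    exact KGroup.continuous_inv_of_compact (by fun_prop)

/-- The restriction of a homomorphism to identity components. -/
def KHom.idComponentMap [KGroup M] [KGroup N] (φ : KHom M N) :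
    KHom (idComponent M) (idComponent N) where
  toFun x := ⟨φ.toMonoidHom x, by
    obtain ⟨p⟩ : Joined 1 x.1 := x.2
    exact ⟨⟨⟨fun t => φ.toMonoidHom (p t), φ.kcontinuous.continuous_comp p.continuous⟩,
      by simp, by simp⟩⟩⟩
  map_one' := Subtype.ext (map_one φ.toMonoidHom)
  map_mul' x y := Subtype.ext (map_mul φ.toMonoidHom x.1 y.1)
  kcontinuous K hK := by
    rw [continuousOn_iff_continuous_domRestrict]
    have : CompactSpace K := isCompact_iff_compactSpace.1 hK
    refine Continuous.subtype_mk (p := fun x => x ∈ idComponent N)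
      (f := fun z : K => φ.toMonoidHom (z.1 : M)) ?_ _
    exact φ.kcontinuous.continuous_comp (by fun_prop)

instance (n : ℕ+) : Nonempty (Fin (n : ℕ)) := ⟨⟨0, n.pos⟩⟩

/-- Pointwise multiplication of two maps `(I^n, ∂I^n) → (M, 1)`. -/
def loopMul [KGroup M] {n : ℕ} (f g : GenLoop (Fin n) M 1) : GenLoop (Fin n) M 1 :=
  ⟨⟨fun y => f y * g y, KGroup.continuous_mul_of_compact f.1.continuous g.1.continuous⟩,
    fun y hy => by
      show f y * g y = 1
      rw [GenLoop.boundary f y hy, GenLoop.boundary g y hy, one_mul]⟩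

theorem loopMul_homotopic [KGroup M] {n : ℕ} {f f' g g' : GenLoop (Fin n) M 1}
    (hf : GenLoop.Homotopic f f') (hg : GenLoop.Homotopic g g') :
    GenLoop.Homotopic (loopMul f g) (loopMul f' g') := by
  obtain ⟨H⟩ := hf
  obtain ⟨L⟩ := hg
  refine ⟨⟨⟨⟨fun z => H z * L z, KGroup.continuous_mul_of_compact H.continuous L.continuous⟩,
    fun y => ?_, fun y => ?_⟩, fun t y hy => ?_⟩⟩
  · show H (0, y) * L (0, y) = f y * g y
    rw [H.apply_zero, L.apply_zero]; rfl
  · show H (1, y) * L (1, y) = f' y * g' y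
    rw [H.apply_one, L.apply_one]; rfl
  · show H (t, y) * L (t, y) = f y * g y
    rw [H.eq_fst t hy, L.eq_fst t hy]; rfl

/-- The homotopy groups of a topological group are abelian, also in degree `1`. -/
theorem homotopyGroup_mul_comm [KGroup M] (n : ℕ+) (x y : HomotopyGroup (Fin n) M (1 : M)) :
    x * y = y * x := by
  let op : HomotopyGroup (Fin n) M (1 : M) → HomotopyGroup (Fin n) M (1 : M) →
      HomotopyGroup (Fin n) M (1 : M) :=
    Quotient.map₂ loopMul fun _ _ h _ _ h' => loopMul_homotopic h h'
  have hu : EckmannHilton.IsUnital op (1 : HomotopyGroup (Fin n) M (1 : M)) :=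
    { left_id := by
        rintro ⟨f⟩
        exact congrArg (Quotient.mk _) (GenLoop.ext _ _ fun y => one_mul (f y))
      right_id := by
        rintro ⟨f⟩
        exact congrArg (Quotient.mk _) (GenLoop.ext _ _ fun y => mul_one (f y)) }
  have hu' : EckmannHilton.IsUnital (fun x y : HomotopyGroup (Fin n) M (1 : M) => x * y) 1 :=
    { left_id := one_mul, right_id := mul_one }
  refine (EckmannHilton.mul_comm hu hu' ?_).comm x y
  rintro ⟨p⟩ ⟨q⟩ ⟨r⟩ ⟨s⟩
  let i : Fin (n : ℕ) := Classical.arbitrary _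
  have key : loopMul (GenLoop.transAt i q p) (GenLoop.transAt i s r) =
      GenLoop.transAt i (loopMul q s) (loopMul p r) := by
    refine GenLoop.ext _ _ fun y => ?_
    show (GenLoop.transAt i q p) y * (GenLoop.transAt i s r) y = _
    simp only [GenLoop.transAt, GenLoop.copy, GenLoop.mk_apply, ContinuousMap.coe_mk]
    split_ifs <;> rfl
  have e1 := HomotopyGroup.mul_spec (i := i) (p := p) (q := q)
  have e2 := HomotopyGroup.mul_spec (i := i) (p := r) (q := s)
  have e3 := HomotopyGroup.mul_spec (i := i) (p := loopMul p r) (q := loopMul q s)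
  have e4 : op (⟦GenLoop.transAt i q p⟧ : HomotopyGroup (Fin n) M (1 : M))
      (⟦GenLoop.transAt i s r⟧ : HomotopyGroup (Fin n) M (1 : M)) =
      (⟦GenLoop.transAt i (loopMul q s) (loopMul p r)⟧ : HomotopyGroup (Fin n) M (1 : M)) :=
    congrArg (Quotient.mk _) key
  exact (congrArg₂ op e1 e2).trans (e4.trans e3.symm)

variable (M) in
/-- `π_n(M, 1)` for `n ≥ 1`, written additively. -/
abbrev piGroup (n : ℕ+) : Type u := Additive (HomotopyGroup (Fin n) M (1 : M))

noncomputable instance [KGroup M] (n : ℕ+) : AddCommGroup (piGroup M n) :=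
  { (inferInstance : AddGroup (piGroup M n)) with
    add_comm := fun x y => homotopyGroup_mul_comm n x.toMul y.toMul }

/-- The commutator `(y, z) ↦ f(y) g(z) f(y)⁻¹ g(z)⁻¹` of two maps `(I^p, ∂I^p) → (M, 1)` and
`(I^q, ∂I^q) → (M, 1)`. -/
def samelsonLoop [KGroup M] {p q : ℕ} (f : GenLoop (Fin p) M 1) (g : GenLoop (Fin q) M 1) :
    GenLoop (Fin (p + q)) M 1 :=
  ⟨⟨fun y => f (fun i => y (Fin.castAdd q i)) * g (fun i => y (Fin.natAdd p i)) *
      (f fun i => y (Fin.castAdd q i))⁻¹ * (g fun i => y (Fin.natAdd p i))⁻¹,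
    KGroup.continuous_commutator_of_compact (f.1.continuous.comp (by fun_prop))
      (g.1.continuous.comp (by fun_prop))⟩, by
    rintro y ⟨i, hi⟩
    show f (fun i => y (Fin.castAdd q i)) * g (fun i => y (Fin.natAdd p i)) *
      (f fun i => y (Fin.castAdd q i))⁻¹ * (g fun i => y (Fin.natAdd p i))⁻¹ = 1
    induction i using Fin.addCases with
    | left j => rw [GenLoop.boundary f _ ⟨j, hi⟩]; simp
    | right j => rw [GenLoop.boundary g _ ⟨j, hi⟩]; simp⟩

theorem samelsonLoop_homotopic [KGroup M] {p q : ℕ} {f f' : GenLoop (Fin p) M 1}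
    {g g' : GenLoop (Fin q) M 1} (hf : GenLoop.Homotopic f f') (hg : GenLoop.Homotopic g g') :
    GenLoop.Homotopic (samelsonLoop f g) (samelsonLoop f' g') := by
  obtain ⟨H⟩ := hf
  obtain ⟨L⟩ := hg
  refine ⟨⟨⟨⟨fun z => H (z.1, fun i => z.2 (Fin.castAdd q i)) *
      L (z.1, fun i => z.2 (Fin.natAdd p i)) * (H (z.1, fun i => z.2 (Fin.castAdd q i)))⁻¹ *
      (L (z.1, fun i => z.2 (Fin.natAdd p i)))⁻¹,
    KGroup.continuous_commutator_of_compact (H.continuous.comp (by fun_prop))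
      (L.continuous.comp (by fun_prop))⟩, fun y => ?_, fun y => ?_⟩, ?_⟩⟩
  · simp only [H.apply_zero, L.apply_zero]; rfl
  · simp only [H.apply_one, L.apply_one]; rfl
  · rintro t y ⟨i, hi⟩
    have hb : samelsonLoop f g y = 1 := GenLoop.boundary _ y ⟨i, hi⟩
    refine Eq.trans ?_ hb.symm
    simp only [ContinuousMap.coe_mk]
    show H (t, fun i => y (Fin.castAdd q i)) * L (t, fun i => y (Fin.natAdd p i)) *
      (H (t, fun i => y (Fin.castAdd q i)))⁻¹ * (L (t, fun i => y (Fin.natAdd p i)))⁻¹ = 1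
    induction i using Fin.addCases with
    | left j =>
      have : H (t, fun i => y (Fin.castAdd q i)) = 1 :=
        (H.eq_fst t ⟨j, hi⟩).trans (GenLoop.boundary f _ ⟨j, hi⟩)
      rw [this]; simp
    | right j =>
      have : L (t, fun i => y (Fin.natAdd p i)) = 1 :=
        (L.eq_fst t ⟨j, hi⟩).trans (GenLoop.boundary g _ ⟨j, hi⟩)
      rw [this]; simp

theorem update_castAdd_castAdd {p q : ℕ} (y : Fin (p + q) → unitInterval) (i : Fin p)
    (v : unitInterval) : (fun j => Function.update y (Fin.castAdd q i) v (Fin.castAdd q j)) =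
      Function.update (fun j => y (Fin.castAdd q j)) i v := by
  funext j
  simp [Function.update_apply]

theorem update_castAdd_natAdd {p q : ℕ} (y : Fin (p + q) → unitInterval) (i : Fin p)
    (v : unitInterval) : (fun j => Function.update y (Fin.castAdd q i) v (Fin.natAdd p j)) =
      fun j => y (Fin.natAdd p j) := by
  funext j
  refine Function.update_of_ne ?_ _ _
  simp [Fin.ext_iff]; omega

theorem update_natAdd_natAdd {p q : ℕ} (y : Fin (p + q) → unitInterval) (i : Fin q)
    (v : unitInterval) : (fun j => Function.update y (Fin.natAdd p i) v (Fin.natAdd p j)) =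
      Function.update (fun j => y (Fin.natAdd p j)) i v := by
  funext j
  simp [Function.update_apply]

theorem update_natAdd_castAdd {p q : ℕ} (y : Fin (p + q) → unitInterval) (i : Fin q)
    (v : unitInterval) : (fun j => Function.update y (Fin.natAdd p i) v (Fin.castAdd q j)) =
      fun j => y (Fin.castAdd q j) := by
  funext j
  refine Function.update_of_ne ?_ _ _
  simp [Fin.ext_iff]; omega

theorem samelsonLoop_apply [KGroup M] {p q : ℕ} (f : GenLoop (Fin p) M 1)
    (g : GenLoop (Fin q) M 1) (y : Fin (p + q) → unitInterval) : samelsonLoop f g y =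
      f (fun i => y (Fin.castAdd q i)) * g (fun i => y (Fin.natAdd p i)) *
      (f fun i => y (Fin.castAdd q i))⁻¹ * (g fun i => y (Fin.natAdd p i))⁻¹ := rfl

theorem transAt_apply {p : ℕ} (i : Fin p) (f g : GenLoop (Fin p) M 1) (y : Fin p → unitInterval) :
    GenLoop.transAt i f g y = if (y i : ℝ) ≤ 1 / 2
      then f (Function.update y i <| Set.projIcc 0 1 zero_le_one (2 * y i))
      else g (Function.update y i <| Set.projIcc 0 1 zero_le_one (2 * y i - 1)) := rfl

theorem samelsonLoop_transAt_left [KGroup M] {p q : ℕ} (i : Fin p) (f f' : GenLoop (Fin p) M 1)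
    (g : GenLoop (Fin q) M 1) : samelsonLoop (GenLoop.transAt i f f') g =
      GenLoop.transAt (Fin.castAdd q i) (samelsonLoop f g) (samelsonLoop f' g) := by
  refine GenLoop.ext _ _ fun y => ?_
  simp only [transAt_apply, samelsonLoop_apply, update_castAdd_castAdd, update_castAdd_natAdd]
  split_ifs <;> rfl

theorem samelsonLoop_transAt_right [KGroup M] {p q : ℕ} (i : Fin q) (f : GenLoop (Fin p) M 1)
    (g g' : GenLoop (Fin q) M 1) : samelsonLoop f (GenLoop.transAt i g g') =
      GenLoop.transAt (Fin.natAdd p i) (samelsonLoop f g) (samelsonLoop f g') := by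
  refine GenLoop.ext _ _ fun y => ?_
  simp only [transAt_apply, samelsonLoop_apply, update_natAdd_castAdd, update_natAdd_natAdd]
  split_ifs <;> rfl

/-- The class of a map `(I^n, ∂I^n) → (M, 1)` in `π_n(M, 1)`. -/
def piMk {n : ℕ+} (f : GenLoop (Fin n) M 1) : piGroup M n :=
  Additive.ofMul (Quotient.mk (GenLoop.Homotopic.setoid (Fin n) (1 : M)) f)

theorem piMk_surjective {n : ℕ+} (x : piGroup M n) : ∃ f, piMk f = x := by
  obtain ⟨f, hf⟩ := Quotient.exists_rep x.toMul
  exact ⟨f, congrArg Additive.ofMul hf⟩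

theorem piMk_add [KGroup M] {n : ℕ+} (i : Fin n) (f g : GenLoop (Fin n) M 1) :
    piMk f + piMk g = piMk (GenLoop.transAt i g f) :=
  congrArg Additive.ofMul (HomotopyGroup.mul_spec (i := i) (p := f) (q := g))

/-- The Samelson product on homotopy classes. -/
def samelsonFun [KGroup M] (p q : ℕ+) (x : piGroup M p) (y : piGroup M q) : piGroup M (p + q) :=
  Additive.ofMul (Quotient.map₂ (samelsonLoop (M := M) (p := p) (q := q))
    (fun _ _ h _ _ h' => samelsonLoop_homotopic h h') x.toMul y.toMul)

theorem samelsonFun_mk [KGroup M] {p q : ℕ+} (f : GenLoop (Fin p) M 1)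
    (g : GenLoop (Fin q) M 1) :
    samelsonFun p q (piMk f) (piMk g) = piMk (n := p + q) (samelsonLoop f g) := rfl

theorem samelsonFun_add_left [KGroup M] {p q : ℕ+} (x x' : piGroup M p) (y : piGroup M q) :
    samelsonFun p q (x + x') y = samelsonFun p q x y + samelsonFun p q x' y := by
  obtain ⟨f, rfl⟩ := piMk_surjective x
  obtain ⟨f', rfl⟩ := piMk_surjective x'
  obtain ⟨g, rfl⟩ := piMk_surjective y
  let i : Fin (p : ℕ) := Classical.arbitrary _
  rw [piMk_add i, samelsonFun_mk, samelsonFun_mk, samelsonFun_mk]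
  refine (congrArg (piMk (n := p + q)) (samelsonLoop_transAt_left i f' f g)).trans ?_
  exact (piMk_add (n := p + q) (Fin.castAdd q i) _ _).symm

theorem samelsonFun_add_right [KGroup M] {p q : ℕ+} (x : piGroup M p) (y y' : piGroup M q) :
    samelsonFun p q x (y + y') = samelsonFun p q x y + samelsonFun p q x y' := by
  obtain ⟨f, rfl⟩ := piMk_surjective x
  obtain ⟨g, rfl⟩ := piMk_surjective y
  obtain ⟨g', rfl⟩ := piMk_surjective y'
  let i : Fin (q : ℕ) := Classical.arbitrary _
  rw [piMk_add i, samelsonFun_mk, samelsonFun_mk, samelsonFun_mk]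
  refine (congrArg (piMk (n := p + q)) (samelsonLoop_transAt_right i f g' g)).trans ?_
  exact (piMk_add (n := p + q) (Fin.natAdd p i) _ _).symm

/-- The map on homotopy groups induced by a homomorphism. -/
noncomputable def piMap [KGroup M] [KGroup N] (φ : KHom M N) (n : ℕ+) : piGroup M n →+ piGroup N n :=
  AddMonoidHom.mk'
    (fun x => Additive.ofMul (Quotient.map
      (fun f : GenLoop (Fin n) M 1 => (⟨⟨fun y => φ.toMonoidHom (f y),
        φ.kcontinuous.continuous_comp f.1.continuous⟩, fun y hy => by
          show φ.toMonoidHom (f y) = 1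
          rw [GenLoop.boundary f y hy, map_one]⟩ : GenLoop (Fin n) N 1))
      (by
        rintro f f' ⟨H⟩
        refine ⟨⟨⟨⟨fun z => φ.toMonoidHom (H z), φ.kcontinuous.continuous_comp H.continuous⟩,
          fun y => ?_, fun y => ?_⟩, fun t y hy => ?_⟩⟩
        · exact congrArg φ.toMonoidHom (H.apply_zero y)
        · exact congrArg φ.toMonoidHom (H.apply_one y)
        · exact congrArg φ.toMonoidHom (H.eq_fst t hy)) x.toMul))
    (by
      intro x x'
      obtain ⟨f, rfl⟩ := piMk_surjective x
      obtain ⟨f', rfl⟩ := piMk_surjective x'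
      let i : Fin (n : ℕ) := Classical.arbitrary _
      rw [piMk_add i]
      refine Eq.trans ?_ (piMk_add i _ _).symm
      refine congrArg piMk (GenLoop.ext _ _ fun y => ?_)
      rw [transAt_apply]
      show φ.toMonoidHom (GenLoop.transAt i f' f y) = _
      rw [transAt_apply]
      split_ifs <;> rfl)

theorem KHom.map_comm (φ : KHom M N) (x y : M) : φ.toMonoidHom (x * y * x⁻¹ * y⁻¹) =
    φ.toMonoidHom x * φ.toMonoidHom y * (φ.toMonoidHom x)⁻¹ * (φ.toMonoidHom y)⁻¹ := by
  simp only [map_mul, map_inv]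

theorem piMap_samelson [KGroup M] [KGroup N] (φ : KHom M N) (p q : ℕ+) (x : piGroup M p)
    (y : piGroup M q) :
    piMap φ (p + q) (samelsonFun p q x y) = samelsonFun p q (piMap φ p x) (piMap φ q y) := by
  obtain ⟨f, rfl⟩ := piMk_surjective x
  obtain ⟨g, rfl⟩ := piMk_surjective y
  refine congrArg (piMk (n := p + q)) (GenLoop.ext _ _ fun z => ?_)
  exact φ.map_comm _ _

theorem piMap_congr [KGroup M] [KGroup N] {φ ψ : KHom M N}
    (h : ∀ x, φ.toMonoidHom x = ψ.toMonoidHom x) (n : ℕ+) (x : piGroup M n) :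
    piMap φ n x = piMap ψ n x := by
  obtain ⟨f, rfl⟩ := piMk_surjective x
  exact congrArg piMk (GenLoop.ext _ _ fun z => h _)

theorem piMap_id [KGroup M] {φ : KHom M M} (h : ∀ x, φ.toMonoidHom x = x) (n : ℕ+)
    (x : piGroup M n) : piMap φ n x = x := by
  obtain ⟨f, rfl⟩ := piMk_surjective x
  exact congrArg piMk (GenLoop.ext _ _ fun z => h _)

theorem piMap_comp {P : Type u} [TopologicalSpace P] [Group P] [KGroup M] [KGroup N] [KGroup P]
    {φ : KHom M N} {ψ : KHom N P} {χ : KHom M P}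
    (h : ∀ x, ψ.toMonoidHom (φ.toMonoidHom x) = χ.toMonoidHom x) (n : ℕ+) (x : piGroup M n) :
    piMap ψ n (piMap φ n x) = piMap χ n x := by
  obtain ⟨f, rfl⟩ := piMk_surjective x
  exact congrArg piMk (GenLoop.ext _ _ fun z => h _)

end Homotopy

/-! ### Graded groups with a bracket -/

/-- A graded abelian group, in degrees `n ≥ 1`, with a biadditive bracket of degree zero. -/
structure BracketGroup : Type (u + 1) where
  deg : ℕ+ → Type u
  [inst : ∀ n, AddCommGroup (deg n)]
  bracket : ∀ p q, deg p →+ deg q →+ deg (p + q)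

attribute [instance] BracketGroup.inst

namespace BracketGroup

/-- A degreewise additive map. -/
abbrev GradedMap (A : BracketGroup.{u}) (A' : BracketGroup.{v}) : Type (max u v) :=
  ∀ n, A.deg n →+ A'.deg n

/-- A degreewise additive map is compatible with the brackets. -/
def PreservesBracket {A : BracketGroup.{u}} {A' : BracketGroup.{v}} (f : GradedMap A A') : Prop :=
  ∀ p q (x : A.deg p) (y : A.deg q),
    f (p + q) (A.bracket p q x y) = A'.bracket p q (f p x) (f q y)

/-- `f` is an isomorphism of graded groups with bracket. (For rational Samelson algebras this is
the same as an isomorphism of graded Lie algebras.) -/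
def IsIso {A : BracketGroup.{u}} {A' : BracketGroup.{v}} (f : GradedMap A A') : Prop :=
  (∀ n, Function.Bijective (f n)) ∧ PreservesBracket f

/-- `π_*(M, 1)` in degrees `n ≥ 1`, with the Samelson bracket
`[ , ] : π_p × π_q → π_{p+q}` induced by the commutator map. -/
noncomputable def samelson (M : Type u) [TopologicalSpace M] [Group M] [KGroup M] : BracketGroup.{u} where
  deg n := piGroup M n
  bracket p q := AddMonoidHom.mk'
    (fun x => AddMonoidHom.mk' (samelsonFun p q x) (samelsonFun_add_right x))
    (fun x x' => AddMonoidHom.ext fun y => samelsonFun_add_left x x' y)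

/-- The rationalization: `ℚ ⊗ A`, with bracket `[a ⊗ x, b ⊗ y] = ab ⊗ [x, y]`. -/
noncomputable def rat (A : BracketGroup.{u}) : BracketGroup.{u} where
  deg n := ℚ ⊗[ℤ] A.deg n
  bracket p q := AddMonoidHom.mk'
    (fun x => (TensorProduct.map₂ (LinearMap.mul ℤ ℚ)
      (AddMonoidHom.toIntLinearMap <| AddMonoidHom.mk'
        (fun x : A.deg p => (A.bracket p q x).toIntLinearMap)
        (fun x x' => LinearMap.ext fun y => by simp)) x).toAddMonoidHom)
    (fun x x' => AddMonoidHom.ext fun y => by simp)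

noncomputable instance (A : BracketGroup.{u}) (n : ℕ+) : Module ℚ (A.rat.deg n) :=
  inferInstanceAs (Module ℚ (ℚ ⊗[ℤ] A.deg n))

/-- The `ℚ`-linear map induced by `f` on rationalizations. -/
noncomputable def ratMap {A : BracketGroup.{u}} {A' : BracketGroup.{v}} (f : GradedMap A A')
    (n : ℕ+) : A.rat.deg n →ₗ[ℚ] A'.rat.deg n :=
  LinearMap.baseChange ℚ (f n).toIntLinearMap

section Limit

/-- A direct system of graded groups with bracket. -/
structure System (ι : Type w) [Preorder ι] where
  obj : ι → BracketGroup.{u}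
  map : ∀ i j, i ≤ j → GradedMap (obj i) (obj j)
  map_bracket : ∀ i j h, PreservesBracket (map i j h)
  directed : ∀ n, DirectedSystem (fun i => (obj i).deg n) fun i j h => map i j h n

attribute [instance] System.directed

variable {ι : Type w} [Preorder ι] [IsDirectedOrder ι]

/-- The degree `n` part of the direct limit. -/
abbrev System.Lim (D : System.{u, w} ι) (n : ℕ+) : Type (max u w) :=
  DirectLimit (fun i => (D.obj i).deg n) fun i j h => D.map i j h n

/-- The class in the direct limit of an element at stage `i`. -/
def System.of (D : System.{u, w} ι) {n : ℕ+} (i : ι) (x : (D.obj i).deg n) : D.Lim n := ⟦⟨i, x⟩⟧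

/-- The bracket on the direct limit: on representatives at a common stage it is that of the
system. -/
noncomputable def System.limBracket (D : System.{u, w} ι) (p q : ℕ+) :
    D.Lim p → D.Lim q → D.Lim (p + q) :=
  DirectLimit.map₂ (fun i j h => D.map i j h p) (fun i j h => D.map i j h q)
    (fun i j h => D.map i j h (p + q)) (fun i x y => (D.obj i).bracket p q x y)
    (fun i j h x y => D.map_bracket i j h p q x y)

theorem System.limBracket_of (D : System.{u, w} ι) {p q : ℕ+} (i : ι) (x : (D.obj i).deg p)
    (y : (D.obj i).deg q) :
    D.limBracket p q (D.of i x) (D.of i y) = D.of i ((D.obj i).bracket p q x y) :=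
  DirectLimit.map₂_def ..

theorem System.of_add (D : System.{u, w} ι) [Nonempty ι] {n : ℕ+} (i : ι)
    (x y : (D.obj i).deg n) : D.of i x + D.of i y = D.of i (x + y) :=
  DirectLimit.add_def ..

theorem System.of_map (D : System.{u, w} ι) {n : ℕ+} (i j : ι) (h : i ≤ j)
    (x : (D.obj i).deg n) : D.of i x = D.of j (D.map i j h n x) :=
  DirectLimit.eq_of_le (f := fun i j h => D.map i j h n) (⟨i, x⟩ : Σ i, (D.obj i).deg n) j h

theorem System.exists_rep (D : System.{u, w} ι) {p q : ℕ+} (x x' : D.Lim p) (y y' : D.Lim q) :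
    ∃ i, ∃ (b b' : (D.obj i).deg p) (c c' : (D.obj i).deg q),
      x = D.of i b ∧ x' = D.of i b' ∧ y = D.of i c ∧ y' = D.of i c' := by
  obtain ⟨i, b, b', rfl, rfl⟩ := DirectLimit.exists_eq_mk₂ _ x x'
  obtain ⟨j, c, c', rfl, rfl⟩ := DirectLimit.exists_eq_mk₂ _ y y'
  obtain ⟨k, hi, hj⟩ := exists_ge_ge i j
  exact ⟨k, _, _, _, _, D.of_map i k hi b, D.of_map i k hi b', D.of_map j k hj c,
    D.of_map j k hj c'⟩

variable [Nonempty ι]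

theorem System.limBracket_add_left (D : System.{u, w} ι) {p q : ℕ+} (x x' : D.Lim p)
    (y : D.Lim q) :
    D.limBracket p q (x + x') y = D.limBracket p q x y + D.limBracket p q x' y := by
  obtain ⟨i, b, b', c, _, rfl, rfl, rfl, _⟩ := D.exists_rep x x' y y
  rw [D.of_add, D.limBracket_of, D.limBracket_of, D.limBracket_of, D.of_add, map_add,
    AddMonoidHom.add_apply]

theorem System.limBracket_add_right (D : System.{u, w} ι) {p q : ℕ+} (x : D.Lim p)
    (y y' : D.Lim q) :
    D.limBracket p q x (y + y') = D.limBracket p q x y + D.limBracket p q x y' := by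
  obtain ⟨i, b, _, c, c', rfl, _, rfl, rfl⟩ := D.exists_rep x x y y'
  rw [D.of_add, D.limBracket_of, D.limBracket_of, D.limBracket_of, D.of_add, map_add]

/-- The direct limit of graded groups with bracket. -/
noncomputable def System.lim (D : System.{u, w} ι) : BracketGroup.{max u w} where
  deg n := D.Lim n
  bracket p q := AddMonoidHom.mk'
    (fun x => AddMonoidHom.mk' (D.limBracket p q x) (D.limBracket_add_right x))
    (fun x x' => AddMonoidHom.ext fun y => D.limBracket_add_left x x' y)

/-- The map out of the direct limit induced by a compatible family. -/
noncomputable def System.desc (D : System.{u, w} ι) (A : BracketGroup.{v})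
    (g : ∀ i, GradedMap (D.obj i) A)
    (hg : ∀ i j h n x, g i n x = g j n (D.map i j h n x)) : GradedMap D.lim A := fun n =>
  AddMonoidHom.mk' (DirectLimit.lift (fun i j h => D.map i j h n) (fun i x => g i n x)
    fun i j h x => hg i j h n x)
    (fun x y => DirectLimit.lift_add (f := fun i j h => D.map i j h n) (fun i => g i n) _ x y)

end Limit

end BracketGroup

/-! ### Gauge groups over an inverse limit of finite complexes -/

section Gauge

variable {B B' B'' : Type u} [TopologicalSpace B] [TopologicalSpace B'] [TopologicalSpace B'']

/-- The gauge group `𝒢(ζ)` of a principal `G`-bundle: sections of `Ad(ζ) = T ×_G G^ad`. -/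
abbrev GaugeGroup {G : Type u} [TopologicalSpace G] [Group G] [KGroup G]
    (ζ : PrincipalBundle G B) : Type u :=
  SectionGroup ζ (conjAction G)

/-- The projective gauge group `𝒫(ζ)` of a principal `PG`-bundle: sections of
`Pad(ζ) = T ×_{PG} G^ad`. -/
abbrev ProjGaugeGroup {G : Type u} [TopologicalSpace G] [Group G] [T2Space G]
    [CompactlyCoherentSpace G] [KGroup G] (ζ : PrincipalBundle (PG G) B) : Type u :=
  SectionGroup ζ (projConjAction G)

/-- A presentation of `X` as the inverse limit of a system of finite complexes indexed by `J`. -/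
structure InverseLimitPresentation (X : Type u) [TopologicalSpace X] (J : Type v) [Preorder J] where
  space : J → Type u
  [top : ∀ j, TopologicalSpace (space j)]
  [t2 : ∀ j, T2Space (space j)]
  [compact : ∀ j, CompactSpace (space j)]
  finite : ∀ j, IsFiniteCW (space j)
  /-- The bonding map `X_i → X_j` for `j ≤ i`. -/
  map : ∀ j i, j ≤ i → C(space i, space j)
  map_self : ∀ j x, map j j le_rfl x = x
  map_map : ∀ k j i (hkj : k ≤ j) (hji : j ≤ i) x,
    map k j hkj (map j i hji x) = map k i (hkj.trans hji) x
  proj : ∀ j, C(X, space j)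
  map_proj : ∀ j i (h : j ≤ i) x, map j i h (proj i x) = proj j x
  isHomeomorph : IsHomeomorph fun x =>
    (⟨fun j => proj j x, fun j i h => map_proj j i h x⟩ :
      {y : ∀ j, space j // ∀ j i (h : j ≤ i), map j i h (y i) = y j})

attribute [instance] InverseLimitPresentation.top InverseLimitPresentation.t2
  InverseLimitPresentation.compact

variable {S : Type u} [TopologicalSpace S] [Group S] {X : Type u} [TopologicalSpace X]
  {J : Type v} [Preorder J] (P : InverseLimitPresentation X J) (m : J)

instance [IsDirectedOrder J] : IsDirectedOrder {j : J // m ≤ j} where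
  directed i j := by
    obtain ⟨k, hi, hj⟩ := exists_ge_ge i.1 j.1
    exact ⟨⟨k, i.2.trans hi⟩, hi, hj⟩

instance : Nonempty {j : J // m ≤ j} := ⟨⟨m, le_rfl⟩⟩

variable (ζm : PrincipalBundle S (P.space m))

/-- The bundle `ζ_j` over `X_j`, for `j ≥ m`: the pullback of `ζ_m`. -/
def stageBundle (j : {j : J // m ≤ j}) : PrincipalBundle S (P.space j) :=
  ζm.pullback (P.map m j j.2)

/-- The canonical bundle map `ζ_j → ζ_i`, for `i ≤ j`, covering `X_j → X_i`. -/
def stageMap (i j : {j : J // m ≤ j}) (h : i ≤ j) :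
    (stageBundle P m ζm j).Hom (stageBundle P m ζm i) (P.map i j h) :=
  ζm.pullbackMap _ _ _ fun x => P.map_map m i j i.2 h x

theorem stageMap_stageMap {i j k : {j : J // m ≤ j}} (hij : i ≤ j) (hjk : j ≤ k)
    (t : (stageBundle P m ζm k).Total) :
    (stageMap P m ζm i j hij).toMap ((stageMap P m ζm j k hjk).toMap t) =
      (stageMap P m ζm i k (hij.trans hjk)).toMap t := by
  refine Subtype.ext (Prod.ext ?_ rfl)
  exact P.map_map i j k hij hjk _

theorem stageMap_self (i : {j : J // m ≤ j}) (t : (stageBundle P m ζm i).Total) :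
    (stageMap P m ζm i i le_rfl).toMap t = t := by
  refine Subtype.ext (Prod.ext ?_ rfl)
  exact P.map_self i _

/-- The bundle map `ζ → ζ_j` covering `X → X_j` that is determined by `Ψ : ζ → ζ_m`. -/
def toStage {ζ : PrincipalBundle S X} (Ψ : ζ.Hom ζm (P.proj m)) (j : {j : J // m ≤ j}) :
    ζ.Hom (stageBundle P m ζm j) (P.proj j) :=
  Ψ.toPullback (P.map m j j.2) (P.proj j) fun x => P.map_proj m j j.2 x

theorem stageMap_toStage {ζ : PrincipalBundle S X} (Ψ : ζ.Hom ζm (P.proj m))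
    (i j : {j : J // m ≤ j}) (h : i ≤ j) (t : ζ.Total) :
    (stageMap P m ζm i j h).toMap ((toStage P m ζm Ψ j).toMap t) =
      (toStage P m ζm Ψ i).toMap t := by
  refine Subtype.ext (Prod.ext ?_ rfl)
  exact P.map_proj i j h _

variable [ContinuousInv S] {F : Type u} [TopologicalSpace F] [Group F] [KGroup F]
  (a : AutAction S F)

theorem SectionGroup.coord_pull [CompactSpace B] [T2Space B] [CompactSpace B'] [T2Space B']
    {ζ' : PrincipalBundle S B'} {ζ : PrincipalBundle S B} {f : C(B', B)} (Φ : ζ'.Hom ζ f)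
    (σ : SectionGroup ζ a) (t : ζ'.Total) :
    Assoc.coord t (((pull a Φ).toMonoidHom σ).toMap (ζ'.proj t)) =
      Assoc.coord (Φ.toMap t) (σ.toMap (ζ.proj (Φ.toMap t))) := by
  rw [Φ.proj_map]
  exact Assoc.coord_fpull Φ t _ (σ.2 _)

theorem SectionGroup.pull_pull [CompactSpace B] [T2Space B] [CompactSpace B'] [T2Space B']
    [CompactSpace B''] [T2Space B''] {ζ'' : PrincipalBundle S B''} {ζ' : PrincipalBundle S B'}
    {ζ : PrincipalBundle S B} {f : C(B', B)} {g : C(B'', B')} {k : C(B'', B)} (Φ : ζ'.Hom ζ f)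
    (Ψ : ζ''.Hom ζ' g) (Χ : ζ''.Hom ζ k) (h : ∀ t, Φ.toMap (Ψ.toMap t) = Χ.toMap t)
    (σ : SectionGroup ζ a) :
    (pull a Ψ).toMonoidHom ((pull a Φ).toMonoidHom σ) = (pull a Χ).toMonoidHom σ :=
  ext_coord fun t => by rw [coord_pull, coord_pull, coord_pull, h]

theorem SectionGroup.pull_id [CompactSpace B] [T2Space B] {ζ : PrincipalBundle S B} {f : C(B, B)}
    (Φ : ζ.Hom ζ f) (h : ∀ t, Φ.toMap t = t) (σ : SectionGroup ζ a) :
    (pull a Φ).toMonoidHom σ = σ :=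
  ext_coord fun t => by rw [coord_pull, h]

/-- `π_*(Γ_∘)`, with its Samelson bracket, for the identity component `Γ_∘` of a group of
sections. -/
noncomputable def sectionSamelson [CompactSpace B] [T2Space B] (ζ : PrincipalBundle S B) :
    BracketGroup.{u} :=
  BracketGroup.samelson (idComponent (SectionGroup ζ a))

/-- The map `π_*(Γ(ζ)_∘) → π_*(Γ(ζ')_∘)` induced by pulling back sections along a bundle map. -/
noncomputable def sectionSamelsonMap [CompactSpace B] [T2Space B] [CompactSpace B'] [T2Space B']
    {ζ' : PrincipalBundle S B'} {ζ : PrincipalBundle S B} {f : C(B', B)} (Φ : ζ'.Hom ζ f) :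
    (sectionSamelson a ζ).GradedMap (sectionSamelson a ζ') :=
  piMap (SectionGroup.pull a Φ).idComponentMap

variable [CompactSpace X] [T2Space X] [IsDirectedOrder J]

/-- The direct system `j ↦ π_*(Γ(ζ_j)_∘)`, `j ≥ m`, with its Samelson brackets; the transition maps
are induced by pulling back sections along `X_j → X_i`. -/
noncomputable def stageSystem : BracketGroup.System.{u, v} {j : J // m ≤ j} where
  obj j := sectionSamelson a (stageBundle P m ζm j)
  map i j h := sectionSamelsonMap a (stageMap P m ζm i j h)
  map_bracket _ _ _ p q x y := piMap_samelson _ p q x y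
  directed n :=
    { map_self := fun i x => piMap_id (fun _ => Subtype.ext (SectionGroup.pull_id a _
        (stageMap_self P m ζm i) _)) n x
      map_map := fun _ _ _ hij hjk x => piMap_comp (fun _ => Subtype.ext
        (SectionGroup.pull_pull a _ _ _ (stageMap_stageMap P m ζm hij hjk) _)) n x }

/-- For a principal bundle `ζ` over `X` and a bundle map `Ψ : ζ → ζ_m` covering `X → X_m`, the
canonical map from the direct limit of the `π_*(Γ(ζ_j)_∘)`, `j ≥ m`, to `π_*(Γ(ζ)_∘)`. It is induced
by the pullbacks of sections along the bundle maps `ζ → ζ_j` covering `X → X_j`. -/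
noncomputable def limitMap {ζ : PrincipalBundle S X} (Ψ : ζ.Hom ζm (P.proj m)) :
    (stageSystem P m ζm a).lim.GradedMap (sectionSamelson a ζ) :=
  (stageSystem P m ζm a).desc (sectionSamelson a ζ)
    (fun j => sectionSamelsonMap a (toStage P m ζm Ψ j))
    (fun i j h n x => (piMap_comp (fun _ => Subtype.ext
      (SectionGroup.pull_pull a _ _ _ (stageMap_toStage P m ζm Ψ i j h) _)) n x).symm)

/-- The canonical map `colim_{j ≥ m} π_*(𝒢(ζ_j)_∘) → π_*(𝒢(ζ)_∘)` for gauge groups. -/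
noncomputable def gaugeLimitMap {G : Type u} [TopologicalSpace G] [Group G]
    [CompactlyCoherentSpace G] [KGroup G] (ζm : PrincipalBundle G (P.space m))
    {ζ : PrincipalBundle G X} (Ψ : ζ.Hom ζm (P.proj m)) :
    (stageSystem P m ζm (conjAction G)).lim.GradedMap
      (BracketGroup.samelson (idComponent (GaugeGroup ζ))) :=
  limitMap P m ζm (conjAction G) Ψ

/-- The canonical map `colim_{j ≥ m} π_*(𝒫(ζ_j)_∘) → π_*(𝒫(ζ)_∘)` for projective gauge groups. -/
noncomputable def projGaugeLimitMap {G : Type u} [TopologicalSpace G] [Group G] [T2Space G]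
    [CompactlyCoherentSpace G] [KGroup G] (ζm : PrincipalBundle (PG G) (P.space m))
    {ζ : PrincipalBundle (PG G) X} (Ψ : ζ.Hom ζm (P.proj m)) :
    (stageSystem P m ζm (projConjAction G)).lim.GradedMap
      (BracketGroup.samelson (idComponent (ProjGaugeGroup ζ))) :=
  limitMap P m ζm (projConjAction G) Ψ

end Gauge

end GaugeLimit

/-! Principal bundles over X and families of sections over X are governed by lifts into bundles
whose fibre has CW type, and such lifts are continuous with respect to inverse limits. The limit X
sits in the compact product of all X_j as the intersection of the decreasing closed sets `threads
k`, and X_k maps into `threads k` by `sec`. By compactness every neighbourhood of X in the product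
contains some `threads k`. So whatever extends from X to a neighbourhood can be restricted to a
stage.

The extension property is `SecExt`: a lift over a closed subset of a compact Hausdorff space is
vertically homotopic to one that extends to a neighbourhood. Allowing a homotopy makes the property
invariant under homotopy equivalence of the fibre. For a finite complex it is proved by attaching
cells (`HExtInto.attach_cell`); a compact image lies in a finite subcomplex, which yields all
complexes and then all spaces of CW type. `SecExt.union` patches the property over the base, so that
it passes from the fibre to principal bundles and to associated bundles. Two consequences carry the
rest: lifts over X come, up to homotopy, from a stage (`CompactSystem.exists_stage_lift`), and lifts
at a stage that become homotopic over X are homotopic at a later stage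
(`CompactSystem.exists_stage_homotopy`).

A bundle over X is descended by induction on the number of trivializing open sets. A section over
the last set is a lift into the part already descended; it is moved to a stage by a homotopy, which
is absorbed into the bundle map, and a trivial bundle is glued on along it (`exists_glue`).

For homotopy groups, all groups of sections are compared inside the one associated bundle over X_m:
a loop of sections over X_j, or over X, is a lift of the map from (I^n/∂I^n) × X_j, or (I^n/∂I^n) ×
X, to X_m. The two consequences give surjectivity and injectivity for free homotopies; dividing
fibrewise by the value at the base point makes lifts and homotopies based. The brackets are
preserved because pullback of sections is a homomorphism, and tensoring with ℚ preserves the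
isomorphism. -/

section

open Set

universe q

namespace GaugeLimit

/-! ### Vertical homotopies and extension of lifts up to homotopy. -/

section Lift

variable {E : Type*} {B : Type*} [TopologicalSpace E]

/-- The pieces `{v ≤ c}` and `{c ≤ v}` are closed in the whole space, so pasting works on an
arbitrary `S`, closed or not. The piecewise maps and homotopies below are assembled with it. -/
theorem continuousOn_ite_le {Z Y : Type*} [TopologicalSpace Z] [TopologicalSpace Y] {S : Set Z}
    {v : Z → ℝ} (hv : Continuous v) {c : ℝ} {f g : Z → Y}
    (hf : ContinuousOn f (S ∩ {z | v z ≤ c})) (hg : ContinuousOn g (S ∩ {z | c ≤ v z}))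
    (h : ∀ z ∈ S, v z = c → f z = g z) :
    ContinuousOn (fun z => if v z ≤ c then f z else g z) S := by
  have hS : S ⊆ {z | v z ≤ c} ∪ {z | c ≤ v z} := fun z _ => le_total (v z) c
  have h1 : ContinuousOn (fun z => if v z ≤ c then f z else g z) (S ∩ {z | v z ≤ c}) :=
    hf.congr fun z hz => if_pos hz.2
  have h2 : ContinuousOn (fun z => if v z ≤ c then f z else g z) (S ∩ {z | c ≤ v z}) :=
    hg.congr fun z hz => by
      by_cases hz' : v z ≤ c
      · simp only [if_pos hz']; exact h z hz.1 (le_antisymm hz' hz.2)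
      · simp only [if_neg hz']
  intro z hz
  have hc1 : IsClosed {z | v z ≤ c} := isClosed_le hv continuous_const
  have hc2 : IsClosed {z | c ≤ v z} := isClosed_le continuous_const hv
  have key : ∀ T : Set Z, IsClosed T →
      ContinuousOn (fun z => if v z ≤ c then f z else g z) (S ∩ T) →
      ContinuousWithinAt (fun z => if v z ≤ c then f z else g z) (S ∩ T) z := by
    intro T hT hc
    by_cases hzT : z ∈ T
    · exact hc z ⟨hz, hzT⟩
    · have : 𝓝[S ∩ T] z = ⊥ := by
        rw [← Filter.empty_mem_iff_bot, mem_nhdsWithin]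
        exact ⟨Tᶜ, hT.isOpen_compl, hzT, fun y hy => (hy.1 hy.2.2).elim⟩
      simp [ContinuousWithinAt, this]
  have := (key _ hc1 h1).union (key _ hc2 h2)
  rwa [← inter_union_distrib_left, inter_eq_left.2 hS] at this

/-- A homotopy over `A`, through lifts of `g` along `π`, from `f₀` to `f₁`. It is parametrized by
the real line and stationary outside of the unit interval. -/
def LiftHtpy {Z : Type*} [TopologicalSpace Z] (π : E → B) (g : Z → B) (A : Set Z)
    (f₀ f₁ : Z → E) : Prop :=
  ∃ H : Z × ℝ → E, ContinuousOn H (A ×ˢ univ) ∧ (∀ z ∈ A, ∀ t, π (H (z, t)) = g z) ∧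
    (∀ z ∈ A, ∀ t ≤ 0, H (z, t) = f₀ z) ∧ ∀ z ∈ A, ∀ t, 1 ≤ t → H (z, t) = f₁ z

namespace LiftHtpy

variable {Z : Type*} [TopologicalSpace Z] {π : E → B} {g : Z → B} {A : Set Z} {f₀ f₁ f₂ : Z → E}

theorem symm (h : LiftHtpy π g A f₀ f₁) : LiftHtpy π g A f₁ f₀ := by
  obtain ⟨H, hc, hl, h0, h1⟩ := h
  refine ⟨fun p => H (p.1, 1 - p.2), hc.comp (by fun_prop) fun p hp => ⟨hp.1, trivial⟩,
    fun z hz t => hl z hz _, fun z hz t ht => h1 z hz _ (by linarith),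
    fun z hz t ht => h0 z hz _ (by linarith)⟩

theorem trans (h : LiftHtpy π g A f₀ f₁) (h' : LiftHtpy π g A f₁ f₂) :
    LiftHtpy π g A f₀ f₂ := by
  obtain ⟨H, hc, hl, h0, h1⟩ := h
  obtain ⟨H', hc', hl', h0', h1'⟩ := h'
  refine ⟨fun p => if p.2 ≤ 1 / 2 then H (p.1, 2 * p.2) else H' (p.1, 2 * p.2 - 1), ?_, ?_, ?_, ?_⟩
  · refine continuousOn_ite_le (v := fun p : Z × ℝ => p.2) continuous_snd ?_ ?_ ?_
    · exact hc.comp (by fun_prop) fun p hp => ⟨hp.1.1, trivial⟩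
    · exact hc'.comp (by fun_prop) fun p hp => ⟨hp.1.1, trivial⟩
    · intro p hp hp2
      rw [h1 _ hp.1 _ (by linarith), h0' _ hp.1 _ (by linarith)]
  · intro z hz t
    dsimp only
    split_ifs
    exacts [hl z hz _, hl' z hz _]
  · intro z hz t ht
    dsimp only
    rw [if_pos (by linarith), h0 z hz _ (by linarith)]
  · intro z hz t ht
    dsimp only
    rw [if_neg (by linarith), h1' z hz _ (by linarith)]

theorem comp {W : Type*} [TopologicalSpace W] (h : LiftHtpy π g A f₀ f₁) {k : W → Z} {A' : Set W}
    (hk : ContinuousOn k A') (hA : MapsTo k A' A) :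
    LiftHtpy π (g ∘ k) A' (f₀ ∘ k) (f₁ ∘ k) := by
  obtain ⟨H, hc, hl, h0, h1⟩ := h
  refine ⟨fun p => H (k p.1, p.2), hc.comp ?_ fun p hp => ⟨hA hp.1, trivial⟩,
    fun z hz t => hl _ (hA hz) t, fun z hz => h0 _ (hA hz), fun z hz => h1 _ (hA hz)⟩
  exact (hk.comp continuousOn_fst fun p hp => hp.1).prodMk continuousOn_snd

theorem congr (h : LiftHtpy π g A f₀ f₁) {f₀' f₁' : Z → E} (h0 : ∀ z ∈ A, f₀' z = f₀ z)
    (h1 : ∀ z ∈ A, f₁' z = f₁ z) : LiftHtpy π g A f₀' f₁' := by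
  obtain ⟨H, hc, hl, e0, e1⟩ := h
  exact ⟨H, hc, hl, fun z hz t ht => by rw [e0 z hz t ht, h0 z hz],
    fun z hz t ht => by rw [e1 z hz t ht, h1 z hz]⟩

end LiftHtpy

variable [TopologicalSpace B]

/-- Lifts over closed subsets extend, up to homotopy, to lifts over neighbourhoods, as long as the
base point stays in `D`. -/
def SecExt (π : E → B) (D : Set B) : Prop :=
  ∀ (Z : Type w) [TopologicalSpace Z] [CompactSpace Z] [T2Space Z] (g : C(Z, B)) (A : Set Z),
    IsClosed A → A ⊆ g ⁻¹' D → ∀ σ : Z → E, ContinuousOn σ A → (∀ z ∈ A, π (σ z) = g z) →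
    ∃ N ∈ 𝓝ˢ A, ∃ τ : Z → E, ContinuousOn τ (N ∩ g ⁻¹' D) ∧ (∀ z ∈ N ∩ g ⁻¹' D, π (τ z) = g z) ∧
      LiftHtpy π g A τ σ

theorem exists_isClosed_nhdsSet {Z : Type*} [TopologicalSpace Z] [NormalSpace Z] {A N : Set Z}
    (hA : IsClosed A) (hN : N ∈ 𝓝ˢ A) : ∃ N' ∈ 𝓝ˢ A, IsClosed N' ∧ N' ⊆ N := by
  obtain ⟨U, hU, hAU, hUN⟩ := mem_nhdsSet_iff_exists.1 hN
  obtain ⟨V, hV, hAV, hVU⟩ := normal_exists_closure_subset hA hU hAU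
  exact ⟨closure V, Filter.mem_of_superset (hV.mem_nhdsSet.2 hAV) subset_closure, isClosed_closure,
    hVU.trans hUN⟩

end Lift

/-! ### The extension property is local in the base. -/

section Union

variable {E : Type*} {B : Type*} [TopologicalSpace E] [TopologicalSpace B]

/-- The sets `{u ≤ 1}` and `{0 ≤ u}` overlap in a band, which leaves room to interpolate. The first
property yields a lift `τ₁` near the part of `A` with `v ≤ 1` and a homotopy `H₁` from it to `σ`.
The second is applied on the cylinder `Z × I` instead of `Z`: there it sees `τ₁` at the bottom, `H₁`
over the band and `σ` at the top, and so it produces one lift that passes from `τ₁` to an extension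
of `σ` as `v` crosses the band. -/
theorem SecExt.union {π : E → B} {D : Set B} (hD : IsClosed D) (u : C(B, ℝ))
    (h₁ : SecExt.{w} π (D ∩ {b | u b ≤ 1})) (h₂ : SecExt.{w} π (D ∩ {b | 0 ≤ u b})) :
    SecExt.{w} π D := by
  classical
  intro Z _ _ _ g A hA hAD σ hσ hσg
  set v : Z → ℝ := fun z => u (g z)
  have hv : Continuous v := u.continuous.comp g.continuous
  have hle : ∀ c, IsClosed {z | v z ≤ c} := fun c => isClosed_le hv continuous_const
  have hge : ∀ c, IsClosed {z | c ≤ v z} := fun c => isClosed_le continuous_const hv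
  have hDZ : IsClosed (g ⁻¹' D) := hD.preimage g.continuous
  obtain ⟨N₀, hN₀, τ₁, hτ₁c, hτ₁, H₁, hH₁c, hH₁g, hH₁0, hH₁1⟩ := h₁ Z g (A ∩ {z | v z ≤ 1})
    (hA.inter (hle 1)) (fun z hz => ⟨hAD hz.1, hz.2⟩) σ (hσ.mono inter_subset_left)
    (fun z hz => hσg z hz.1)
  obtain ⟨N₁, hN₁, hN₁c, hN₁N₀⟩ := exists_isClosed_nhdsSet (hA.inter (hle 1)) hN₀
  have hτ₁c' : ContinuousOn τ₁ (N₁ ∩ g ⁻¹' D ∩ {z | v z ≤ 1}) :=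
    hτ₁c.mono fun z hz => ⟨hN₁N₀ hz.1.1, hz.1.2, hz.2⟩
  have hτ₁' : ∀ z ∈ N₁ ∩ g ⁻¹' D ∩ {z | v z ≤ 1}, π (τ₁ z) = g z :=
    fun z hz => hτ₁ z ⟨hN₁N₀ hz.1.1, hz.1.2, hz.2⟩
  have hvg : ∀ z, v z = u (g z) := fun _ => rfl
  clear_value v
  -- At the bottom `τ₁` is needed on all of `N₁` over the band, whereas `H₁` is controlled only over
  -- `A`; hence the separate case at time 0. Over `A` the two cases agree because `H₁` starts at
  -- `τ₁`.
  let σ' : Z × unitInterval → E := fun p =>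
    if v p.1 ≤ 1 then (if (p.2 : ℝ) = 0 then τ₁ p.1 else H₁ (p.1, p.2)) else σ p.1
  let A₂ : Set (Z × unitInterval) := {p | p.1 ∈ A ∧ 0 ≤ v p.1 ∧ p.2 = 1}
  let A₃ : Set (Z × unitInterval) := {p | p.1 ∈ A ∧ 0 ≤ v p.1 ∧ v p.1 ≤ 1}
  let A₄ : Set (Z × unitInterval) := {p | p.1 ∈ N₁ ∩ g ⁻¹' D ∧ 0 ≤ v p.1 ∧ v p.1 ≤ 1 ∧ p.2 = 0}
  have cA : IsClosed {p : Z × unitInterval | p.1 ∈ A} := hA.preimage continuous_fst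
  have c0 : IsClosed {p : Z × unitInterval | 0 ≤ v p.1} := (hge 0).preimage continuous_fst
  have c1 : IsClosed {p : Z × unitInterval | v p.1 ≤ 1} := (hle 1).preimage continuous_fst
  have cA₂ : IsClosed A₂ := cA.inter (c0.inter (isClosed_eq continuous_snd continuous_const))
  have cA₃ : IsClosed A₃ := cA.inter (c0.inter c1)
  have cA₄ : IsClosed A₄ := ((hN₁c.inter hDZ).preimage continuous_fst).inter (c0.inter (c1.inter
    (isClosed_eq continuous_snd continuous_const)))
  have e₂ : ∀ p ∈ A₂, σ' p = σ p.1 := by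
    rintro ⟨z, t⟩ ⟨hz, hz0, ht⟩
    simp only at ht hz hz0
    subst ht
    by_cases h : v z ≤ 1
    · simp [σ', h, hH₁1 z ⟨hz, h⟩ 1 le_rfl]
    · simp [σ', h]
  have e₃ : ∀ p ∈ A₃, σ' p = H₁ (p.1, p.2) := by
    rintro ⟨z, t⟩ ⟨hz, hz0, hz1⟩
    simp only at hz hz0 hz1
    by_cases h : (t : ℝ) = 0
    · simp [σ', hz1, h, hH₁0 z ⟨hz, hz1⟩ 0 le_rfl]
    · simp only [σ', if_pos hz1, if_neg h]
  have e₄ : ∀ p ∈ A₄, σ' p = τ₁ p.1 := by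
    rintro ⟨z, t⟩ ⟨hz, hz0, hz1, ht⟩
    simp only at ht hz1
    simp [σ', hz1, ht]
  have k₂ : ContinuousOn σ' A₂ :=
    (hσ.comp continuousOn_fst fun p hp => hp.1).congr e₂
  have k₃ : ContinuousOn σ' A₃ := by
    refine ContinuousOn.congr (hH₁c.comp (f := fun p : Z × unitInterval => (p.1, (p.2 : ℝ)))
      (by fun_prop) fun p hp => ⟨⟨hp.1, hp.2.2⟩, trivial⟩) e₃
  have k₄ : ContinuousOn σ' A₄ :=
    (hτ₁c'.comp continuousOn_fst fun p hp => ⟨hp.1, hp.2.2.1⟩).congr e₄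
  have kσ' : ContinuousOn σ' (A₂ ∪ A₃ ∪ A₄) :=
    (k₂.union_of_isClosed k₃ cA₂ cA₃).union_of_isClosed k₄ (cA₂.union cA₃) cA₄
  obtain ⟨N', hN', τ', hτ'c, hτ'g, H', hH'c, hH'g, hH'0, hH'1⟩ := h₂ (Z × unitInterval)
    (g.comp ⟨Prod.fst, continuous_fst⟩) (A₂ ∪ A₃ ∪ A₄) ((cA₂.union cA₃).union cA₄) (by
      rintro p ((hp | hp) | hp)
      · exact ⟨hAD hp.1, (hvg p.1).le.trans' hp.2.1⟩
      · exact ⟨hAD hp.1, (hvg p.1).le.trans' hp.2.1⟩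
      · exact ⟨hp.1.2, (hvg p.1).le.trans' hp.2.1⟩) σ' kσ' (by
      rintro p ((hp | hp) | hp)
      · rw [e₂ p hp]; exact hσg _ hp.1
      · rw [e₃ p hp]; exact hH₁g _ ⟨hp.1, hp.2.2⟩ _
      · rw [e₄ p hp]; exact hτ₁' _ ⟨hp.1, hp.2.2.1⟩)
  -- The height at which the cylinder is entered: 0 up to `v = 1/2` and 1 from `v = 2/3` on, so that
  -- beyond the band only the top `A₂` is met.
  let s : Z → unitInterval := fun z => projIcc 0 1 zero_le_one (6 * v z - 3)
  have hs : Continuous s := continuous_projIcc.comp (by fun_prop)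
  have hs0 : ∀ z, v z ≤ 1 / 2 → s z = 0 := fun z hz => projIcc_of_le_left _ (by linarith)
  have hs1 : ∀ z, 2 / 3 ≤ v z → s z = 1 := fun z hz => projIcc_of_right_le _ (by linarith)
  have hmem : ∀ z ∈ A, 0 ≤ v z → (1 / 2 : ℝ) ≤ v z → (z, s z) ∈ A₂ ∪ A₃ ∪ A₄ := by
    intro z hz h0 h
    by_cases h1 : v z ≤ 1
    · exact Or.inl (Or.inr ⟨hz, h0, h1⟩)
    · exact Or.inl (Or.inl ⟨hz, h0, hs1 z (by linarith)⟩)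
  -- At `v = 1/3` the parameter `3 - 6 * v` is 1, where `H'` is `τ₁`; at `v = 1/2` it is 0, where
  -- `H'` is `τ'` at height 0.
  let F : Z → E := fun z => if v z ≤ 1 / 2 then
      (if v z ≤ 1 / 3 then τ₁ z else H' ((z, 0), 3 - 6 * v z)) else τ' (z, s z)
  let N : Set Z := {z | v z ≤ 1 / 2 → z ∈ N₁} ∩ {z | 1 / 2 ≤ v z → (z, s z) ∈ N'}
  have hz4 : ∀ z ∈ N ∩ g ⁻¹' D, 0 ≤ v z → v z ≤ 1 / 2 → (z, (0 : unitInterval)) ∈ A₄ :=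
    fun z hz h0 h1 => ⟨⟨hz.1.1 h1, hz.2⟩, h0, by simp only; linarith, rfl⟩
  have hmid : ContinuousOn (fun z => H' ((z, 0), 3 - 6 * v z))
      (N ∩ g ⁻¹' D ∩ {z | v z ≤ 1 / 2} ∩ {z | 1 / 3 ≤ v z}) := by
    refine hH'c.comp (f := fun z => ((z, (0 : unitInterval)), 3 - 6 * v z)) (by fun_prop) ?_
    rintro z ⟨⟨hz, hz1⟩, hz2⟩
    simp only [mem_ofPred_eq] at hz1 hz2
    exact ⟨Or.inr (hz4 z hz (by linarith) hz1), trivial⟩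
  refine ⟨N, ?_, F, ?_, ?_, ?_⟩
  · rw [mem_nhdsSet_iff_forall]
    intro a ha
    refine Filter.inter_mem ?_ ?_
    · by_cases h : v a ≤ 1
      · exact Filter.mem_of_superset (mem_nhdsSet_iff_forall.1 hN₁ a ⟨ha, h⟩) fun z hz _ => hz
      · have : {z | 1 / 2 < v z} ∈ 𝓝 a := (isOpen_lt continuous_const hv).mem_nhds (by
          simp only [mem_ofPred_eq]; linarith)
        exact Filter.mem_of_superset this fun z hz h => absurd h (not_le.2 hz)
    · by_cases h : 1 / 2 ≤ v a
      · have h1 := mem_nhdsSet_iff_forall.1 hN' _ (hmem a ha (by linarith) h)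
        have h2 : Continuous fun z => (z, s z) := by fun_prop
        exact Filter.mem_of_superset (h2.continuousAt.preimage_mem_nhds h1) fun z hz _ => hz
      · have : {z | v z < 1 / 2} ∈ 𝓝 a := (isOpen_lt hv continuous_const).mem_nhds (by
          simp only [mem_ofPred_eq]; linarith)
        exact Filter.mem_of_superset this fun z hz h => absurd h (not_le.2 hz)
  · refine continuousOn_ite_le hv (continuousOn_ite_le hv ?_ hmid ?_) ?_ ?_
    · refine hτ₁c'.mono ?_
      rintro z ⟨⟨hz, hz1⟩, hz2⟩
      simp only [mem_ofPred_eq] at hz1 hz2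
      exact ⟨⟨hz.1.1 hz1, hz.2⟩, by simp only [mem_ofPred_eq]; linarith⟩
    · rintro z ⟨hz, hz1⟩ hz2
      simp only [mem_ofPred_eq] at hz1
      have h4 := hz4 z hz (by linarith) hz1
      rw [hH'1 _ (Or.inr h4) _ (by linarith), e₄ _ h4]
    · refine hτ'c.comp (f := fun z => (z, s z)) (by fun_prop) ?_
      rintro z ⟨hz, hz1⟩
      simp only [mem_ofPred_eq] at hz1
      exact ⟨hz.1.2 hz1, hz.2, (hvg z).le.trans' (by linarith)⟩
    · intro z hz h
      have h4 := hz4 z hz (by linarith) h.le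
      rw [if_neg (by linarith), hs0 z h.le, hH'0 _ (Or.inr h4) _ (by linarith)]
  · intro z hz
    simp only [F]
    split_ifs with h1 h2
    · exact hτ₁' z ⟨⟨hz.1.1 h1, hz.2⟩, by simp only [mem_ofPred_eq]; linarith⟩
    · exact hH'g _ (Or.inr (hz4 z hz (by linarith) h1)) _
    · refine hτ'g _ ⟨hz.1.2 (by linarith), hz.2, (hvg z).le.trans' (by linarith)⟩
  · have hAN : ∀ z ∈ A, v z ≤ 1 → z ∈ N₁ ∩ g ⁻¹' D := fun z hz h =>
      ⟨subset_of_mem_nhdsSet hN₁ ⟨hz, h⟩, hAD hz⟩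
    have hA4 : ∀ z ∈ A, 0 ≤ v z → v z ≤ 1 → (z, (0 : unitInterval)) ∈ A₂ ∪ A₃ ∪ A₄ :=
      fun z hz h0 h1 => Or.inr ⟨hAN z hz h1, h0, h1, rfl⟩
    -- Over `A`, first `H'` turns the values of `τ'` into those of `σ'` on the graph of `s`; then
    -- `H₁`, started at height `s z`, runs on to `σ`. The maxima hold each motion still until the
    -- time passes the parameter already reached.
    refine LiftHtpy.trans (f₁ := fun z => if v z ≤ 1 / 2 then τ₁ z else σ' (z, s z)) ?_ ?_
    · refine ⟨fun p => if v p.1 ≤ 1 / 2 then (if v p.1 ≤ 1 / 3 then τ₁ p.1 else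
        H' ((p.1, 0), max (3 - 6 * v p.1) p.2)) else H' ((p.1, s p.1), p.2), ?_, ?_, ?_, ?_⟩
      · refine continuousOn_ite_le (v := fun p : Z × ℝ => v p.1) (by fun_prop)
          (continuousOn_ite_le (v := fun p : Z × ℝ => v p.1) (by fun_prop) ?_ ?_ ?_) ?_ ?_
        · refine hτ₁c'.comp continuousOn_fst ?_
          rintro p ⟨⟨hp, hp1⟩, hp2⟩
          simp only [mem_ofPred_eq] at hp1 hp2
          exact ⟨hAN _ hp.1 (by linarith), by simp only [mem_ofPred_eq]; linarith⟩
        · refine hH'c.comp (f := fun p : Z × ℝ =>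
            ((p.1, (0 : unitInterval)), max (3 - 6 * v p.1) p.2)) (by fun_prop) ?_
          rintro p ⟨⟨hp, hp1⟩, hp2⟩
          simp only [mem_ofPred_eq] at hp1 hp2
          exact ⟨hA4 _ hp.1 (by linarith) (by linarith), trivial⟩
        · rintro p ⟨hp, hp1⟩ hp2
          simp only [mem_ofPred_eq] at hp1 hp2
          have h4 : (p.1, (0 : unitInterval)) ∈ A₄ :=
            ⟨hAN _ hp.1 (by linarith), by simp only; linarith, by simp only; linarith, rfl⟩
          rw [hH'1 _ (Or.inr h4) _ (le_max_of_le_left (by linarith)), e₄ _ h4]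
        · refine hH'c.comp (f := fun p : Z × ℝ => ((p.1, s p.1), p.2)) (by fun_prop) ?_
          rintro p ⟨hp, hp1⟩
          simp only [mem_ofPred_eq] at hp1
          exact ⟨hmem _ hp.1 (by linarith) hp1, trivial⟩
        · intro p hp h
          have h4 := hA4 p.1 hp.1 (by linarith) (by linarith)
          rw [if_neg (by linarith), hs0 _ h.le]
          rcases le_total p.2 0 with h0 | h0
          · rw [hH'0 _ h4 _ h0, hH'0 _ h4 _ (max_le (by linarith) h0)]
          · rw [max_eq_right (by linarith)]
      · intro z hz t
        dsimp only
        split_ifs with h1 h2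
        · exact hτ₁' z ⟨hAN z hz (by linarith), by simp only [mem_ofPred_eq]; linarith⟩
        · exact hH'g _ (hA4 z hz (by linarith) (by linarith)) _
        · exact hH'g _ (hmem z hz (by linarith) (by linarith)) _
      · intro z hz t ht
        simp only [F]
        split_ifs with h1 h2
        · rfl
        · rw [max_eq_left (by linarith)]
        · exact hH'0 _ (hmem z hz (by linarith) (by linarith)) _ ht
      · intro z hz t ht
        dsimp only
        split_ifs with h1 h2
        · rfl
        · have h4 : (z, (0 : unitInterval)) ∈ A₄ :=
            ⟨hAN _ hz (by linarith), by simp only; linarith, by simp only; linarith, rfl⟩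
          rw [hH'1 _ (Or.inr h4) _ (le_max_of_le_right ht), e₄ _ h4]
        · exact hH'1 _ (hmem z hz (by linarith) (by linarith)) _ ht
    · refine ⟨fun p => if v p.1 ≤ 1 then H₁ (p.1, max (s p.1) p.2) else σ p.1, ?_, ?_, ?_, ?_⟩
      · refine continuousOn_ite_le (v := fun p : Z × ℝ => v p.1) (by fun_prop) ?_ ?_ ?_
        · exact hH₁c.comp (f := fun p : Z × ℝ => (p.1, max (s p.1 : ℝ) p.2)) (by fun_prop)
            fun p hp => ⟨⟨hp.1.1, hp.2⟩, trivial⟩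
        · exact hσ.comp continuousOn_fst fun p hp => hp.1.1
        · intro p hp h
          refine hH₁1 _ ⟨hp.1, h.le⟩ _ (le_max_of_le_left ?_)
          rw [hs1 _ (by linarith)]; exact le_rfl
      · intro z hz t
        dsimp only
        split_ifs with h1
        · exact hH₁g _ ⟨hz, h1⟩ _
        · exact hσg z hz
      · intro z hz t ht
        dsimp only
        rw [max_eq_left (ht.trans (s z).2.1)]
        split_ifs with h1 h2
        · rw [hs0 z h2]; exact hH₁0 z ⟨hz, h1⟩ _ le_rfl
        · exact (e₃ (z, s z) ⟨hz, by simp only; linarith, h1⟩).symm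
        · linarith
        · simp [σ', h1]
      · intro z hz t ht
        dsimp only
        split_ifs with h1
        · exact hH₁1 _ ⟨hz, h1⟩ _ (le_max_of_le_right ht)
        · rfl

/-- The extension property is local in the base. -/
theorem secExt_univ_of_local [Nonempty E] [CompactSpace B] [T2Space B] {π : E → B}
    (h : ∀ b, ∃ V, IsOpen V ∧ b ∈ V ∧ ∀ D ⊆ V, IsClosed D → SecExt.{w} π D) :
    SecExt.{w} π univ := by
  -- The induction over compact sets runs on the existence of an open neighbourhood all of whose
  -- closed subsets have the property; for the whole space, `univ` is one of these.
  suffices ∃ V, IsOpen V ∧ (univ : Set B) ⊆ V ∧ ∀ D ⊆ V, IsClosed D → SecExt.{w} π D by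
    obtain ⟨V, _, hV, h⟩ := this
    exact h _ hV isClosed_univ
  refine isCompact_univ.induction_on (p := fun s =>
    ∃ V, IsOpen V ∧ s ⊆ V ∧ ∀ D ⊆ V, IsClosed D → SecExt.{w} π D) ?_ ?_ ?_ ?_
  · refine ⟨∅, isOpen_empty, le_rfl, fun D hD _ => ?_⟩
    intro Z _ _ _ g A hA hAD σ hσ hσg
    have hA0 : A = ∅ := subset_empty_iff.1 fun z hz => hD (hAD hz)
    subst hA0
    refine ⟨∅, by simp, fun _ => Classical.arbitrary E, by simp, by simp, ?_⟩
    exact ⟨fun _ => Classical.arbitrary E, by simp, by simp, by simp, by simp⟩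
  · rintro s t hst ⟨V, h1, h2, h3⟩
    exact ⟨V, h1, hst.trans h2, h3⟩
  · rintro s t ⟨V, hV, hsV, h1⟩ ⟨V', hV', hsV', h2⟩
    refine ⟨V ∪ V', hV.union hV', union_subset_union hsV hsV', fun D hD hDc => ?_⟩
    have d : Disjoint (D \ V) (D \ V') := disjoint_left.2 fun x hx hx' =>
      (hD hx.1).elim hx.2 hx'.2
    obtain ⟨f, hf0, hf1, _⟩ := exists_continuous_zero_one_of_isClosed
      (hDc.sdiff hV') (hDc.sdiff hV) d.symm
    -- As `f` is 0 on `D \ V'` and 1 on `D \ V`, the part of `D` with `f ≤ 2/3` lies in `V` and the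
    -- part with `1/3 ≤ f` lies in `V'`.
    refine SecExt.union hDc (3 * f - 1) ?_ ?_
    · refine h1 _ ?_ (hDc.inter (isClosed_le (by fun_prop) continuous_const))
      rintro x ⟨hx, hx1⟩
      by_contra hxV
      have h3 : f x = 1 := hf1 ⟨hx, hxV⟩
      have h4 : 3 * f x - 1 ≤ 1 := hx1
      linarith
    · refine h2 _ ?_ (hDc.inter (isClosed_le continuous_const (by fun_prop)))
      rintro x ⟨hx, hx1⟩
      by_contra hxV
      have h3 : f x = 0 := hf0 ⟨hx, hxV⟩
      have h4 : 0 ≤ 3 * f x - 1 := hx1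
      linarith
  · intro x _
    obtain ⟨V, hV, hx, h1⟩ := h x
    exact ⟨V, mem_nhdsWithin_of_mem_nhds (hV.mem_nhds hx), V, hV, le_rfl, h1⟩

end Union

/-! ### Extension of maps into a space, and attaching a cell. -/

section Target

variable {K : Type*} [TopologicalSpace K]

/-- Maps into `E` from closed subsets of compact Hausdorff spaces extend, up to homotopy, to
neighbourhoods. -/
def HExtInto (E : Set K) : Prop :=
  ∀ (Z : Type w) [TopologicalSpace Z] [CompactSpace Z] [T2Space Z] (A : Set Z), IsClosed A →
    ∀ f : Z → K, ContinuousOn f A → MapsTo f A E → ∃ N ∈ 𝓝ˢ A, ∃ F : Z → K,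
      -- Membership in `E` is read as a map to `Prop`: a homotopy through lifts of the constant map
      -- `True` is a homotopy that stays in `E`.
      ContinuousOn F N ∧ MapsTo F N E ∧ LiftHtpy (fun k => k ∈ E) (fun _ : Z => True) A F f

theorem hExtInto_empty : HExtInto.{w} (∅ : Set K) := by
  intro Z _ _ _ A hA f hf hfE
  have : A = ∅ := eq_empty_of_forall_notMem fun z hz => hfE hz
  subst this
  exact ⟨∅, by simp, f, by simp, by simp, fun p => f p.1, by simp, by simp, by simp, by simp⟩

/-- Continuity on a space obtained by attaching a cell, times a parameter space. -/
theorem continuousOn_attach [T2Space K] {V : Type*} [TopologicalSpace V] {C : Set V}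
    (hC : IsCompact C) {φ : V → K} (hφ : ContinuousOn φ C) {E : Set K} (hE : IsClosed E)
    {W Y : Type*} [TopologicalSpace W] [TopologicalSpace Y] {h : K × W → Y}
    (h₁ : ContinuousOn h (E ×ˢ univ))
    (h₂ : ContinuousOn (fun p : V × W => h (φ p.1, p.2)) (C ×ˢ univ)) :
    ContinuousOn h ((E ∪ φ '' C) ×ˢ univ) := by
  have hP : IsClosed (φ '' C) := (hC.image_of_continuousOn hφ).isClosed
  rw [union_prod]
  refine h₁.union_of_isClosed ?_ (hE.prod isClosed_univ) (hP.prod isClosed_univ)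
  have : CompactSpace C := isCompact_iff_compactSpace.1 hC
  let c : C → φ '' C := fun x => ⟨φ x, mem_image_of_mem φ x.2⟩
  have hc : Continuous c := (continuousOn_iff_continuous_domRestrict.1 hφ).subtype_mk _
  have hcs : Function.Surjective c := by
    rintro ⟨_, x, hx, rfl⟩
    exact ⟨⟨x, hx⟩, rfl⟩
  -- A map from a compact to a Hausdorff space is proper, and properness survives a product with the
  -- identity of any `W`. So the product is a closed surjection, hence a quotient map, without local
  -- compactness of `W`.
  have hq : IsProperMap (Prod.map c (id : W → W)) := hc.isProperMap.prodMap isProperMap_id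
  have hquot : Topology.IsQuotientMap (Prod.map c (id : W → W)) :=
    hq.isClosedMap.isQuotientMap hq.continuous (hcs.prodMap Function.surjective_id)
  have key : Continuous fun p : (φ '' C) × W => h (p.1, p.2) := by
    rw [hquot.continuous_iff]
    exact h₂.comp_continuous (f := fun p : C × W => ((p.1 : V), p.2)) (by fun_prop)
      fun p => ⟨p.1.2, trivial⟩
  rw [continuousOn_iff_continuous_domRestrict]
  exact key.comp (f := fun p : ((φ '' C) ×ˢ (univ : Set W) : Set (K × W)) =>
    ((⟨p.1.1, p.2.1⟩ : φ '' C), p.1.2)) (by fun_prop)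

/-- Well inside the cell, a map is given by coordinates in `ℝⁿ` and extends by Tietze; away from the
centre it can be pushed radially into `E`, where the hypothesis applies. The homotopy `q` stretches
the cell so that its outer part ends in `E`, and the two extensions are matched along a collar
measured by the extended radial coordinate `v`. Replacing `f` by its stretched version costs a
homotopy, which the property permits. -/
theorem HExtInto.attach_cell [T2Space K] {n : ℕ} {E : Set K} (hE : IsClosed E)
    (h : HExtInto.{w} E) {φ : (Fin n → ℝ) → K} {ψ : K → (Fin n → ℝ)}
    (hφ : ContinuousOn φ (Metric.closedBall 0 1)) (hψ : ContinuousOn ψ (φ '' Metric.ball 0 1))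
    (hψφ : ∀ x, ‖x‖ < 1 → ψ (φ x) = x) (hφE : ∀ x, ‖x‖ = 1 → φ x ∈ E)
    (hφE' : ∀ x, ‖x‖ < 1 → φ x ∉ E) : HExtInto.{w} (E ∪ φ '' Metric.closedBall 0 1) := by
  classical
  have hBc : IsCompact (Metric.closedBall (0 : Fin n → ℝ) 1) := isCompact_closedBall 0 1
  set E₁ : Set K := E ∪ φ '' Metric.closedBall 0 1 with hE₁
  have hφE₁ : ∀ x, ‖x‖ ≤ 1 → φ x ∈ E₁ := fun x hx => Or.inr ⟨x, by simpa using hx, rfl⟩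
  have hcase : ∀ e ∈ E₁, e ∈ E ∨ e ∉ E ∧ ∃ x, ‖x‖ < 1 ∧ e = φ x := by
    rintro e (he | ⟨x, hx, rfl⟩)
    · exact Or.inl he
    · rcases (show ‖x‖ ≤ 1 by simpa using hx).lt_or_eq with h1 | h1
      · exact Or.inr ⟨hφE' x h1, x, h1, rfl⟩
      · exact Or.inl (hφE x h1)
  -- the radial coordinate
  let ρ : K → ℝ := fun e => if e ∈ E then 1 else ‖ψ e‖
  have hρφ : ∀ x, ‖x‖ ≤ 1 → ρ (φ x) = ‖x‖ := by
    intro x hx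
    rcases hx.lt_or_eq with h1 | h1
    · simp only [ρ, if_neg (hφE' x h1), hψφ x h1]
    · simp only [ρ, if_pos (hφE x h1), h1]
  have hρ : ContinuousOn ρ E₁ := by
    have : ContinuousOn (fun p : K × Unit => ρ p.1) (E₁ ×ˢ univ) := by
      refine continuousOn_attach hBc hφ hE ?_ ?_
      · exact ContinuousOn.congr (f := fun _ => (1 : ℝ)) continuousOn_const fun p hp => if_pos hp.1
      · refine ContinuousOn.congr (f := fun p : (Fin n → ℝ) × Unit => ‖p.1‖) (by fun_prop) ?_
        exact fun p hp => hρφ p.1 (by simpa using hp.1)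
    exact this.comp (f := fun e : K => (e, ())) (by fun_prop) fun e he => ⟨he, trivial⟩
  -- radial stretching
  let l : (Fin n → ℝ) → ℝ := fun x => (max ‖x‖ (1 / 2))⁻¹
  have hl : Continuous l := Continuous.inv₀ (by fun_prop) fun x => by positivity
  let c : ℝ → ℝ := fun t => max 0 (min t 1)
  -- The scaling factor moves from 1 to `1 / max ‖x‖ (1/2)`: points of norm at least 1/2 end on the
  -- sphere, points inside are doubled. The sphere is fixed throughout, so that `q` fits with the
  -- identity of `E`.
  let κ : (Fin n → ℝ) → ℝ → (Fin n → ℝ) := fun x t => (1 + c t * (l x - 1)) • x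
  have hκ : Continuous fun p : (Fin n → ℝ) × ℝ => κ p.1 p.2 := by fun_prop
  have hl1 : ∀ x, ‖x‖ ≤ 1 → 1 ≤ l x := fun x hx =>
    (one_le_inv₀ (by positivity)).2 (max_le hx (by norm_num))
  have hlx : ∀ x, l x * ‖x‖ ≤ 1 := fun x => by
    show (max ‖x‖ (1 / 2))⁻¹ * ‖x‖ ≤ 1
    rw [inv_mul_le_iff₀ (by positivity), mul_one]; exact le_max_left _ _
  have hκ1 : ∀ x t, ‖x‖ ≤ 1 → ‖κ x t‖ ≤ 1 := by
    intro x t hx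
    have h1 := hl1 x hx
    have hc0 : 0 ≤ c t := le_max_left _ _
    have hc1 : c t ≤ 1 := max_le zero_le_one (min_le_right _ _)
    have h2 : 0 ≤ 1 + c t * (l x - 1) := by nlinarith
    simp only [κ, norm_smul, Real.norm_eq_abs, abs_of_nonneg h2]
    refine le_trans (mul_le_mul_of_nonneg_right ?_ (norm_nonneg x)) (hlx x)
    nlinarith
  have hκs : ∀ x t, ‖x‖ = 1 → κ x t = x := by
    intro x t hx
    have : l x = 1 := by simp only [l, hx]; norm_num
    simp [κ, this]
  have hκ0 : ∀ x, ∀ t ≤ 0, κ x t = x := by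
    intro x t ht
    have : c t = 0 := max_eq_left (min_le_of_left_le ht)
    simp [κ, this]
  have hκt : ∀ x, ∀ t, 1 ≤ t → κ x t = l x • x := by
    intro x t ht
    have : c t = 1 := by simp only [c]; rw [min_eq_right ht]; norm_num
    simp [κ, this]
  let q : K × ℝ → K := fun p => if p.1 ∈ E then p.1 else φ (κ (ψ p.1) p.2)
  have hqφ : ∀ x t, ‖x‖ ≤ 1 → q (φ x, t) = φ (κ x t) := by
    intro x t hx
    rcases hx.lt_or_eq with h1 | h1
    · simp only [q, if_neg (hφE' x h1), hψφ x h1]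
    · simp only [q, if_pos (hφE x h1), hκs x t h1]
  have hq : ContinuousOn q (E₁ ×ˢ univ) := by
    refine continuousOn_attach hBc hφ hE ?_ ?_
    · exact continuousOn_fst.congr fun p hp => if_pos hp.1
    · refine ContinuousOn.congr (f := fun p : (Fin n → ℝ) × ℝ => φ (κ p.1 p.2)) ?_ ?_
      · refine hφ.comp hκ.continuousOn fun p hp => ?_
        simpa using hκ1 p.1 p.2 (by simpa using hp.1)
      · exact fun p hp => hqφ p.1 p.2 (by simpa using hp.1)
  have hqE₁ : ∀ e ∈ E₁, ∀ t, q (e, t) ∈ E₁ := by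
    intro e he t
    rcases hcase e he with h1 | ⟨_, x, hx, rfl⟩
    · simp only [q, if_pos h1]; exact he
    · rw [hqφ x t hx.le]; exact hφE₁ _ (hκ1 x t hx.le)
  have hq0 : ∀ e ∈ E₁, ∀ t ≤ 0, q (e, t) = e := by
    intro e he t ht
    rcases hcase e he with h1 | ⟨_, x, hx, rfl⟩
    · simp only [q, if_pos h1]
    · rw [hqφ x t hx.le, hκ0 x t ht]
  have hq1 : ∀ e, ∀ t, 1 ≤ t → q (e, t) = q (e, 1) := by
    intro e t ht
    simp only [q, hκt _ t ht, hκt _ 1 le_rfl]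
  have hqE : ∀ e ∈ E₁, 1 / 2 ≤ ρ e → q (e, 1) ∈ E := by
    intro e he hρe
    rcases hcase e he with h1 | ⟨_, x, hx, rfl⟩
    · simp only [q, if_pos h1]; exact h1
    · rw [hρφ x hx.le] at hρe
      rw [hqφ x 1 hx.le, hκt x 1 le_rfl]
      refine hφE _ ?_
      have : ‖x‖ ≠ 0 := by linarith
      simp only [l, max_eq_left hρe, norm_smul, norm_inv, norm_norm, inv_mul_cancel₀ this]
  intro Z _ _ _ A hA f hf hfE
  have hf' : ContinuousOn (fun z => q (f z, 1)) A :=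
    hq.comp (hf.prodMk continuousOn_const) fun z hz => ⟨hfE hz, trivial⟩
  have hpush : LiftHtpy (fun k => k ∈ E₁) (fun _ : Z => True) A (fun z => q (f z, 1)) f := by
    refine ⟨fun p => q (f p.1, 1 - p.2), ?_, ?_, ?_, ?_⟩
    · refine hq.comp ?_ fun p hp => ⟨hfE hp.1, trivial⟩
      exact (hf.comp continuousOn_fst fun p hp => hp.1).prodMk (by fun_prop)
    · exact fun z hz t => eq_true (hqE₁ _ (hfE hz) _)
    · exact fun z hz t ht => hq1 _ _ (by linarith)
    · exact fun z hz t ht => hq0 _ (hfE hz) _ (by linarith)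
  -- extend the radial coordinate and the coordinate in the cell
  obtain ⟨v, hvA⟩ := ContinuousMap.exists_restrict_eq hA
    (⟨A.domRestrict (fun z => ρ (f z)), continuousOn_iff_continuous_domRestrict.1
      (hρ.comp hf hfE)⟩ : C(A, ℝ))
  replace hvA : ∀ z ∈ A, v z = ρ (f z) := fun z hz => DFunLike.congr_fun hvA ⟨z, hz⟩
  have hle : ∀ a, IsClosed {z | v z ≤ a} := fun a => isClosed_le v.continuous continuous_const
  have hge : ∀ a, IsClosed {z | a ≤ v z} := fun a => isClosed_le continuous_const v.continuous
  have hcell : ∀ z ∈ A, v z ≤ 3 / 4 → ∃ x, ‖x‖ < 1 ∧ f z = φ x ∧ ‖x‖ = v z := by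
    intro z hz hvz
    rcases hcase _ (hfE hz) with h1 | ⟨_, x, hx, hfx⟩
    · have : v z = 1 := by rw [hvA z hz]; exact if_pos h1
      norm_num [this] at hvz
    · exact ⟨x, hx, hfx, by rw [hvA z hz, hfx, hρφ x hx.le]⟩
  obtain ⟨G, hG⟩ := ContinuousMap.exists_restrict_eq (hA.inter (hle (3 / 4)))
    (⟨(A ∩ {z | v z ≤ 3 / 4}).domRestrict (fun z => ψ (f z)),
      continuousOn_iff_continuous_domRestrict.1 (hψ.comp (hf.mono inter_subset_left) (by
        rintro z ⟨hz, hvz⟩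
        obtain ⟨x, hx, hfx, _⟩ := hcell z hz hvz
        exact ⟨x, by simpa using hx, hfx.symm⟩))⟩ : C(_, Fin n → ℝ))
  replace hG : ∀ z ∈ A, v z ≤ 3 / 4 → G z = ψ (f z) :=
    fun z hz hvz => DFunLike.congr_fun hG ⟨z, hz, hvz⟩
  have hGf : ∀ z ∈ A, v z ≤ 3 / 4 → ‖G z‖ < 1 ∧ f z = φ (G z) ∧ ‖G z‖ = v z := by
    intro z hz hvz
    obtain ⟨x, hx, hfx, hxv⟩ := hcell z hz hvz
    have : G z = x := by rw [hG z hz hvz, hfx, hψφ x hx]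
    rw [this]; exact ⟨hx, hfx, hxv⟩
  -- The identity `‖G z‖ = v z` holds only on `A`, where `v ≤ 3/4`. On a neighbourhood of `A` it
  -- still follows that `G` has no zero in the band `1/2 ≤ v ≤ 3/4`, which is what radial projection
  -- to the sphere requires.
  have hN₀ : {z | 1 / 2 ≤ v z → v z ≤ 3 / 4 → G z ≠ 0} ∈ 𝓝ˢ A := by
    refine IsOpen.mem_nhdsSet (?_ : IsOpen _) |>.2 ?_
    · have : {z | 1 / 2 ≤ v z → v z ≤ 3 / 4 → G z ≠ 0} =
          {z | 1 / 2 ≤ v z}ᶜ ∪ ({z | v z ≤ 3 / 4}ᶜ ∪ {z | G z = 0}ᶜ) := by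
        ext z
        simp only [mem_ofPred_eq, mem_union, mem_compl_iff]
        tauto
      rw [this]
      exact (hge _).isOpen_compl.union ((hle _).isOpen_compl.union
        (isClosed_eq G.continuous continuous_const).isOpen_compl)
    · intro z hz h1 h2 h0
      have := (hGf z hz h2).2.2
      rw [h0, norm_zero] at this
      linarith
  obtain ⟨N₀, hN₀A, hN₀c, hN₀G⟩ := exists_isClosed_nhdsSet hA hN₀
  have hAN₀ : A ⊆ N₀ := subset_of_mem_nhdsSet hN₀A
  let rad : Z → (Fin n → ℝ) := fun z => ‖G z‖⁻¹ • G z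
  have hrad1 : ∀ z, G z ≠ 0 → ‖rad z‖ = 1 := fun z hz => by
    have : ‖G z‖ ≠ 0 := norm_ne_zero_iff.2 hz
    simp only [rad, norm_smul, norm_inv, norm_norm, inv_mul_cancel₀ this]
  let A₁ : Set Z := A ∩ {z | 1 / 2 ≤ v z}
  let A₂ : Set Z := N₀ ∩ ({z | 1 / 2 ≤ v z} ∩ {z | v z ≤ 3 / 4})
  have cA₁ : IsClosed A₁ := hA.inter (hge _)
  have cA₂ : IsClosed A₂ := hN₀c.inter ((hge _).inter (hle _))
  have hGA₂ : ∀ z ∈ A₂, G z ≠ 0 := fun z hz => hN₀G hz.1 hz.2.1 hz.2.2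
  -- In the band the radial projection of `G` to the sphere is also defined off `A`; over `A` it
  -- coincides with the stretched map.
  let f₁ : Z → K := fun z => if v z ≤ 3 / 4 then φ (rad z) else q (f z, 1)
  have e₂ : ∀ z ∈ A₂, f₁ z = φ (rad z) := fun z hz => if_pos hz.2.2
  have e₁ : ∀ z ∈ A₁, f₁ z = q (f z, 1) := by
    intro z hz
    by_cases hvz : v z ≤ 3 / 4
    · obtain ⟨h1, h2, h3⟩ := hGf z hz.1 hvz
      simp only [f₁, if_pos hvz]
      rw [h2, hqφ _ _ h1.le, hκt _ _ le_rfl]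
      have : 1 / 2 ≤ ‖G z‖ := by rw [h3]; exact hz.2
      simp only [rad, l, max_eq_left this]
    · exact if_neg hvz
  have k₁ : ContinuousOn f₁ A₁ := (hf'.mono inter_subset_left).congr e₁
  have k₂ : ContinuousOn f₁ A₂ := by
    refine ContinuousOn.congr (f := fun z => φ (rad z)) (hφ.comp ?_ fun z hz => ?_) e₂
    · exact ContinuousOn.smul (ContinuousOn.inv₀ (by fun_prop) fun z hz =>
        norm_ne_zero_iff.2 (hGA₂ z hz)) (by fun_prop)
    · simpa using (hrad1 z (hGA₂ z hz)).le
  obtain ⟨N₁, hN₁, F₁, hF₁c, hF₁E, H₁, hH₁c, hH₁E, hH₁0, hH₁1⟩ := h Z (A₁ ∪ A₂) (cA₁.union cA₂) f₁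
    (k₁.union_of_isClosed k₂ cA₁ cA₂) (by
      rintro z (hz | hz)
      · rw [e₁ z hz]; exact hqE _ (hfE hz.1) (by rw [← hvA z hz.1]; exact hz.2)
      · rw [e₂ z hz]; exact hφE _ (hrad1 z (hGA₂ z hz)))
  -- On `A`, where `‖G z‖ = v z`, the denominator is 1/2 and this is the doubling done by `q`; at `v
  -- = 1/2` it is `rad`. Off `A` the nonnegative term `1/2 - v` keeps the norm at most 1.
  let inn : Z → (Fin n → ℝ) := fun z => (‖G z‖ + (1 / 2 - v z))⁻¹ • G z
  have hinn1 : ∀ z, v z ≤ 1 / 2 → ‖inn z‖ ≤ 1 := by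
    intro z hz
    have h0 : 0 ≤ ‖G z‖ + (1 / 2 - v z) := by have := norm_nonneg (G z); linarith
    simp only [inn, norm_smul, norm_inv, Real.norm_eq_abs, abs_of_nonneg h0]
    rcases h0.eq_or_lt with h1 | h1
    · rw [← h1]; simp
    · rw [inv_mul_le_iff₀ h1]; linarith
  have hinnA : ∀ z ∈ A, v z ≤ 1 / 2 → φ (inn z) = q (f z, 1) := by
    intro z hz hvz
    obtain ⟨h1, h2, h3⟩ := hGf z hz (by linarith)
    rw [h2, hqφ _ _ h1.le, hκt _ _ le_rfl]
    have : max ‖G z‖ (1 / 2) = 1 / 2 := max_eq_right (by rw [h3]; exact hvz)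
    simp only [inn, l, this]
    rw [h3]
    congr 3; ring
  have hinnc : ContinuousOn (fun z => φ (inn z)) (N₀ ∩ {z | v z ≤ 1 / 2}) := by
    refine hφ.comp ?_ fun z hz => by simpa using hinn1 z hz.2
    refine ContinuousOn.smul (f := fun z => (‖G z‖ + (1 / 2 - v z))⁻¹) (g := fun z => G z)
      (ContinuousOn.inv₀ (by fun_prop) ?_) (by fun_prop)
    rintro z ⟨hz, hvz⟩
    simp only [mem_ofPred_eq] at hvz
    rcases hvz.lt_or_eq with h1 | h1
    · have := norm_nonneg (G z); linarith
    · rw [h1]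
      simpa using hN₀G hz (by linarith) (by linarith)
  have hinnr : ∀ z, v z = 1 / 2 → inn z = rad z := fun z hz => by simp [inn, rad, hz]
  have hH₁E₁ : ∀ z ∈ A₁ ∪ A₂, ∀ t, H₁ (z, t) ∈ E₁ := fun z hz t =>
    Or.inl (of_eq_true (hH₁E z hz t))
  -- `H₁` is run backwards in the collar `1/2 ≤ v ≤ 5/8`: it is `f₁` at `v = 1/2` (parameter 1) and
  -- `F₁` at `v = 5/8` (parameter 0). Since `5/8 < 3/4`, the collar stays in `A₂`, where `H₁` is
  -- controlled.
  let F : Z → K := fun z => if v z ≤ 1 / 2 then φ (inn z) else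
    (if v z ≤ 5 / 8 then H₁ (z, 5 - 8 * v z) else F₁ z)
  let N : Set Z := N₀ ∩ {z | 1 / 2 ≤ v z → z ∈ N₁}
  refine ⟨N, ?_, F, ?_, ?_, LiftHtpy.trans ?_ hpush⟩
  · refine Filter.inter_mem hN₀A (mem_nhdsSet_iff_forall.2 fun a ha => ?_)
    by_cases hva : 1 / 2 ≤ v a
    · exact Filter.mem_of_superset (mem_nhdsSet_iff_forall.1 hN₁ a (Or.inl ⟨ha, hva⟩))
        fun z hz _ => hz
    · exact Filter.mem_of_superset ((hge (1 / 2)).isOpen_compl.mem_nhds hva)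
        fun z hz h => absurd h hz
  · refine continuousOn_ite_le v.continuous ?_ (continuousOn_ite_le v.continuous ?_ ?_ ?_) ?_
    · exact hinnc.mono fun z hz => ⟨hz.1.1, hz.2⟩
    · refine hH₁c.comp (f := fun z => (z, 5 - 8 * v z)) (by fun_prop) ?_
      rintro z ⟨⟨hz, hz1⟩, hz2⟩
      simp only [mem_ofPred_eq] at hz1 hz2
      exact ⟨Or.inr ⟨hz.1, hz1, by simp only [mem_ofPred_eq]; linarith⟩, trivial⟩
    · exact hF₁c.mono fun z hz => hz.1.1.2 hz.1.2
    · rintro z ⟨hz, hz1⟩ hz2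
      exact hH₁0 z (Or.inr ⟨hz.1, hz1, by simp only [mem_ofPred_eq]; linarith⟩) _ (by linarith)
    · intro z hz hz1
      have hzA : z ∈ A₂ := ⟨hz.1, hz1.ge, by simp only [mem_ofPred_eq]; linarith⟩
      rw [if_pos (by linarith), hH₁1 z (Or.inr hzA) _ (by linarith), e₂ z hzA, hinnr z hz1]
  · intro z hz
    simp only [F]
    split_ifs with h1 h2
    · exact hφE₁ _ (hinn1 z h1)
    · exact hH₁E₁ z (Or.inr ⟨hz.1, by simp only [mem_ofPred_eq]; linarith, by
        simp only [mem_ofPred_eq]; linarith⟩) _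
    · exact Or.inl (hF₁E (hz.2 (by linarith)))
  · refine ⟨fun p => if v p.1 ≤ 1 / 2 then φ (inn p.1) else H₁ (p.1, max p.2 (5 - 8 * v p.1)),
      ?_, ?_, ?_, ?_⟩
    · refine continuousOn_ite_le (v := fun p : Z × ℝ => v p.1) (by fun_prop) ?_ ?_ ?_
      · exact hinnc.comp continuousOn_fst fun p hp => ⟨hAN₀ hp.1.1, hp.2⟩
      · exact hH₁c.comp (f := fun p : Z × ℝ => (p.1, max p.2 (5 - 8 * v p.1))) (by fun_prop)
          fun p hp => ⟨Or.inl ⟨hp.1.1, hp.2⟩, trivial⟩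
      · intro p hp hp1
        have hz : p.1 ∈ A₁ := ⟨hp.1, hp1.ge⟩
        rw [hH₁1 _ (Or.inl hz) _ (le_max_of_le_right (by linarith)), e₁ _ hz,
          hinnA _ hp.1 hp1.le]
    · intro z hz t
      refine eq_true ?_
      dsimp only
      split_ifs with h1
      · exact hφE₁ _ (hinn1 z h1)
      · exact hH₁E₁ z (Or.inl ⟨hz, by simp only [mem_ofPred_eq]; linarith⟩) _
    · intro z hz t ht
      simp only [F]
      split_ifs with h1 h2
      · rfl
      · rw [max_eq_right (by linarith)]
      · exact hH₁0 z (Or.inl ⟨hz, by simp only [mem_ofPred_eq]; linarith⟩) _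
          (max_le ht (by linarith))
    · intro z hz t ht
      dsimp only
      split_ifs with h1
      · exact hinnA z hz h1
      · have hzA : z ∈ A₁ := ⟨hz, by simp only [mem_ofPred_eq]; linarith⟩
        rw [hH₁1 z (Or.inl hzA) _ (le_max_of_le_left ht), e₁ z hzA]

end Target

/-! ### Finite subcomplexes and compact subsets of CW complexes. -/

section CW

open Topology RelCWComplex

variable {K : Type u} [TopologicalSpace K] [CWComplex (univ : Set K)]

/-- The union of the open cells in `T`. -/
def cellUnion (T : Finset (Σ n, cell (univ : Set K) n)) : Set K := ⋃ e ∈ T, openCell e.1 e.2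

/-- The boundary of each cell in `T` is covered by the cells of smaller dimension in `T`. -/
def BoundaryClosed (T : Finset (Σ n, cell (univ : Set K) n)) : Prop :=
  ∀ e ∈ T, cellFrontier e.1 e.2 ⊆ ⋃ e' ∈ T, ⋃ (_ : e'.1 < e.1), openCell e'.1 e'.2

theorem BoundaryClosed.biUnion [DecidableEq (Σ n, cell (univ : Set K) n)] {ι : Type*}
    {s : Finset ι} {T : ι → Finset (Σ n, cell (univ : Set K) n)}
    (h : ∀ i ∈ s, BoundaryClosed (T i)) : BoundaryClosed (s.biUnion T) := by
  intro e he
  obtain ⟨i, hi, hei⟩ := Finset.mem_biUnion.1 he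
  refine (h i hi e hei).trans (iUnion₂_subset fun e' he' => ?_)
  exact subset_biUnion_of_mem (u := fun e' => ⋃ (_ : e'.1 < e.1), openCell e'.1 e'.2)
    (Finset.mem_biUnion.2 ⟨i, hi, he'⟩)

theorem BoundaryClosed.closedCell_subset {T : Finset (Σ n, cell (univ : Set K) n)}
    (h : BoundaryClosed T) {e} (he : e ∈ T) : closedCell e.1 e.2 ⊆ cellUnion T := by
  rw [← cellFrontier_union_openCell_eq_closedCell]
  refine union_subset ((h e he).trans ?_) (subset_biUnion_of_mem
    (u := fun e : Σ n, cell (univ : Set K) n => openCell e.1 e.2) he)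
  exact iUnion₂_mono fun e' _ => iUnion_subset fun _ => le_rfl

/-- Closure finiteness covers the frontier of a cell by finitely many open cells of lower dimension;
induction on the dimension places each of these in a finite family of the required kind. -/
theorem exists_boundaryClosed (n : ℕ) : ∀ i : cell (univ : Set K) n,
    ∃ T : Finset (Σ n, cell (univ : Set K) n), BoundaryClosed T ∧ ⟨n, i⟩ ∈ T ∧
      ∀ e ∈ T, e ≠ ⟨n, i⟩ → e.1 < n := by
  classical
  induction n using Nat.strong_induction_on with
  | _ n ih =>
    intro i
    obtain ⟨I, hI⟩ := CWComplex.cellFrontier_subset_finite_openCell n i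
    choose T h1 h2 h3 using ih
    let s : Finset (Σ m : Fin n, cell (univ : Set K) m) := Finset.univ.sigma fun m => I m
    let T₀ : Finset (Σ n, cell (univ : Set K) n) := s.biUnion fun e => T e.1 e.1.2 e.2
    have hT₀ : BoundaryClosed T₀ := BoundaryClosed.biUnion fun e _ => h1 _ _ _
    have hlt : ∀ e ∈ T₀, e.1 < n := by
      intro e he
      obtain ⟨e', _, h⟩ := Finset.mem_biUnion.1 he
      by_cases hee : e = ⟨e'.1, e'.2⟩
      · rw [hee]; exact e'.1.2
      · exact (h3 _ _ _ e h hee).trans e'.1.2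
    refine ⟨insert ⟨n, i⟩ T₀, ?_, Finset.mem_insert_self _ _, fun e he hne =>
      hlt e ((Finset.mem_insert.1 he).resolve_left hne)⟩
    intro e he
    rcases Finset.mem_insert.1 he with rfl | he
    · refine hI.trans ?_
      simp only [iUnion_subset_iff]
      intro m hm j hj
      have : (⟨m, j⟩ : Σ n, cell (univ : Set K) n) ∈ T₀ :=
        Finset.mem_biUnion.2 ⟨⟨⟨m, hm⟩, j⟩, by simp [s, hj], h2 m hm j⟩
      intro x hx
      simp only [mem_iUnion]
      exact ⟨⟨m, j⟩, Finset.mem_insert_of_mem this, hm, hx⟩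
    · refine (hT₀ e he).trans ?_
      exact biUnion_subset_biUnion_left fun e' he' => Finset.mem_insert_of_mem he'

theorem exists_boundaryClosed_finset (s : Finset (Σ n, cell (univ : Set K) n)) :
    ∃ T, BoundaryClosed T ∧ s ⊆ T := by
  classical
  choose T h1 h2 _ using fun e : Σ n, cell (univ : Set K) n => exists_boundaryClosed e.1 e.2
  exact ⟨s.biUnion T, BoundaryClosed.biUnion fun e _ => h1 e,
    fun e he => Finset.mem_biUnion.2 ⟨e, he, h2 e⟩⟩

variable [T2Space K]

theorem BoundaryClosed.isClosed {T : Finset (Σ n, cell (univ : Set K) n)}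
    (h : BoundaryClosed T) : IsClosed (cellUnion T) := by
  have : cellUnion T = ⋃ e ∈ T, closedCell e.1 e.2 :=
    Subset.antisymm (iUnion₂_mono fun e _ => openCell_subset_closedCell e.1 e.2)
      (iUnion₂_subset fun e he => h.closedCell_subset he)
  rw [this]
  exact T.finite_toSet.isClosed_biUnion fun e _ => isClosed_closedCell

/-- If `C` met infinitely many open cells, one point from each would form an infinite set all of
whose subsets are closed, because a closed cell lies in finitely many open cells and so contains
finitely many of these points. Such a set has no accumulation point, against compactness of `C`. -/
theorem exists_cellUnion_of_isCompact {C : Set K} (hC : IsCompact C) :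
    ∃ T, BoundaryClosed T ∧ C ⊆ cellUnion T := by
  classical
  let S : Set (Σ n, cell (univ : Set K) n) := {e | (C ∩ openCell e.1 e.2).Nonempty}
  choose x hx using fun e : S => e.2
  have hinj : Function.Injective x := by
    intro e e' h
    by_contra hne
    have hd := disjoint_openCell_of_ne (C := (univ : Set K)) (i := e.1.2) (j := e'.1.2)
      (fun h' => hne (Subtype.ext h'))
    exact disjoint_left.1 hd (hx e).2 (h ▸ (hx e').2)
  have hclosed : ∀ A ⊆ range x, IsClosed A := by
    intro A hA
    refine CWComplex.closed' (C := (univ : Set K)) A (subset_univ _)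
      fun n (j : cell (univ : Set K) n) => ?_
    obtain ⟨T, hT, hj, _⟩ := exists_boundaryClosed n j
    have hfin : (A ∩ closedCell n j).Finite := by
      refine (((T.finite_toSet.preimage Subtype.val_injective.injOn).image x)).subset ?_
      rintro y ⟨hy, hyj⟩
      obtain ⟨e, rfl⟩ := hA hy
      obtain ⟨e', he', hxe'⟩ := mem_iUnion₂.1 (hT.closedCell_subset hj hyj)
      refine ⟨e, ?_, rfl⟩
      by_contra hne
      have hd := disjoint_openCell_of_ne (C := (univ : Set K)) (i := e.1.2) (j := e'.2)
        (fun h' => hne (by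
          have : e.1 = e' := h'
          rw [mem_preimage, this]; exact he'))
      exact disjoint_left.1 hd (hx e).2 hxe'
    exact hfin.isClosed
  have hS : S.Finite := by
    by_contra hinf
    have : Infinite S := (infinite_coe_iff).2 hinf
    obtain ⟨y, _, hy⟩ := (infinite_range_of_injective hinj).exists_accPt_of_subset_isCompact hC
      (range_subset_iff.2 fun e => (hx e).1)
    rw [accPt_principal_iff_nhdsWithin] at hy
    have h1 : y ∈ closure (range x \ {y}) := mem_closure_iff_nhdsWithin_neBot.2 hy
    rw [(hclosed _ sdiff_subset).closure_eq] at h1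
    exact h1.2 rfl
  obtain ⟨T, hT, hST⟩ := exists_boundaryClosed_finset hS.toFinset
  refine ⟨T, hT, fun y hy => ?_⟩
  have : y ∈ ⋃ (n : ℕ) (j : cell (univ : Set K) n), openCell n j := by
    rw [CWComplex.iUnion_openCell_eq_complex]; trivial
  obtain ⟨n, j, hj⟩ := mem_iUnion₂.1 this
  exact mem_iUnion₂.2 ⟨⟨n, j⟩, hST (hS.mem_toFinset.2 ⟨y, hy, hj⟩), hj⟩

/-- Induction on the number of cells. A cell of maximal dimension is not needed for the boundary of
any other, so removing it leaves a family of the same kind, from which the complex is recovered by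
attaching one cell. -/
theorem hExtInto_cellUnion (T : Finset (Σ n, cell (univ : Set K) n)) (hT : BoundaryClosed T) :
    HExtInto.{w} (cellUnion T) := by
  classical
  induction hk : T.card generalizing T with
  | zero =>
    rw [Finset.card_eq_zero] at hk
    subst hk
    simpa [cellUnion] using hExtInto_empty
  | succ k ih =>
    obtain ⟨e, he, hmax⟩ := T.exists_max_image (fun e => e.1)
      (Finset.card_pos.1 (by rw [hk]; exact k.succ_pos))
    obtain ⟨n, i⟩ := e
    have hfr : cellFrontier n i ⊆ cellUnion (T.erase ⟨n, i⟩) := by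
      refine (hT _ he).trans (iUnion₂_subset fun e' he' => iUnion_subset fun hlt => ?_)
      exact subset_biUnion_of_mem (u := fun e : Σ n, cell (univ : Set K) n => openCell e.1 e.2)
        (Finset.mem_erase.2 ⟨fun h => by subst h; exact lt_irrefl _ hlt, he'⟩)
    have hT' : BoundaryClosed (T.erase ⟨n, i⟩) := by
      intro e' he'
      refine (hT _ (Finset.mem_of_mem_erase he')).trans ?_
      refine iUnion₂_subset fun e₂ he₂ => iUnion_subset fun hlt => ?_
      have hne : e₂ ≠ ⟨n, i⟩ := by
        rintro rfl
        exact absurd (hmax _ (Finset.mem_of_mem_erase he')) (not_le.2 hlt)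
      intro x hx
      simp only [mem_iUnion]
      exact ⟨e₂, Finset.mem_erase.2 ⟨hne, he₂⟩, hlt, hx⟩
    have hU : cellUnion T = cellUnion (T.erase ⟨n, i⟩) ∪ map n i '' Metric.closedBall 0 1 := by
      refine Subset.antisymm (iUnion₂_subset fun e' he' => ?_) (union_subset ?_
        (hT.closedCell_subset he))
      · by_cases h : e' = ⟨n, i⟩
        · subst h
          exact (openCell_subset_closedCell n i).trans subset_union_right
        · refine subset_union_of_subset_left ?_ _
          exact subset_biUnion_of_mem (u := fun e : Σ n, cell (univ : Set K) n =>
            openCell e.1 e.2) (Finset.mem_erase.2 ⟨h, he'⟩)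
      · exact biUnion_subset_biUnion_left fun e' he' => Finset.mem_of_mem_erase he'
    rw [hU]
    have hball : ∀ x : Fin n → ℝ, ‖x‖ < 1 → x ∈ (map (C := (univ : Set K)) n i).source := by
      intro x hx
      rw [source_eq]; simpa using hx
    refine HExtInto.attach_cell hT'.isClosed (ih _ hT' ?_) (continuousOn n i)
      (ψ := (map n i).symm) ?_ (fun x hx => (map n i).left_inv (hball x hx)) ?_ ?_
    · rw [Finset.card_erase_of_mem he, hk]; rfl
    · refine (continuousOn_symm n i).mono ?_
      rintro _ ⟨x, hx, rfl⟩
      exact (map n i).map_source (hball x (by simpa using hx))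
    · exact fun x hx => hfr ⟨x, by simpa using hx, rfl⟩
    · intro x hx hmem
      obtain ⟨e', he', h'⟩ := mem_iUnion₂.1 hmem
      have hd := disjoint_openCell_of_ne (C := (univ : Set K)) (i := i) (j := e'.2)
        (fun h' => (Finset.mem_erase.1 he').1 h'.symm)
      exact disjoint_left.1 hd ⟨x, by simpa using hx, rfl⟩ h'

/-- The image of the compact set `A` lies in a finite subcomplex, which reduces the infinite case to
the finite one. -/
theorem hExtInto_univ_of_cwComplex : HExtInto.{w} (univ : Set K) := by
  intro Z _ _ _ A hA f hf _
  obtain ⟨T, hT, hfT⟩ := exists_cellUnion_of_isCompact (hA.isCompact.image_of_continuousOn hf)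
  obtain ⟨N, hN, F, hF, _, H, h1, h2, h3, h4⟩ := hExtInto_cellUnion T hT Z A hA f hf
    (mapsTo_iff_image_subset.2 hfT)
  exact ⟨N, hN, F, hF, mapsTo_univ _ _, H, h1, fun z hz t => eq_true trivial, h3, h4⟩

end CW

/-! ### From spaces of CW type to bundles with such fibres. -/

theorem HExtInto.of_homotopyEquiv {Y K : Type*} [TopologicalSpace Y] [TopologicalSpace K]
    (e : ContinuousMap.HomotopyEquiv Y K) (h : HExtInto.{w} (univ : Set K)) :
    HExtInto.{w} (univ : Set Y) := by
  intro Z _ _ _ A hA f hf _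
  obtain ⟨N, hN, F, hF, _, H, h1, h2, h3, h4⟩ := h Z A hA (fun z => e.toFun (f z))
    (e.toFun.continuous.comp_continuousOn hf) (mapsTo_univ _ _)
  refine ⟨N, hN, fun z => e.invFun (F z), e.invFun.continuous.comp_continuousOn hF,
    mapsTo_univ _ _, LiftHtpy.trans (f₁ := fun z => e.invFun (e.toFun (f z))) ?_ ?_⟩
  · exact ⟨fun p => e.invFun (H p), e.invFun.continuous.comp_continuousOn h1,
      fun z hz t => eq_true trivial, fun z hz t ht => congrArg e.invFun (h3 z hz t ht),
      fun z hz t ht => congrArg e.invFun (h4 z hz t ht)⟩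
  · obtain ⟨L⟩ := e.left_inv
    refine ⟨fun p => L (projIcc 0 1 zero_le_one p.2, f p.1), ?_, fun z hz t => eq_true trivial,
      fun z hz t ht => ?_, fun z hz t ht => ?_⟩
    · refine L.continuous.comp_continuousOn (ContinuousOn.prodMk ?_ ?_)
      · exact (continuous_projIcc.comp continuous_snd).continuousOn
      · exact hf.comp continuousOn_fst fun p hp => hp.1
    · dsimp only
      rw [projIcc_of_le_left _ ht]; exact L.apply_zero _
    · dsimp only
      rw [projIcc_of_right_le _ ht]; exact L.apply_one _

theorem HasCWType.hExtInto {Y : Type u} [TopologicalSpace Y] (h : HasCWType Y) :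
    HExtInto.{w} (univ : Set Y) := by
  obtain ⟨K, _, _, _, ⟨e⟩⟩ := h
  exact HExtInto.of_homotopyEquiv e hExtInto_univ_of_cwComplex

/-- The extension property holds where a map has a fibre coordinate with values in `F`. -/
theorem secExt_of_coordinate {E B F : Type*} [TopologicalSpace E] [TopologicalSpace B]
    [TopologicalSpace F] (hF : HExtInto.{w} (univ : Set F)) {π : E → B} {D : Set B}
    (hD : IsClosed D) {c : E → F} (hc : ContinuousOn c (π ⁻¹' D)) {s : B → F → E}
    (hs : ∀ {W : Type w} [TopologicalSpace W] {K : Set W}, IsCompact K → ∀ {b : W → B} {x : W → F},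
      ContinuousOn b K → MapsTo b K D → ContinuousOn x K → ContinuousOn (fun y => s (b y) (x y)) K)
    (hπ : ∀ b ∈ D, ∀ x, π (s b x) = b) (hsc : ∀ e, π e ∈ D → s (π e) (c e) = e) :
    SecExt.{w} π D := by
  intro Z _ _ _ g A hA hAD σ hσ hσg
  have hσD : MapsTo σ A (π ⁻¹' D) := fun z hz => by
    rw [mem_preimage, hσg z hz]; exact hAD hz
  obtain ⟨N₀, hN₀, F₁, hF₁, _, H, hHc, _, hH0, hH1⟩ := hF Z A hA (fun z => c (σ z))
    (hc.comp hσ hσD) (mapsTo_univ _ _)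
  obtain ⟨N, hN, hNc, hNN₀⟩ := exists_isClosed_nhdsSet hA hN₀
  refine ⟨N, hN, fun z => s (g z) (F₁ z), ?_, fun z hz => hπ _ hz.2 _, ?_⟩
  · exact hs (hNc.inter (hD.preimage g.continuous)).isCompact (by fun_prop) (fun z hz => hz.2)
      (hF₁.mono fun z hz => hNN₀ hz.1)
  · let cl : ℝ → ℝ := fun t => projIcc (0 : ℝ) 1 zero_le_one t
    have hcl : Continuous cl := continuous_subtype_val.comp continuous_projIcc
    have key : ContinuousOn (fun p : Z × ℝ => s (g p.1) (H p)) (A ×ˢ Icc (0 : ℝ) 1) :=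
      hs (hA.isCompact.prod isCompact_Icc) (by fun_prop) (fun p hp => hAD hp.1)
        (hHc.mono (prod_mono_right (subset_univ _)))
    refine ⟨fun p => s (g p.1) (H (p.1, cl p.2)), ?_, ?_, ?_, ?_⟩
    · exact key.comp (f := fun p : Z × ℝ => (p.1, cl p.2)) (by fun_prop)
        fun p hp => ⟨hp.1, (projIcc (0 : ℝ) 1 zero_le_one p.2).2⟩
    · exact fun z hz t => hπ _ (hAD hz) _
    · intro z hz t ht
      simp only [cl, projIcc_of_le_left _ ht]
      rw [hH0 z hz _ le_rfl]
    · intro z hz t ht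
      simp only [cl, projIcc_of_right_le _ ht]
      rw [hH1 z hz _ le_rfl, ← hσg z hz]
      exact hsc _ (hσD hz)

theorem LiftHtpy.of_isEmpty {E B Z : Type*} [TopologicalSpace E] [TopologicalSpace Z] [IsEmpty Z]
    {π : E → B} {g : Z → B} {A : Set Z} {f₀ f₁ : Z → E} : LiftHtpy π g A f₀ f₁ :=
  ⟨fun p => isEmptyElim p.1, continuousOn_of_forall_continuousAt fun p => isEmptyElim p.1,
    fun z => isEmptyElim z, fun z => isEmptyElim z, fun z => isEmptyElim z⟩

theorem secExt_of_isEmpty {E B : Type*} [TopologicalSpace E] [TopologicalSpace B] [IsEmpty B]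
    {π : E → B} {D : Set B} : SecExt.{w} π D := by
  intro Z _ _ _ g A _ _ σ _ _
  have : IsEmpty Z := ⟨fun z => isEmptyElim (g z)⟩
  exact ⟨univ, Filter.univ_mem, fun z => isEmptyElim z,
    continuousOn_of_forall_continuousAt fun z => isEmptyElim z, fun z => isEmptyElim z,
    LiftHtpy.of_isEmpty⟩

namespace PrincipalBundle

variable {S : Type u} [TopologicalSpace S] [Group S] {B : Type u} [TopologicalSpace B]

theorem IsLocTriv.mono {ζ : PrincipalBundle S B} {C D : Set B} {σ : B → ζ.Total}
    {c : ζ.Total → S} (h : ζ.IsLocTriv C σ c) (hD : IsClosed D) (hDC : D ⊆ C) :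
    ζ.IsLocTriv D σ c where
  isClosed := hD
  continuousOn_sec := h.continuousOn_sec.mono hDC
  proj_sec b hb := h.proj_sec b (hDC hb)
  continuousOn_coord := h.continuousOn_coord.mono (preimage_mono hDC)
  act_coord t ht := h.act_coord t (hDC ht)

/-- In a chart the action is multiplication in `S`, which is known to be continuous only along maps
from compact spaces; hence the compact parameter space. -/
theorem continuous_act_of_compact [RegularSpace B] [KGroup S] (ζ : PrincipalBundle S B)
    {W : Type*} [TopologicalSpace W] [CompactSpace W] {t : W → ζ.Total} {x : W → S}
    (ht : Continuous t) (hx : Continuous x) : Continuous fun y => ζ.act (t y) (x y) := by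
  rw [continuous_iff_continuousAt]
  intro y₀
  obtain ⟨U, hU, hb, e, he1, he2⟩ := ζ.exists_triv (ζ.proj (t y₀))
  obtain ⟨C, hC, hCc, hCU⟩ := exists_mem_nhds_isClosed_subset (hU.mem_nhds hb)
  have hp : Continuous fun y => ζ.proj (t y) := ζ.proj.continuous.comp ht
  let K : Set W := (fun y => ζ.proj (t y)) ⁻¹' C
  have hK : IsClosed K := hCc.preimage hp
  suffices ContinuousOn (fun y => ζ.act (t y) (x y)) K from
    this.continuousAt (hp.continuousAt.preimage_mem_nhds hC)
  have : CompactSpace K := isCompact_iff_compactSpace.1 hK.isCompact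
  rw [continuousOn_iff_continuous_domRestrict]
  let t' : K → ζ.proj ⁻¹' U := fun y => ⟨t y, hCU y.2⟩
  have ht' : Continuous t' := by fun_prop
  have h1 : Continuous fun y : K => (e (t' y)).2 * x y :=
    KGroup.kcontinuous_mul.continuous_comp (g := fun y : K => ((e (t' y)).2, x y)) (by fun_prop)
  have h2 : Continuous fun y : K => ((e.symm ((e (t' y)).1, (e (t' y)).2 * x y) :
    ζ.proj ⁻¹' U) : ζ.Total) := by fun_prop
  refine h2.congr fun y => ?_
  rw [← he2 (t' y) (x y), e.symm_apply_apply]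
  rfl

/-- Over a closed set with a local section, a lift is the same as a map into `S`. So the extension
property of `S` gives the local statement, and compactness of `B` globalizes it. -/
theorem secExt_proj [CompactSpace B] [T2Space B] [KGroup S] (ζ : PrincipalBundle S B)
    (hS : HExtInto.{w} (univ : Set S)) : SecExt.{w} ζ.proj univ := by
  rcases isEmpty_or_nonempty B with _ | _
  · exact secExt_of_isEmpty
  have : Nonempty ζ.Total := ζ.proj_surjective.nonempty
  refine secExt_univ_of_local fun b => ?_
  obtain ⟨C, hC, σ, c, h⟩ := ζ.exists_isLocTriv b
  refine ⟨interior C, isOpen_interior, mem_interior_iff_mem_nhds.2 hC, fun D hD hDc => ?_⟩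
  have h' := h.mono hDc (hD.trans interior_subset)
  refine secExt_of_coordinate hS hDc h'.continuousOn_coord (s := fun b x => ζ.act (σ b) x) ?_
    (fun b hb x => by rw [ζ.proj_act, h'.proj_sec b hb]) fun t ht => h'.act_coord t ht
  intro W _ K hK b x hb hbD hx
  have : CompactSpace K := isCompact_iff_compactSpace.1 hK
  rw [continuousOn_iff_continuous_domRestrict] at hx ⊢
  have hσ := h'.continuousOn_sec.comp hb hbD
  rw [continuousOn_iff_continuous_domRestrict] at hσ
  exact ζ.continuous_act_of_compact hσ hx

end PrincipalBundle

theorem Assoc.secExt_proj {S F : Type u} [TopologicalSpace S] [Group S] [TopologicalSpace F]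
    [Group F] {B : Type u} [TopologicalSpace B] [CompactSpace B] [T2Space B]
    (ζ : PrincipalBundle S B) (a : AutAction S F) (hF : HExtInto.{w} (univ : Set F)) :
    SecExt.{w} (Assoc.proj : Assoc ζ a → B) univ := by
  rcases isEmpty_or_nonempty B with _ | _
  · exact secExt_of_isEmpty
  have : Nonempty (Assoc ζ a) := ‹Nonempty B›.map fun b => Assoc.fone a b
  refine secExt_univ_of_local fun b => ?_
  obtain ⟨C, hC, σ, c, h⟩ := ζ.exists_isLocTriv b
  refine ⟨interior C, isOpen_interior, mem_interior_iff_mem_nhds.2 hC, fun D hD hDc => ?_⟩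
  have h' := h.mono hDc (hD.trans interior_subset)
  refine secExt_of_coordinate hF hDc (Assoc.continuousOn_coord h')
    (s := fun b x => Assoc.mk a (σ b) x) ?_ (fun b hb x => by rw [Assoc.proj_mk, h'.proj_sec b hb])
    fun p hp => Assoc.mk_coord _ _ (h'.proj_sec _ hp).symm
  intro W _ K hK b x hb hbD hx
  exact Assoc.continuousOn_mk hK (h'.continuousOn_sec.comp hb hbD) hx

/-! ### Inverse systems inside the product of their stages. -/

/-- A compact Hausdorff space as the limit of an inverse system of compact Hausdorff spaces. -/
structure CompactSystem (X : Type u) [TopologicalSpace X] (J : Type v) [Preorder J] where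
  space : J → Type u
  [top : ∀ j, TopologicalSpace (space j)]
  [t2 : ∀ j, T2Space (space j)]
  [compact : ∀ j, CompactSpace (space j)]
  map : ∀ j i, j ≤ i → C(space i, space j)
  map_map : ∀ k j i (hkj : k ≤ j) (hji : j ≤ i) x,
    map k j hkj (map j i hji x) = map k i (hkj.trans hji) x
  proj : ∀ j, C(X, space j)
  map_proj : ∀ j i (h : j ≤ i) x, map j i h (proj i x) = proj j x
  proj_inj : ∀ x y, (∀ j, proj j x = proj j y) → x = y
  exists_proj : ∀ y : ∀ j, space j, (∀ j i (h : j ≤ i), map j i h (y i) = y j) →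
    ∃ x, ∀ j, proj j x = y j

attribute [instance] CompactSystem.top CompactSystem.t2 CompactSystem.compact

namespace CompactSystem

variable {X : Type u} [TopologicalSpace X] {J : Type v} [Preorder J] (P : CompactSystem X J)

/-- The points of the product that are determined up to stage `k` by their `k`-th coordinate. -/
def threads (k : J) : Set (∀ j, P.space j) := {z | ∀ i (h : i ≤ k), P.map i k h (z k) = z i}

/-- The points of the product that come from the limit. -/
def limitSet : Set (∀ j, P.space j) := {z | ∀ i k (h : i ≤ k), P.map i k h (z k) = z i}

theorem isClosed_threads (k : J) : IsClosed (P.threads k) := by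
  have : P.threads k = ⋂ i, ⋂ h : i ≤ k, {z | P.map i k h (z k) = z i} := by
    ext z; simp [threads]
  rw [this]
  exact isClosed_iInter fun i => isClosed_iInter fun h => isClosed_eq (by fun_prop) (by fun_prop)

theorem threads_anti {k l : J} (h : k ≤ l) : P.threads l ⊆ P.threads k := by
  intro z hz i hi
  rw [← hz k h, P.map_map, hz i]

theorem iInter_threads : ⋂ k, P.threads k = P.limitSet := by
  ext z
  simp only [mem_iInter]
  exact ⟨fun h i k => h k i, fun h k i => h i k⟩

theorem isClosed_limitSet : IsClosed P.limitSet := by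
  rw [← iInter_threads]; exact isClosed_iInter P.isClosed_threads

/-- The map of the limit into the product. -/
def incl (x : X) : ∀ j, P.space j := fun j => P.proj j x

theorem continuous_incl : Continuous P.incl := by unfold incl; fun_prop

theorem incl_injective : Function.Injective P.incl :=
  fun x y h => P.proj_inj x y fun j => congrFun h j

theorem range_incl : range P.incl = P.limitSet := by
  ext z
  constructor
  · rintro ⟨x, rfl⟩
    exact fun i k h => P.map_proj i k h x
  · intro h
    obtain ⟨x, hx⟩ := P.exists_proj z h
    exact ⟨x, funext hx⟩

theorem isClosedEmbedding_incl [CompactSpace X] : Topology.IsClosedEmbedding P.incl :=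
  P.continuous_incl.isClosedEmbedding P.incl_injective

/-- A retraction of the product onto the limit. -/
noncomputable def retr [Nonempty X] : (∀ j, P.space j) → X := Function.invFun P.incl

@[simp] theorem retr_incl [Nonempty X] (x : X) : P.retr (P.incl x) = x :=
  Function.leftInverse_invFun P.incl_injective x

theorem incl_retr [Nonempty X] {z} (hz : z ∈ P.limitSet) : P.incl (P.retr z) = z := by
  rw [← range_incl] at hz
  exact Function.invFun_eq hz

theorem proj_retr [Nonempty X] {z} (hz : z ∈ P.limitSet) (j : J) : P.proj j (P.retr z) = z j :=
  congrFun (P.incl_retr hz) j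

theorem continuousOn_retr [Nonempty X] [CompactSpace X] : ContinuousOn P.retr P.limitSet := by
  rw [continuousOn_iff_continuous_domRestrict, P.isClosedEmbedding_incl.isInducing.continuous_iff]
  exact continuous_subtype_val.congr fun z => (P.incl_retr z.2).symm

open Classical in
/-- The section of the projection to stage `k`, with values in `threads k`, whose remaining
coordinates are those of a base point. -/
noncomputable def sec (z₀ : ∀ j, P.space j) (k : J) (y : P.space k) : ∀ j, P.space j :=
  fun i => if h : i ≤ k then P.map i k h y else z₀ i

theorem continuous_sec (z₀ : ∀ j, P.space j) (k : J) : Continuous (P.sec z₀ k) := by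
  refine continuous_pi fun i => ?_
  by_cases h : i ≤ k
  · simpa [sec, h] using (P.map i k h).continuous
  · simpa [sec, h] using continuous_const

theorem sec_apply (z₀ : ∀ j, P.space j) {k i : J} (h : i ≤ k) (y : P.space k) :
    P.sec z₀ k y i = P.map i k h y := by simp [sec, h]

theorem sec_mem (z₀ : ∀ j, P.space j) (k : J) (y : P.space k) : P.sec z₀ k y ∈ P.threads k := by
  intro i h
  rw [P.sec_apply z₀ h, P.sec_apply z₀ le_rfl, P.map_map]

variable [IsDirectedOrder J] [Nonempty J]

/-- The sets `W × threads k` are closed in a compact space, decrease with `k` and intersect in `W ×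
limitSet`; so one of them lies in any given neighbourhood of the intersection. -/
theorem exists_threads_subset {W : Type*} [TopologicalSpace W] [CompactSpace W] [T2Space W]
    {N : Set (W × ∀ j, P.space j)} (hN : ∀ w, ∀ z ∈ P.limitSet, N ∈ 𝓝 (w, z)) (m : J) :
    ∃ k, m ≤ k ∧ ∀ w, ∀ z ∈ P.threads k, (w, z) ∈ N := by
  obtain ⟨k, hk⟩ := exists_subset_nhds_of_isCompact
    (V := fun k => {p : W × ∀ j, P.space j | p.2 ∈ P.threads k})
    (directed_of_isDirected_le fun i j h p hp => P.threads_anti h hp)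
    (fun k => ((P.isClosed_threads k).preimage continuous_snd).isCompact) (U := N) (by
      rintro ⟨w, z⟩ hz
      refine hN w z ?_
      rw [← iInter_threads]
      exact mem_iInter.2 fun k => mem_iInter.1 hz k)
  obtain ⟨l, hml, hkl⟩ := exists_ge_ge m k
  exact ⟨l, hml, fun w z hz => hk (show (w, z).2 ∈ P.threads k from P.threads_anti hkl hz)⟩

/-- If all late stages were inhabited, then the empty set, being a neighbourhood of the empty limit,
would contain some `threads k`; but `sec` takes values there. -/
theorem exists_isEmpty [IsEmpty X] (m : J) : ∃ k, m ≤ k ∧ IsEmpty (P.space k) := by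
  by_contra! h
  have hne : ∀ i, Nonempty (P.space i) := fun i => by
    obtain ⟨k, hm, hi⟩ := exists_ge_ge m i
    exact (h k hm).map (P.map i k hi)
  let z₀ : ∀ j, P.space j := fun j => Classical.arbitrary _
  obtain ⟨k, _, hk⟩ := P.exists_threads_subset (W := Unit) (N := ∅) (by
    intro _ z hz
    obtain ⟨x, _⟩ := P.exists_proj z hz
    exact isEmptyElim x) m
  exact hk () _ (P.sec_mem z₀ k (z₀ k))

theorem liftHtpy_path {E B Z : Type*} [TopologicalSpace E] [TopologicalSpace Z]
    {π : E → B} {g : Z → B} {f : Z × unitInterval → E} (hf : Continuous f) (hg : ∀ p, π (f p) = g p.1) :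
    LiftHtpy π g univ (fun z => f (z, 0)) (fun z => f (z, 1)) := by
  refine ⟨fun p => f (p.1, projIcc 0 1 zero_le_one p.2), ?_, fun z _ t => hg _, ?_, ?_⟩
  · exact (hf.comp (continuous_fst.prodMk (continuous_projIcc.comp continuous_snd))).continuousOn
  · intro z _ t ht
    dsimp only
    rw [projIcc_of_le_left _ ht]; rfl
  · intro z _ t ht
    dsimp only
    rw [projIcc_of_right_le _ ht]; rfl

variable [CompactSpace X]
  {E B : Type*} [TopologicalSpace E] [TopologicalSpace B] {π : E → B}
  {Q : Type q} [TopologicalSpace Q] [CompactSpace Q] [T2Space Q]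

/-- Up to homotopy, lifts over the limit come from lifts over a stage of the system. -/
theorem exists_stage_lift [T2Space X] (h : SecExt.{max q u v} π univ) (m : J) (b : C(P.space m, B))
    (σ : C(Q × X, E)) (hσ : ∀ p, π (σ p) = b (P.proj m p.2)) :
    ∃ k, ∃ hmk : m ≤ k, ∃ τ : C(Q × P.space k, E), (∀ p, π (τ p) = b (P.map m k hmk p.2)) ∧
      LiftHtpy π (fun p : Q × X => b (P.proj m p.2)) univ (fun p => τ (p.1, P.proj k p.2)) σ := by
  rcases isEmpty_or_nonempty X with hX | hX
  · obtain ⟨k, hmk, hk⟩ := P.exists_isEmpty m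
    refine ⟨k, hmk, ⟨fun p => isEmptyElim p.2, continuous_iff_continuousAt.2 fun p =>
      isEmptyElim p.2⟩, fun p => isEmptyElim p.2, LiftHtpy.of_isEmpty⟩
  have cL : IsClosed {p : Q × ∀ j, P.space j | p.2 ∈ P.limitSet} :=
    P.isClosed_limitSet.preimage continuous_snd
  -- The lift `σ`, carried to `Q × limitSet` by `retr`, is extended to a neighbourhood in the
  -- product of `Q` with all stages. The base point there depends on coordinate `m` alone, so it
  -- makes sense off the limit.
  obtain ⟨N₀, hN₀, τ, hτc, hτg, hτσ⟩ := h (Q × ∀ j, P.space j)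
    ⟨fun p => b (p.2 m), by fun_prop⟩ {p | p.2 ∈ P.limitSet} cL (subset_univ _)
    (fun p => σ (p.1, P.retr p.2))
    (σ.continuous.comp_continuousOn (continuousOn_fst.prodMk
      (P.continuousOn_retr.comp continuousOn_snd fun p hp => hp)))
    (fun p hp => by rw [hσ, P.proj_retr hp]; rfl)
  simp only [preimage_univ, inter_univ] at hτc hτg
  obtain ⟨N, hN, hNc, hNN₀⟩ := exists_isClosed_nhdsSet cL hN₀
  replace hτc := hτc.mono hNN₀
  have hNL : ∀ p : Q × ∀ j, P.space j, p.2 ∈ P.limitSet → p ∈ N :=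
    fun p hp => subset_of_mem_nhdsSet hN hp
  have hincl : ∀ x, P.incl x ∈ P.limitSet := fun x => by rw [← range_incl]; exact ⟨x, rfl⟩
  have hτi : Continuous fun p : Q × X => τ (p.1, P.incl p.2) :=
    hτc.comp_continuous (by have := P.continuous_incl; fun_prop) fun p => hNL _ (hincl _)
  -- nearby points have homotopic images
  let f₂ : (((Q × X) × unitInterval) × ∀ j, P.space j) → E := fun y =>
    if y.1.2 = 0 then τ (y.1.1.1, y.2) else τ (y.1.1.1, P.incl y.1.1.2)
  -- A point consists of `q`, `x`, a time `t` and a point `z` of the product. The lifts `τ (q, z)`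
  -- at `t = 0` and `τ (q, P.incl x)` at `t = 1` lie over the same base point, as `D₁` demands that
  -- `z` and `x` agree at stage `m`. On `D₃`, where `z` is the image of `x`, they are joined by a
  -- constant path. Extension to a neighbourhood of `D₃` joins them, up to homotopy at the two ends,
  -- as soon as `z` is close to `x`.
  let D₁ : Set (((Q × X) × unitInterval) × ∀ j, P.space j) :=
    {y | y.1.2 = 0 ∧ (y.1.1.1, y.2) ∈ N ∧ y.2 m = P.proj m y.1.1.2}
  let D₂ : Set (((Q × X) × unitInterval) × ∀ j, P.space j) := {y | y.1.2 = 1}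
  let D₃ : Set (((Q × X) × unitInterval) × ∀ j, P.space j) := {y | y.2 = P.incl y.1.1.2}
  have cD₁ : IsClosed D₁ := (isClosed_eq (by fun_prop) continuous_const).inter
    ((hNc.preimage (f := fun y : (((Q × X) × unitInterval) × ∀ j, P.space j) => (y.1.1.1, y.2))
      (by fun_prop)).inter
      (isClosed_eq (by fun_prop) (by fun_prop)))
  have cD₂ : IsClosed D₂ := isClosed_eq (by fun_prop) continuous_const
  have cD₃ : IsClosed D₃ := isClosed_eq (by fun_prop) (by have := P.continuous_incl; fun_prop)
  have e₁ : ∀ y ∈ D₁, f₂ y = τ (y.1.1.1, y.2) := fun y hy => if_pos hy.1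
  have e₂ : ∀ y ∈ D₂, f₂ y = τ (y.1.1.1, P.incl y.1.1.2) := fun y hy => if_neg (by
    have : y.1.2 = 1 := hy
    rw [this]; exact one_ne_zero)
  have e₃ : ∀ y ∈ D₃, f₂ y = τ (y.1.1.1, P.incl y.1.1.2) := fun y hy => by
    have hy' : y.2 = P.incl y.1.1.2 := hy
    simp only [f₂, hy', ite_self]
  have kI : Continuous fun y : (((Q × X) × unitInterval) × ∀ j, P.space j) =>
      τ (y.1.1.1, P.incl y.1.1.2) :=
    hτi.comp (f := fun y : (((Q × X) × unitInterval) × ∀ j, P.space j) => (y.1.1.1, y.1.1.2))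
      (by fun_prop)
  have k₁ : ContinuousOn f₂ D₁ :=
    (hτc.comp (f := fun y : (((Q × X) × unitInterval) × ∀ j, P.space j) => (y.1.1.1, y.2)) (by fun_prop)
      fun y hy => hy.2.1).congr e₁
  have hτN : ∀ p ∈ N, π (τ p) = b (p.2 m) := fun p hp => hτg p (hNN₀ hp)
  have hτI : ∀ y : (((Q × X) × unitInterval) × ∀ j, P.space j),
      π (τ (y.1.1.1, P.incl y.1.1.2)) = b (P.proj m y.1.1.2) := fun y =>
    hτN _ (hNL _ (hincl _))
  obtain ⟨N₂, hN₂, τ₂, hτ₂c, hτ₂g, hτ₂⟩ := h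
    (((Q × X) × unitInterval) × ∀ j, P.space j) ⟨fun y => b (P.proj m y.1.1.2), by fun_prop⟩
    (D₁ ∪ D₂ ∪ D₃) ((cD₁.union cD₂).union cD₃) (subset_univ _) f₂
    ((k₁.union_of_isClosed (kI.continuousOn.congr e₂) cD₁ cD₂).union_of_isClosed
      (kI.continuousOn.congr e₃) (cD₁.union cD₂) cD₃) (by
      rintro y ((hy | hy) | hy)
      · rw [e₁ y hy, hτN _ hy.2.1]; exact congrArg b hy.2.2
      · rw [e₂ y hy]; exact hτI y
      · rw [e₃ y hy]; exact hτI y)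
  simp only [preimage_univ, inter_univ] at hτ₂c hτ₂g
  obtain ⟨k₀, hmk₀, hk₀⟩ := P.exists_threads_subset (N := N)
    (fun w z hz => mem_nhdsSet_iff_forall.1 hN (w, z) hz) m
  -- The closed sets on which `z` and `x` agree at all stages below `k` shrink to `D₃`, so one of
  -- them lies in `N₂`. For large `k` it contains the point of the product obtained from `x` by
  -- projecting to stage `k` and applying `sec`.
  obtain ⟨k₁', hk₁'⟩ := exists_subset_nhds_of_isCompact
    (V := fun k => {y : (((Q × X) × unitInterval) × ∀ j, P.space j) |
      ∀ i ≤ k, y.2 i = P.proj i y.1.1.2})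
    (directed_of_isDirected_le fun i j hij y hy l hl => hy l (hl.trans hij))
    (fun k => by
      refine IsClosed.isCompact ?_
      simp only [ofPred_forall]
      exact isClosed_iInter fun i => isClosed_iInter fun h =>
        isClosed_eq (by fun_prop) (by fun_prop)) (U := N₂) (by
      intro y hy
      refine mem_nhdsSet_iff_forall.1 hN₂ y (Or.inr (funext fun i => ?_))
      exact mem_iInter.1 hy i i le_rfl)
  obtain ⟨k, hk₀k, hk₁k⟩ := exists_ge_ge k₀ k₁'
  have hmk := hmk₀.trans hk₀k
  let z₀ : ∀ j, P.space j := P.incl (Classical.arbitrary X)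
  have hsN : ∀ p : Q × P.space k, (p.1, P.sec z₀ k p.2) ∈ N := fun p =>
    hk₀ _ _ (P.threads_anti hk₀k (P.sec_mem z₀ k p.2))
  have cs := P.continuous_sec z₀ k
  have hsN₂ : ∀ (p : Q × X) (t : unitInterval),
      ((p, t), P.sec z₀ k (P.proj k p.2)) ∈ N₂ := fun p t =>
    hk₁' fun i hi => by
      show P.sec z₀ k (P.proj k p.2) i = P.proj i p.2
      rw [P.sec_apply z₀ (hi.trans hk₁k), P.map_proj]
  refine ⟨k, hmk, ⟨fun p => τ (p.1, P.sec z₀ k p.2), hτc.comp_continuous (by fun_prop) hsN⟩,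
    ?_, ?_⟩
  · intro p
    refine (hτN _ (hsN p)).trans ?_
    exact congrArg b (P.sec_apply z₀ hmk p.2)
  · have l₀ : ∀ p : Q × X, ((p, (0 : unitInterval)), P.sec z₀ k (P.proj k p.2)) ∈ D₁ := fun p =>
      ⟨rfl, hsN (p.1, P.proj k p.2), by
        show P.sec z₀ k (P.proj k p.2) m = P.proj m p.2
        rw [P.sec_apply z₀ hmk, P.map_proj]⟩
    have l₁ : ∀ p : Q × X, ((p, (1 : unitInterval)), P.sec z₀ k (P.proj k p.2)) ∈ D₂ :=
      fun p => rfl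
    have c₀ : LiftHtpy π (fun p : Q × X => b (P.proj m p.2)) univ
        (fun p => τ₂ ((p, 0), P.sec z₀ k (P.proj k p.2)))
        (fun p => τ (p.1, P.sec z₀ k (P.proj k p.2))) := by
      refine (hτ₂.comp (k := fun p : Q × X => ((p, (0 : unitInterval)),
        P.sec z₀ k (P.proj k p.2))) (A' := univ) (by fun_prop)
        fun p _ => Or.inl (Or.inl (l₀ p))).congr (fun p _ => rfl) fun p _ => (e₁ _ (l₀ p)).symm
    have c₁ : LiftHtpy π (fun p : Q × X => b (P.proj m p.2)) univ
        (fun p => τ₂ ((p, 1), P.sec z₀ k (P.proj k p.2)))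
        (fun p => τ (p.1, P.incl p.2)) := by
      refine (hτ₂.comp (k := fun p : Q × X => ((p, (1 : unitInterval)),
        P.sec z₀ k (P.proj k p.2))) (A' := univ) (by fun_prop)
        fun p _ => Or.inl (Or.inr (l₁ p))).congr (fun p _ => rfl) fun p _ => (e₂ _ (l₁ p)).symm
    have c₂ : LiftHtpy π (fun p : Q × X => b (P.proj m p.2)) univ
        (fun p => τ₂ ((p, 0), P.sec z₀ k (P.proj k p.2)))
        (fun p => τ₂ ((p, 1), P.sec z₀ k (P.proj k p.2))) :=
      liftHtpy_path (f := fun r : (Q × X) × unitInterval => τ₂ (r, P.sec z₀ k (P.proj k r.1.2)))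
        (hτ₂c.comp_continuous (by fun_prop) fun r => hsN₂ r.1 r.2) fun r => hτ₂g _ (hsN₂ r.1 r.2)
    have c₃ : LiftHtpy π (fun p : Q × X => b (P.proj m p.2)) univ
        (fun p => τ (p.1, P.incl p.2)) σ := by
      refine (hτσ.comp (k := fun p : Q × X => (p.1, P.incl p.2)) (A' := univ)
        (by have := P.continuous_incl; fun_prop) fun p _ => hincl p.2).congr (fun p _ => rfl)
        fun p _ => ?_
      simp
    exact ((c₀.symm.trans c₂).trans c₁).trans c₃

/-- Lifts over a stage of the system whose pullbacks to the limit are homotopic are homotopic over a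
later stage. -/
theorem exists_stage_homotopy (h : SecExt.{max q u v} π univ) (k : J) (b : C(P.space k, B))
    (τ₀ τ₁ : C(Q × P.space k, E)) (hτ₀ : ∀ p, π (τ₀ p) = b p.2) (hτ₁ : ∀ p, π (τ₁ p) = b p.2)
    (H : LiftHtpy π (fun p : Q × X => b (P.proj k p.2)) univ (fun p => τ₀ (p.1, P.proj k p.2))
      (fun p => τ₁ (p.1, P.proj k p.2))) :
    ∃ l, ∃ hkl : k ≤ l, LiftHtpy π (fun p : Q × P.space l => b (P.map k l hkl p.2)) univ
      (fun p => τ₀ (p.1, P.map k l hkl p.2)) (fun p => τ₁ (p.1, P.map k l hkl p.2)) := by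
  rcases isEmpty_or_nonempty X with hX | hX
  · obtain ⟨l, hkl, hl⟩ := P.exists_isEmpty k
    exact ⟨l, hkl, LiftHtpy.of_isEmpty⟩
  obtain ⟨H, hHc, hHg, hH0, hH1⟩ := H
  -- The homotopy over the limit (`D₃`) and the given lifts at times 0 and 1 (`D₁`, `D₂`) form a
  -- single lift on a closed set. Its extension, restricted along `sec`, is a homotopy at a stage,
  -- whose ends are still homotopic to the given lifts.
  let f : ((Q × unitInterval) × ∀ j, P.space j) → E := fun y =>
    if y.1.2 = 0 then τ₀ (y.1.1, y.2 k) else if y.1.2 = 1 then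
    τ₁ (y.1.1, y.2 k) else H ((y.1.1, P.retr y.2), y.1.2)
  let D₁ : Set ((Q × unitInterval) × ∀ j, P.space j) := {y | y.1.2 = 0}
  let D₂ : Set ((Q × unitInterval) × ∀ j, P.space j) := {y | y.1.2 = 1}
  let D₃ : Set ((Q × unitInterval) × ∀ j, P.space j) := {y | y.2 ∈ P.limitSet}
  have cD₁ : IsClosed D₁ := isClosed_eq (by fun_prop) continuous_const
  have cD₂ : IsClosed D₂ := isClosed_eq (by fun_prop) continuous_const
  have cD₃ : IsClosed D₃ := P.isClosed_limitSet.preimage continuous_snd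
  have e₁ : ∀ y ∈ D₁, f y = τ₀ (y.1.1, y.2 k) := fun y hy => if_pos hy
  have e₂ : ∀ y ∈ D₂, f y = τ₁ (y.1.1, y.2 k) := fun y hy => by
    have hy' : y.1.2 = 1 := hy
    simp [f, hy']
  have e₃ : ∀ y ∈ D₃, f y = H ((y.1.1, P.retr y.2), y.1.2) := fun y hy => by
    simp only [f]
    split_ifs with h1 h2
    · rw [hH0 _ trivial _ (by simp [h1])]
      dsimp only
      rw [P.proj_retr hy]
    · rw [hH1 _ trivial _ (by simp [h2])]
      dsimp only
      rw [P.proj_retr hy]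
    · rfl
  have k₃ : ContinuousOn f D₃ := by
    refine ContinuousOn.congr (hHc.comp (f := fun y : ((Q × unitInterval) × ∀ j, P.space j) =>
      ((y.1.1, P.retr y.2), (y.1.2 : ℝ))) ?_
      fun y _ => ⟨trivial, trivial⟩) e₃
    refine ContinuousOn.prodMk (ContinuousOn.prodMk (by fun_prop) ?_) (by fun_prop)
    exact P.continuousOn_retr.comp continuousOn_snd fun y hy => hy
  obtain ⟨N, hN, τ, hτc, hτg, hτ⟩ := h
    ((Q × unitInterval) × ∀ j, P.space j) ⟨fun y => b (y.2 k), by fun_prop⟩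
    (D₁ ∪ D₂ ∪ D₃) ((cD₁.union cD₂).union cD₃) (subset_univ _) f
    (((ContinuousOn.congr (by fun_prop) e₁).union_of_isClosed (ContinuousOn.congr (by fun_prop) e₂)
      cD₁ cD₂).union_of_isClosed k₃ (cD₁.union cD₂) cD₃) (by
      rintro y ((hy | hy) | hy)
      · rw [e₁ y hy, hτ₀]; rfl
      · rw [e₂ y hy, hτ₁]; rfl
      · rw [e₃ y hy, hHg _ trivial]
        exact congrArg b (P.proj_retr hy k))
  simp only [preimage_univ, inter_univ] at hτc hτg
  obtain ⟨l, hkl, hl⟩ := P.exists_threads_subset (N := N)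
    (fun w z hz => mem_nhdsSet_iff_forall.1 hN (w, z) (Or.inr hz)) k
  let z₀ : ∀ j, P.space j := P.incl (Classical.arbitrary X)
  have cs := P.continuous_sec z₀ l
  have hsN : ∀ (p : Q × P.space l) (t : unitInterval), ((p.1, t), P.sec z₀ l p.2) ∈ N :=
    fun p t => hl _ _ (P.sec_mem z₀ l p.2)
  refine ⟨l, hkl, ?_⟩
  have c₀ : LiftHtpy π (fun p : Q × P.space l => b (P.map k l hkl p.2)) univ
      (fun p => τ ((p.1, 0), P.sec z₀ l p.2)) (fun p => τ₀ (p.1, P.map k l hkl p.2)) := by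
    have := (hτ.comp (k := fun p : Q × P.space l => ((p.1, (0 : unitInterval)),
      P.sec z₀ l p.2)) (A' := univ) (by fun_prop) fun p _ => Or.inl (Or.inl rfl))
    simp only [Function.comp_def, ContinuousMap.coe_mk, P.sec_apply z₀ hkl] at this
    refine this.congr (fun p _ => rfl) fun p _ => ?_
    rw [e₁ _ rfl]
    exact congrArg (fun y => τ₀ (p.1, y)) (P.sec_apply z₀ hkl p.2).symm
  have c₁ : LiftHtpy π (fun p : Q × P.space l => b (P.map k l hkl p.2)) univ
      (fun p => τ ((p.1, 1), P.sec z₀ l p.2)) (fun p => τ₁ (p.1, P.map k l hkl p.2)) := by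
    have := (hτ.comp (k := fun p : Q × P.space l => ((p.1, (1 : unitInterval)),
      P.sec z₀ l p.2)) (A' := univ) (by fun_prop) fun p _ => Or.inl (Or.inr rfl))
    simp only [Function.comp_def, ContinuousMap.coe_mk, P.sec_apply z₀ hkl] at this
    refine this.congr (fun p _ => rfl) fun p _ => ?_
    rw [e₂ _ rfl]
    exact congrArg (fun y => τ₁ (p.1, y)) (P.sec_apply z₀ hkl p.2).symm
  have c₂ : LiftHtpy π (fun p : Q × P.space l => b (P.map k l hkl p.2)) univ
      (fun p => τ ((p.1, 0), P.sec z₀ l p.2)) (fun p => τ ((p.1, 1), P.sec z₀ l p.2)) :=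
    liftHtpy_path (f := fun r : (Q × P.space l) × unitInterval =>
      τ ((r.1.1, r.2), P.sec z₀ l r.1.2))
      (hτc.comp_continuous (by fun_prop) fun r => hsN r.1 r.2) fun r => by
        rw [hτg _ (hsN r.1 r.2)]
        exact congrArg b (P.sec_apply z₀ hkl _)
  exact (c₀.symm.trans c₂).trans c₁

end CompactSystem

/-! ### Multiplication by a compact family is continuous on the ordinary product. -/

section Joint

variable {S : Type u} [TopologicalSpace S] [Group S] [CompactlyCoherentSpace S] [KGroup S]

/-- `S` need not be locally compact, so continuity on compact sets does not suffice directly. The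
curried map `S → C(W, S)` can be tested on compact sets because `S` is compactly coherent, and it
can be uncurried because `W` is compact Hausdorff. -/
theorem continuous_mul_of_compact_left {W : Type*} [TopologicalSpace W] [CompactSpace W]
    [T2Space W] {y : W → S} (hy : Continuous y) : Continuous fun p : W × S => y p.1 * p.2 := by
  have hc : ∀ x : S, Continuous fun w => y w * x := fun x =>
    KGroup.continuous_mul_of_compact hy continuous_const
  let c : S → C(W, S) := fun x => ⟨_, hc x⟩
  have hcc : Continuous c := by
    refine KContinuous.continuous fun L hL => ?_
    have : CompactSpace L := isCompact_iff_compactSpace.1 hL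
    rw [continuousOn_iff_continuous_domRestrict]
    refine ContinuousMap.continuous_of_continuous_uncurry _ ?_
    exact KGroup.continuous_mul_of_compact (f := fun p : L × W => y p.2)
      (g := fun p : L × W => (p.1 : S)) (by fun_prop) (by fun_prop)
  exact (ContinuousMap.continuous_uncurry_of_continuous ⟨c, hcc⟩).comp continuous_swap

end Joint

/-! ### Differences of points in a fibre. -/

namespace PrincipalBundle

variable {S : Type u} [TopologicalSpace S] [Group S] {B B' : Type u} [TopologicalSpace B]
  [TopologicalSpace B']

theorem act_left_inj (ξ : PrincipalBundle S B) {t : ξ.Total} {s s' : S}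
    (h : ξ.act t s = ξ.act t s') : s = s' := by
  have : ξ.act (ξ.act t s) (s⁻¹ * s') = ξ.act t s := by
    rw [← ξ.act_mul, mul_inv_cancel_left, h]
  exact (inv_mul_eq_one.1 (ξ.act_inj this))

open Classical in
/-- The element of the structure group that moves `t` to `t'`. -/
noncomputable def diff (ξ : PrincipalBundle S B) (t t' : ξ.Total) : S :=
  if h : ξ.proj t = ξ.proj t' then (ξ.exists_act h).choose else 1

theorem act_diff (ξ : PrincipalBundle S B) {t t' : ξ.Total} (h : ξ.proj t = ξ.proj t') :
    ξ.act t (ξ.diff t t') = t' := by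
  rw [diff, dif_pos h]; exact (ξ.exists_act h).choose_spec

theorem diff_eq (ξ : PrincipalBundle S B) {t t' : ξ.Total} {s : S} (h : ξ.act t s = t') :
    ξ.diff t t' = s := by
  have hp : ξ.proj t = ξ.proj t' := by rw [← h, ξ.proj_act]
  exact ξ.act_left_inj ((ξ.act_diff hp).trans h.symm)

theorem diff_self (ξ : PrincipalBundle S B) (t : ξ.Total) : ξ.diff t t = 1 :=
  ξ.diff_eq (ξ.act_one t)

theorem diff_act (ξ : PrincipalBundle S B) {t t' : ξ.Total} (h : ξ.proj t = ξ.proj t') (s : S) :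
    ξ.diff t (ξ.act t' s) = ξ.diff t t' * s :=
  ξ.diff_eq (by rw [ξ.act_mul, ξ.act_diff h])

theorem diff_mul_diff (ξ : PrincipalBundle S B) {t t' t'' : ξ.Total} (h : ξ.proj t = ξ.proj t')
    (h' : ξ.proj t' = ξ.proj t'') : ξ.diff t t' * ξ.diff t' t'' = ξ.diff t t'' :=
  (ξ.diff_eq (by rw [ξ.act_mul, ξ.act_diff h, ξ.act_diff h'])).symm

variable [CompactlyCoherentSpace S] [KGroup S]

theorem continuous_act_prod [RegularSpace B] (ξ : PrincipalBundle S B) {W : Type*}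
    [TopologicalSpace W] [CompactSpace W] [T2Space W] {y : W → ξ.Total} (hy : Continuous y) :
    Continuous fun p : W × S => ξ.act (y p.1) p.2 := by
  rw [continuous_iff_continuousAt]
  rintro ⟨w₀, s₀⟩
  obtain ⟨U, hU, hb, e, he1, he2⟩ := ξ.exists_triv (ξ.proj (y w₀))
  obtain ⟨C, hC, hCc, hCU⟩ := exists_mem_nhds_isClosed_subset (hU.mem_nhds hb)
  have hp : Continuous fun w => ξ.proj (y w) := ξ.proj.continuous.comp hy
  let K : Set W := (fun w => ξ.proj (y w)) ⁻¹' C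
  have hK : IsClosed K := hCc.preimage hp
  have : CompactSpace K := isCompact_iff_compactSpace.1 hK.isCompact
  suffices ContinuousOn (fun p : W × S => ξ.act (y p.1) p.2) (K ×ˢ univ) from
    this.continuousAt (prod_mem_nhds (hp.continuousAt.preimage_mem_nhds hC) Filter.univ_mem)
  let y' : K → ξ.proj ⁻¹' U := fun w => ⟨y w, hCU w.2⟩
  have hy' : Continuous y' := by fun_prop
  have h1 : Continuous fun p : K × S => (e (y' p.1)).2 * p.2 :=
    continuous_mul_of_compact_left (y := fun w => (e (y' w)).2) (by fun_prop)
  have h2 : Continuous fun p : K × S => ((e.symm ((e (y' p.1)).1, (e (y' p.1)).2 * p.2) :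
    ξ.proj ⁻¹' U) : ξ.Total) := by fun_prop
  have h3 : Continuous fun p : K × S => ξ.act (y p.1) p.2 := by
    refine h2.congr fun p => ?_
    rw [← he2 (y' p.1) p.2, e.symm_apply_apply]
  rw [continuousOn_iff_continuous_domRestrict]
  exact h3.comp (f := fun p : (K ×ˢ (univ : Set S) : Set (W × S)) =>
    ((⟨p.1.1, p.2.1⟩ : K), p.1.2)) (by fun_prop)

/-- The fibre coordinate with respect to a continuous local section is continuous. -/
theorem continuousOn_diff [CompactSpace B] [T2Space B] (ξ : PrincipalBundle S B) {C : Set B}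
    (hC : IsClosed C) {σ : B → ξ.Total} (hσ : ContinuousOn σ C) (hσp : ∀ b ∈ C, ξ.proj (σ b) = b) :
    ContinuousOn (fun t => ξ.diff (σ (ξ.proj t)) t) (ξ.proj ⁻¹' C) := by
  intro t₀ ht₀
  obtain ⟨U, hU, hb, e, he1, he2⟩ := ξ.exists_triv (ξ.proj t₀)
  obtain ⟨C₀, hC₀, hC₀c, hC₀U⟩ := exists_mem_nhds_isClosed_subset (hU.mem_nhds hb)
  let K : Set B := C ∩ C₀
  have hK : IsClosed K := hC.inter hC₀c
  have : CompactSpace K := isCompact_iff_compactSpace.1 hK.isCompact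
  suffices ContinuousOn (fun t => ξ.diff (σ (ξ.proj t)) t) (ξ.proj ⁻¹' K) by
    refine (this t₀ ⟨ht₀, mem_of_mem_nhds hC₀⟩).mono_of_mem_nhdsWithin ?_
    exact Filter.inter_mem self_mem_nhdsWithin (mem_nhdsWithin_of_mem_nhds
      (ξ.proj.continuous.continuousAt.preimage_mem_nhds hC₀))
  let σ' : K → ξ.proj ⁻¹' U := fun b => ⟨σ b, by
    rw [mem_preimage, hσp _ b.2.1]; exact hC₀U b.2.2⟩
  have hσ' : Continuous σ' := (continuousOn_iff_continuous_domRestrict.1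
    (hσ.mono inter_subset_left)).subtype_mk _
  have h1 : Continuous fun p : K × S => (e (σ' p.1)).2⁻¹ * p.2 :=
    continuous_mul_of_compact_left (y := fun b => (e (σ' b)).2⁻¹)
      (KGroup.continuous_inv_of_compact (by fun_prop))
  rw [continuousOn_iff_continuous_domRestrict]
  let t' : (ξ.proj ⁻¹' K) → ξ.proj ⁻¹' U := fun t => ⟨t, hC₀U t.2.2⟩
  have h2 : Continuous fun t : ξ.proj ⁻¹' K =>
      (e (σ' ⟨ξ.proj t, t.2⟩)).2⁻¹ * (e (t' t)).2 :=
    h1.comp (f := fun t : ξ.proj ⁻¹' K => ((⟨ξ.proj t, t.2⟩ : K), (e (t' t)).2)) (by fun_prop)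
  refine h2.congr fun t => (ξ.diff_eq ?_).symm
  have h3 := he2 (σ' ⟨ξ.proj t, t.2⟩) ((e (σ' ⟨ξ.proj t, t.2⟩)).2⁻¹ * (e (t' t)).2)
  refine congrArg Subtype.val (e.injective (a₂ := t' t) (h3.trans ?_))
  refine Prod.ext (Subtype.ext ?_) (by simp)
  rw [he1, he1]
  exact hσp _ t.2.1

theorem continuousOn_diff_of_isOpen [CompactSpace B] [T2Space B] (ξ : PrincipalBundle S B)
    {V : Set B} (hV : IsOpen V) {σ : B → ξ.Total} (hσ : ContinuousOn σ V)
    (hσp : ∀ b ∈ V, ξ.proj (σ b) = b) :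
    ContinuousOn (fun t => ξ.diff (σ (ξ.proj t)) t) (ξ.proj ⁻¹' V) := by
  intro t ht
  obtain ⟨C, hC, hCc, hCV⟩ := exists_mem_nhds_isClosed_subset (hV.mem_nhds ht)
  exact ((ξ.continuousOn_diff hCc (hσ.mono hCV) fun b hb => hσp b (hCV hb)).continuousAt
    (ξ.proj.continuous.continuousAt.preimage_mem_nhds hC)).continuousWithinAt

/-! ### Bundles from cocycles -/

/-- An `S`-valued cocycle for an open cover of `B`. -/
structure Cocycle (S : Type u) [TopologicalSpace S] [Group S] (B : Type u)
    [TopologicalSpace B] where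
  ι : Type u
  cover : ι → Set B
  isOpen_cover : ∀ i, IsOpen (cover i)
  idx : B → ι
  mem_idx : ∀ b, b ∈ cover (idx b)
  val : ι → ι → B → S
  val_self : ∀ i, ∀ b ∈ cover i, val i i b = 1
  continuousOn_val : ∀ i j, ContinuousOn (val i j) (cover i ∩ cover j)
  val_mul : ∀ i j k, ∀ b ∈ cover i ∩ cover j ∩ cover k, val j k b * val i j b = val i k b

variable [CompactSpace B] [T2Space B]

/-- The fibre bundle defined by a cocycle. -/
def Cocycle.core (c : Cocycle S B) : FiberBundleCore c.ι B S where
  baseSet := c.cover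
  isOpen_baseSet := c.isOpen_cover
  indexAt := c.idx
  mem_baseSet_at := c.mem_idx
  coordChange i j b s := c.val i j b * s
  coordChange_self i b hb s := by rw [c.val_self i b hb, one_mul]
  continuousOn_coordChange i j := by
    have hV := (c.isOpen_cover i).inter (c.isOpen_cover j)
    rintro ⟨b, s⟩ ⟨hb, _⟩
    obtain ⟨C, hC, hCc, hCV⟩ := exists_mem_nhds_isClosed_subset (hV.mem_nhds hb)
    have : CompactSpace C := isCompact_iff_compactSpace.1 hCc.isCompact
    have h1 := continuous_mul_of_compact_left
      (continuousOn_iff_continuous_domRestrict.1 ((c.continuousOn_val i j).mono hCV))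
    have h2 : ContinuousOn (fun p : B × S => c.val i j p.1 * p.2) (C ×ˢ univ) := by
      rw [continuousOn_iff_continuous_domRestrict]
      exact h1.comp (f := fun p : (C ×ˢ (univ : Set S) : Set (B × S)) =>
        ((⟨p.1.1, p.2.1⟩ : C), p.1.2)) (by fun_prop)
    exact (h2.continuousAt (prod_mem_nhds hC Filter.univ_mem)).continuousWithinAt
  coordChange_comp i j k b hb s := by rw [← mul_assoc, c.val_mul i j k b hb]

/-- The point of the total space with a given coordinate in the preferred chart. -/
def Cocycle.pt (c : Cocycle S B) (b : B) (s : S) : c.core.TotalSpace := ⟨b, s⟩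

/-- The coordinate of a point in the preferred chart. -/
def Cocycle.coord (c : Cocycle S B) (t : c.core.TotalSpace) : S := t.2

/-- The principal bundle defined by a cocycle. -/
def ofCocycle (c : Cocycle S B) : PrincipalBundle S B where
  Total := c.core.TotalSpace
  proj := ⟨c.core.proj, c.core.continuous_proj⟩
  act t s := c.pt t.1 (c.coord t * s)
  act_one t := congrArg (c.pt t.1) (mul_one (c.coord t))
  act_mul t s s' := congrArg (c.pt t.1) (mul_assoc (c.coord t) s s').symm
  proj_act t s := rfl
  exists_triv b := by
    let e := c.core.localTriv (c.idx b)
    have hb : c.cover (c.idx b) ⊆ e.baseSet := le_rfl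
    refine ⟨c.cover (c.idx b), c.isOpen_cover _, c.mem_idx b, e.preimageHomeomorph hb, ?_, ?_⟩
    · intro t; rfl
    · intro t s
      refine Prod.ext rfl ?_
      exact (mul_assoc (c.val _ _ _) (c.coord t.1) s).symm

/-- The preferred chart `c.idx (p t)` jumps with `t`. Near `t₀` every point is rewritten in the
chart chosen at `t₀`, where the coordinate is continuous; compatibility with the cocycle shows that
the point is the same. -/
theorem Cocycle.continuous_pt (c : Cocycle S B) {T : Type*} [TopologicalSpace T] {p : T → B}
    (hp : Continuous p) {X : c.ι → T → S} (hX : ∀ i, ContinuousOn (X i) (p ⁻¹' c.cover i))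
    (hXc : ∀ i j t, p t ∈ c.cover i → p t ∈ c.cover j → c.val i j (p t) * X i t = X j t) :
    Continuous fun t => c.pt (p t) (X (c.idx (p t)) t) := by
  refine continuous_iff_continuousAt.2 fun t₀ => ?_
  let i := c.idx (p t₀)
  refine ContinuousOn.continuousAt (s := p ⁻¹' c.cover i) ?_
    (((c.isOpen_cover i).preimage hp).mem_nhds (c.mem_idx _))
  have h1 := (c.core.localTriv i).continuousOn_invFun
  have h2 := h1.comp (f := fun t => (p t, X i t)) (hp.continuousOn.prodMk (hX i)) (by
    intro t ht
    rw [(c.core.localTriv i).target_eq]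
    exact ⟨ht, trivial⟩)
  refine h2.congr fun t ht => ?_
  refine Eq.trans ?_ (c.core.localTriv_symm_apply i (p t, X i t)).symm
  exact congrArg (c.pt (p t)) (hXc i _ t ht (c.mem_idx _)).symm

/-- A bundle map into the bundle of a cocycle, from its coordinates. -/
def Cocycle.hom (c : Cocycle S B) {ζ : PrincipalBundle S B'} {f : C(B', B)} (X : c.ι → ζ.Total → S)
    (hX : ∀ i, ContinuousOn (X i) {t | f (ζ.proj t) ∈ c.cover i})
    (hXc : ∀ i j t, f (ζ.proj t) ∈ c.cover i → f (ζ.proj t) ∈ c.cover j →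
      c.val i j (f (ζ.proj t)) * X i t = X j t)
    (hXa : ∀ i t s, f (ζ.proj t) ∈ c.cover i → X i (ζ.act t s) = X i t * s) :
    Hom ζ (ofCocycle c) f where
  toMap := ⟨fun t => c.pt (f (ζ.proj t)) (X (c.idx (f (ζ.proj t))) t),
    c.continuous_pt (f.continuous.comp ζ.proj.continuous) hX hXc⟩
  proj_map t := rfl
  map_act t s := by
    refine (congrArg₂ (fun b => c.pt (f b)) (ζ.proj_act t s) rfl).trans
      (congrArg (c.pt (f (ζ.proj t))) ?_)
    rw [ζ.proj_act, hXa _ t s (c.mem_idx _)]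
    rfl

/-- A principal bundle over a closed subset is glued to a trivial bundle along a section; bundle
maps are glued at the same time. -/
theorem exists_glue [CompactSpace B'] [T2Space B'] (f : C(B', B)) {R : Set B} (hR : IsClosed R)
    {O₁ O₂ : Set B} (hO₁ : IsOpen O₁) (hO₂ : IsOpen O₂) (hO₁R : O₁ ⊆ R) (hO : O₁ ∪ O₂ = univ)
    (ζ : PrincipalBundle S B') (ξ : PrincipalBundle S R)
    (Φ : {t : ζ.Total // f (ζ.proj t) ∈ R} → ξ.Total) (hΦ : Continuous Φ)
    (hΦp : ∀ t, ξ.proj (Φ t) = ⟨f (ζ.proj t), t.2⟩)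
    (hΦa : ∀ t s h, Φ ⟨ζ.act t.1 s, h⟩ = ξ.act (Φ t) s)
    {s : R → ξ.Total} (hs : ContinuousOn s (Subtype.val ⁻¹' (O₁ ∩ O₂)))
    (hsp : ∀ r : R, (r : B) ∈ O₁ ∩ O₂ → ξ.proj (s r) = r)
    {s₂ : B' → ζ.Total} (hs₂ : ContinuousOn s₂ (f ⁻¹' O₂))
    (hs₂p : ∀ b, f b ∈ O₂ → ζ.proj (s₂ b) = b)
    (hcompat : ∀ b (h : f (ζ.proj (s₂ b)) ∈ R), f b ∈ O₁ ∩ O₂ →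
      Φ ⟨s₂ b, h⟩ = s ⟨f (ζ.proj (s₂ b)), h⟩) :
    ∃ ξ' : PrincipalBundle S B, Nonempty (ζ.Hom ξ' f) := by
  classical
  have : CompactSpace R := isCompact_iff_compactSpace.1 hR.isCompact
  choose C hC τ c hτ using fun r : R => ξ.exists_isLocTriv r
  choose O hO' hOC using fun r : R => isOpen_induced_iff.1 (isOpen_interior (s := C r))
  -- The index `none` stands for the trivial piece over `O₂`, with the section `s` on the overlap;
  -- `some r` stands for a local section of `ξ` near `r`, cut down to `O₁`.
  let W : Option R → Set B := fun i => i.elim O₂ fun r => O r ∩ O₁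
  let σ : Option R → R → ξ.Total := fun i => i.elim s τ
  have hWo : ∀ i, IsOpen (W i) := by
    rintro (_ | r)
    exacts [hO₂, (hO' r).inter hO₁]
  have hCr : ∀ (r r' : R), (r' : B) ∈ O r → r' ∈ interior (C r) := fun r r' h => by
    rw [← hOC r]; exact h
  have hσp : ∀ i (r : R), (r : B) ∈ W i ∩ O₁ → ξ.proj (σ i r) = r := by
    rintro (_ | r') r h
    · exact hsp r ⟨h.2, h.1⟩
    · exact (hτ r').proj_sec r (interior_subset (hCr _ _ h.1.1))
  have hσc : ∀ i, ContinuousOn (σ i) (Subtype.val ⁻¹' (W i ∩ O₁)) := by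
    rintro (_ | r')
    · exact hs.mono fun r h => ⟨h.2, h.1⟩
    · exact (hτ r').continuousOn_sec.mono fun r h => interior_subset (hCr _ _ h.1.1)
  have hdiffc : ∀ i, ContinuousOn (fun t => ξ.diff (σ i (ξ.proj t)) t)
      (ξ.proj ⁻¹' (Subtype.val ⁻¹' (W i ∩ O₁))) := fun i =>
    ξ.continuousOn_diff_of_isOpen (((hWo i).inter hO₁).preimage continuous_subtype_val)
      (hσc i) (hσp i)
  have hidx : ∀ b, ∃ i, b ∈ W i := by
    intro b
    rcases (hO ▸ mem_univ b : b ∈ O₁ ∪ O₂) with h | h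
    · refine ⟨some ⟨b, hO₁R h⟩, ?_, h⟩
      have : (⟨b, hO₁R h⟩ : R) ∈ Subtype.val ⁻¹' O ⟨b, hO₁R h⟩ := by
        rw [hOC]; exact mem_interior_iff_mem_nhds.2 (hC _)
      exact this
    · exact ⟨none, h⟩
  choose idx hidx using hidx
  -- Transition functions compare local sections of `ξ`. Distinct charts overlap only inside `O₁`;
  -- outside of it a chart is compared only with itself, so the default value 1 is the correct one.
  let g : Option R → Option R → B → S := fun i j b =>
    if h : b ∈ O₁ then ξ.diff (σ j ⟨b, hO₁R h⟩) (σ i ⟨b, hO₁R h⟩) else 1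
  have hW₁ : ∀ i j, i ≠ j → W i ∩ W j ⊆ O₁ := by
    rintro (_ | r) (_ | r') h b hb
    · exact absurd rfl h
    · exact hb.2.2
    · exact hb.1.2
    · exact hb.1.2
  have hgs : ∀ i b, g i i b = 1 := by
    intro i b
    simp only [g]
    split_ifs
    exacts [ξ.diff_self _, rfl]
  let cc : Cocycle S B :=
    { ι := Option R
      cover := W
      isOpen_cover := hWo
      idx := idx
      mem_idx := hidx
      val := g
      val_self := fun i b _ => hgs i b
      continuousOn_val := by
        intro i j
        by_cases hij : i = j
        · subst hij
          exact continuousOn_const.congr fun b _ => hgs i b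
        · have h1 : ContinuousOn (fun r : R => ξ.diff (σ j (ξ.proj (σ i r))) (σ i r))
              (Subtype.val ⁻¹' (W i ∩ W j)) :=
            (hdiffc j).comp ((hσc i).mono fun r hr => ⟨hr.1, hW₁ i j hij hr⟩) fun r hr => by
              rw [mem_preimage, hσp i r ⟨hr.1, hW₁ i j hij hr⟩]
              exact ⟨hr.2, hW₁ i j hij hr⟩
          have h2 : ContinuousOn (fun r : R => g i j r) (Subtype.val ⁻¹' (W i ∩ W j)) := by
            refine h1.congr fun r hr => ?_
            simp only [g, dif_pos (hW₁ i j hij hr)]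
            rw [hσp i r ⟨hr.1, hW₁ i j hij hr⟩]
          intro b hb
          have hb₁ := hW₁ i j hij hb
          have h3 := (h2.continuousAt ((((hWo i).inter (hWo j)).preimage
            continuous_subtype_val).mem_nhds (x := (⟨b, hO₁R hb₁⟩ : R)) hb))
          refine ContinuousAt.continuousWithinAt ?_
          have h4 : ContinuousWithinAt (g i j) R b := by
            rw [continuousWithinAt_iff_continuousAt_domRestrict _ (hO₁R hb₁)]
            exact h3
          exact h4.continuousAt (Filter.mem_of_superset (hO₁.mem_nhds hb₁) hO₁R)
      val_mul := by
        intro i j k b hb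
        by_cases h : b ∈ O₁
        · simp only [g, dif_pos h]
          refine ξ.diff_mul_diff ?_ ?_
          · rw [hσp k _ ⟨hb.2, h⟩, hσp j _ ⟨hb.1.2, h⟩]
          · rw [hσp i _ ⟨hb.1.1, h⟩, hσp j _ ⟨hb.1.2, h⟩]
        · simp only [g, dif_neg h, one_mul] }
  -- Over `O₂` the coordinate of `t` is taken in `ζ` itself, relative to `s₂`. Where `O₁` and `O₂`
  -- overlap, `hcompat` and equivariance make it equal to the coordinate of `Φ t` relative to `s`.
  let X : Option R → ζ.Total → S := fun i => i.elim (fun t => ζ.diff (s₂ (ζ.proj t)) t) fun r t =>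
    if h : f (ζ.proj t) ∈ R then ξ.diff (τ r ⟨f (ζ.proj t), h⟩) (Φ ⟨t, h⟩) else 1
  have hX₁ : ∀ i (t : ζ.Total) (h : f (ζ.proj t) ∈ O₁), f (ζ.proj t) ∈ W i →
      X i t = ξ.diff (σ i ⟨f (ζ.proj t), hO₁R h⟩) (Φ ⟨t, hO₁R h⟩) := by
    rintro (_ | r) t h hi
    · have hp : ζ.proj (s₂ (ζ.proj t)) = ζ.proj t := hs₂p _ hi
      have hm : f (ζ.proj (s₂ (ζ.proj t))) ∈ R := by rw [hp]; exact hO₁R h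
      have h1 := hΦa ⟨s₂ (ζ.proj t), hm⟩ (ζ.diff (s₂ (ζ.proj t)) t) (by
        rw [ζ.proj_act]; exact hm)
      rw [hcompat (ζ.proj t) hm ⟨h, hi⟩] at h1
      simp only [ζ.act_diff hp, hp] at h1
      exact (ξ.diff_eq h1.symm).symm
    · exact dif_pos (hO₁R h)
  refine ⟨ofCocycle cc, ⟨cc.hom X ?_ ?_ ?_⟩⟩
  · rintro (_ | r)
    · exact ζ.continuousOn_diff_of_isOpen (hO₂.preimage f.continuous) hs₂ hs₂p
    · intro t ht
      have hO₁t : IsOpen {t | f (ζ.proj t) ∈ W (some r)} :=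
        (hWo _).preimage (f.continuous.comp ζ.proj.continuous)
      have ht₁ : f (ζ.proj t) ∈ O₁ := ht.2
      have h1 : ContinuousOn (fun t => ξ.diff (σ (some r) (ξ.proj (Φ t))) (Φ t))
          {t | f (ζ.proj t.1) ∈ W (some r)} :=
        (hdiffc (some r)).comp hΦ.continuousOn fun t ht => by
          rw [mem_preimage, hΦp]; exact ⟨ht, ht.2⟩
      have h2 : ContinuousOn (fun t : {t : ζ.Total // f (ζ.proj t) ∈ R} => X (some r) t)
          {t | f (ζ.proj t.1) ∈ W (some r)} := by
        refine h1.congr fun t ht => ?_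
        dsimp only
        rw [hX₁ (some r) t ht.2 ht, hΦp]
      have h3 := h2.continuousAt ((hO₁t.preimage continuous_subtype_val).mem_nhds
        (x := (⟨t, hO₁R ht₁⟩ : {t : ζ.Total // f (ζ.proj t) ∈ R})) ht)
      refine ContinuousAt.continuousWithinAt ?_
      have h4 : ContinuousWithinAt (X (some r)) {t | f (ζ.proj t) ∈ R} t := by
        rw [continuousWithinAt_iff_continuousAt_domRestrict (X (some r))
          (show t ∈ {t | f (ζ.proj t) ∈ R} from hO₁R ht₁)]
        exact h3
      exact h4.continuousAt (Filter.mem_of_superset (hO₁t.mem_nhds ht) fun t ht => hO₁R ht.2)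
  · intro i j t hi hj
    by_cases h : f (ζ.proj t) ∈ O₁
    · rw [hX₁ i t h hi, hX₁ j t h hj]
      show g i j _ * _ = _
      simp only [g, dif_pos h]
      refine ξ.diff_mul_diff ?_ ?_
      · rw [hσp i _ ⟨hi, h⟩, hσp j _ ⟨hj, h⟩]
      · rw [hσp i _ ⟨hi, h⟩, hΦp]
    · have hij : i = j := by
        by_contra hij
        exact h (hW₁ i j hij ⟨hi, hj⟩)
      subst hij
      rw [show cc.val i i _ = 1 from hgs i _, one_mul]
  · rintro (_ | r) t x hi
    · show ζ.diff (s₂ (ζ.proj (ζ.act t x))) (ζ.act t x) = ζ.diff (s₂ (ζ.proj t)) t * x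
      rw [ζ.proj_act]
      exact ζ.diff_act (hs₂p _ hi) x
    · have hi' : f (ζ.proj (ζ.act t x)) ∈ W (some r) := by rw [ζ.proj_act]; exact hi
      rw [hX₁ _ t hi.2 hi, hX₁ _ _ hi'.2 hi', hΦa ⟨t, hO₁R hi.2⟩]
      simp only [ζ.proj_act]
      exact ξ.diff_act (by rw [hσp _ _ ⟨hi, hi.2⟩, hΦp]) x

end PrincipalBundle

/-! ### Lifts over closed subsets of the limit. -/

theorem LiftHtpy.of_domRestrict {E B Z : Type*} [TopologicalSpace E] [TopologicalSpace Z]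
    {π : E → B} {g : Z → B} {A : Set Z} {f₀ f₁ : Z → E}
    (h : LiftHtpy π (fun z : A => g z) univ (fun z : A => f₀ z) (fun z : A => f₁ z)) :
    LiftHtpy π g A f₀ f₁ := by
  classical
  obtain ⟨H, hHc, hHg, hH0, hH1⟩ := h
  let H' : Z × ℝ → E := fun p => if h : p.1 ∈ A then H (⟨p.1, h⟩, p.2) else f₀ p.1
  have e : ∀ (z : Z) (hz : z ∈ A) (t : ℝ), H' (z, t) = H (⟨z, hz⟩, t) := fun z hz t => dif_pos hz
  refine ⟨H', ?_, ?_, ?_, ?_⟩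
  · rw [continuousOn_iff_continuous_domRestrict]
    have h1 : Continuous fun p : (A ×ˢ (univ : Set ℝ) : Set (Z × ℝ)) =>
        H (⟨p.1.1, p.2.1⟩, p.1.2) :=
      hHc.comp_continuous (by fun_prop) fun p => ⟨trivial, trivial⟩
    exact h1.congr fun p => (e _ p.2.1 _).symm
  · intro z hz t
    rw [e z hz]; exact hHg _ trivial _
  · intro z hz t ht
    rw [e z hz]; exact hH0 _ trivial _ ht
  · intro z hz t ht
    rw [e z hz]; exact hH1 _ trivial _ ht

namespace CompactSystem

variable {X : Type u} [TopologicalSpace X] {J : Type v} [Preorder J] (P : CompactSystem X J)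
  [IsDirectedOrder J]

/-- The inverse system of the preimages of a closed subset of a stage. -/
def restrict (m : J) {D : Set (P.space m)} (hD : IsClosed D) :
    CompactSystem (P.proj m ⁻¹' D) {j : J // m ≤ j} where
  space j := P.map m j j.2 ⁻¹' D
  compact j := isCompact_iff_compactSpace.1 (hD.preimage (P.map m j j.2).continuous).isCompact
  map j i h := ⟨fun y => ⟨P.map j i h y, by
    rw [mem_preimage, P.map_map]; exact y.2⟩, by fun_prop⟩
  map_map k j i hkj hji y := Subtype.ext (P.map_map k j i hkj hji y)
  proj j := ⟨fun x => ⟨P.proj j x, by rw [mem_preimage, P.map_proj]; exact x.2⟩, by fun_prop⟩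
  map_proj j i h x := Subtype.ext (P.map_proj j i h x)
  proj_inj x y h := Subtype.ext <| P.proj_inj _ _ fun j => by
    obtain ⟨k, hm, hj⟩ := exists_ge_ge m j
    rw [← P.map_proj j k hj, ← P.map_proj j k hj]
    exact congrArg (P.map j k hj) (congrArg Subtype.val (h ⟨k, hm⟩))
  exists_proj y hy := by
    -- The thread is given only at stages above `m`. Its coordinate at `j` is read off from a stage
    -- above both `j` and `m`, and `hz` shows that the choice does not matter.
    choose k hm hj using fun j => exists_ge_ge m j
    have hy' : ∀ (j i : J) (hmj : m ≤ j) (hmi : m ≤ i) (h : j ≤ i),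
        P.map j i h (y ⟨i, hmi⟩) = (y ⟨j, hmj⟩ : P.space j) := fun j i hmj hmi h =>
      congrArg Subtype.val (hy ⟨j, hmj⟩ ⟨i, hmi⟩ h)
    have hz : ∀ j l (hml : m ≤ l) (hjl : j ≤ l),
        P.map j (k j) (hj j) (y ⟨k j, hm j⟩) = P.map j l hjl (y ⟨l, hml⟩) := by
      intro j l hml hjl
      obtain ⟨n, hkn, hln⟩ := exists_ge_ge (k j) l
      rw [← hy' (k j) n (hm j) (hml.trans hln) hkn, ← hy' l n hml (hml.trans hln) hln,
        P.map_map, P.map_map]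
    obtain ⟨x, hx⟩ := P.exists_proj (fun j => P.map j (k j) (hj j) (y ⟨k j, hm j⟩)) (by
      intro j i h
      rw [P.map_map]
      exact (hz j (k i) (hm i) (h.trans (hj i))).symm)
    refine ⟨⟨x, ?_⟩, fun j => Subtype.ext ?_⟩
    · rw [mem_preimage, hx]
      exact (y ⟨k m, hm m⟩).2
    · exact (hx j).trans (hy' j (k j) j.2 (hm j) (hj j))

/-- Disjoint closed subsets of the limit are separated by a function on some stage. -/
theorem exists_separation [Nonempty J] [CompactSpace X] [T2Space X] {A C : Set X} (hA : IsClosed A)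
    (hC : IsClosed C) (hAC : Disjoint A C) :
    ∃ m, ∃ f : C(P.space m, ℝ), (∀ x ∈ C, f (P.proj m x) = 0) ∧ ∀ x ∈ A, f (P.proj m x) = 1 := by
  obtain ⟨m, hm⟩ : ∃ m, Disjoint (P.proj m '' C) (P.proj m '' A) := by
    by_contra! h
    -- If no stage separated the two sets, the pairs in `C × A` that agree at a given stage would
    -- form a directed family of nonempty compact sets. A common point would be a pair that agrees
    -- at all stages, hence a point of both `C` and `A`.
    have hne := IsCompact.nonempty_iInter_of_directed_nonempty_isCompact_isClosed
      (fun m => {p : X × X | p.1 ∈ C ∧ p.2 ∈ A ∧ P.proj m p.1 = P.proj m p.2})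
      (directed_of_isDirected_le fun i j hij p hp => ⟨hp.1, hp.2.1, by
        rw [← P.map_proj i j hij, ← P.map_proj i j hij, hp.2.2]⟩)
      (fun m => by
        obtain ⟨_, ⟨c, hc, rfl⟩, a, ha, hac⟩ := not_disjoint_iff.1 (h m)
        exact ⟨(c, a), hc, ha, hac.symm⟩)
      (fun m => (((hC.preimage continuous_fst).inter ((hA.preimage continuous_snd).inter
        (isClosed_eq (by fun_prop) (by fun_prop))))).isCompact)
      (fun m => ((hC.preimage continuous_fst).inter ((hA.preimage continuous_snd).inter
        (isClosed_eq (by fun_prop) (by fun_prop)))))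
    obtain ⟨⟨c, a⟩, hp⟩ := hne
    have hp' := fun m => mem_iInter.1 hp m
    obtain ⟨m⟩ := ‹Nonempty J›
    have : c = a := P.proj_inj _ _ fun j => (hp' j).2.2
    exact disjoint_left.1 hAC (hp' m).2.1 (this ▸ (hp' m).1)
  obtain ⟨f, hf0, hf1, -⟩ := exists_continuous_zero_one_of_isClosed
    (hC.isCompact.image (P.proj m).continuous).isClosed
    (hA.isCompact.image (P.proj m).continuous).isClosed hm
  exact ⟨m, f, fun x hx => hf0 (mem_image_of_mem _ hx), fun x hx => hf1 (mem_image_of_mem _ hx)⟩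

/-- Up to homotopy, lifts over the preimage in the limit of a closed subset of a stage come from
lifts over the preimage in a later stage. -/
theorem exists_stage_lift_on [Nonempty J] [CompactSpace X] [T2Space X] {E B : Type*}
    [TopologicalSpace E] [TopologicalSpace B] {π : E → B} (h : SecExt.{max u v} π univ)
    (hπ : Function.Surjective π) (m : J) {D : Set (P.space m)} (hD : IsClosed D)
    (b : C(P.space m, B)) {σ : X → E} (hσ : ContinuousOn σ (P.proj m ⁻¹' D))
    (hσb : ∀ x ∈ P.proj m ⁻¹' D, π (σ x) = b (P.proj m x)) :
    ∃ k, ∃ hmk : m ≤ k, ∃ τ : P.space k → E, ContinuousOn τ (P.map m k hmk ⁻¹' D) ∧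
      (∀ y, π (τ y) = b (P.map m k hmk y)) ∧
      LiftHtpy π (fun x => b (P.proj m x)) (P.proj m ⁻¹' D) (fun x => τ (P.proj k x)) σ := by
  classical
  let R := P.restrict m hD
  have : CompactSpace (P.proj m ⁻¹' D) :=
    isCompact_iff_compactSpace.1 (hD.preimage (P.proj m).continuous).isCompact
  let b' : C(R.space ⟨m, le_rfl⟩, B) :=
    ⟨fun y => b (P.map m m le_rfl y.1), by fun_prop⟩
  obtain ⟨k, hmk, τ, hτ, H⟩ := R.exists_stage_lift (Q := Unit) h ⟨m, le_rfl⟩ b'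
    ⟨fun p => σ p.2, (continuousOn_iff_continuous_domRestrict.1 hσ).comp continuous_snd⟩
    (fun p => (hσb _ p.2.2).trans (congrArg b (P.map_proj m m le_rfl p.2).symm))
  -- Off the preimage of `D` the value is an arbitrary point of the correct fibre. Continuity is not
  -- claimed there, but a later pullback bundle needs a point over every element of the stage.
  let τ' : P.space k → E := fun y => if hy : P.map m k k.2 y ∈ D then τ ((), ⟨y, hy⟩) else
    (hπ (b (P.map m k k.2 y))).choose
  have e : ∀ y (hy : P.map m k k.2 y ∈ D), τ' y = τ ((), ⟨y, hy⟩) := fun y hy => dif_pos hy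
  refine ⟨k, hmk, τ', ?_, ?_, LiftHtpy.of_domRestrict ?_⟩
  · rw [continuousOn_iff_continuous_domRestrict]
    have h1 : Continuous fun y : R.space k => τ ((), y) := by fun_prop
    exact h1.congr fun y => (e y.1 y.2).symm
  · intro y
    by_cases hy : P.map m k k.2 y ∈ D
    · rw [e y hy, hτ]
      exact congrArg b (P.map_map m m k le_rfl hmk y)
    · simp only [τ', dif_neg hy]
      exact (hπ (b (P.map m k k.2 y))).choose_spec
  · have hb : (fun x : P.proj m ⁻¹' D => b (P.proj m x)) =
        (fun p : Unit × (P.proj m ⁻¹' D : Set X) => b' (R.proj ⟨m, le_rfl⟩ p.2)) ∘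
          fun x => ((), x) :=
      funext fun x => congrArg b (P.map_proj m m le_rfl x).symm
    rw [hb]
    exact (H.comp (k := fun x => ((), x)) (A' := univ) (by fun_prop) (mapsTo_univ _ _)).congr
      (fun x _ => e _ (R.proj k x).2) fun x _ => rfl

end CompactSystem

/-! ### Sections of pullbacks, and deformation of bundle maps. -/

namespace PrincipalBundle

variable {S : Type u} [TopologicalSpace S] [Group S] {B B' : Type u} [TopologicalSpace B]
  [TopologicalSpace B']

theorem continuousOn_pullback_mk {ζ : PrincipalBundle S B} {f : C(B', B)} {W : Type*}
    [TopologicalSpace W] {U : Set W} {σ : W → (ζ.pullback f).Total}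
    (hσ : ContinuousOn (fun w => (σ w).1) U) : ContinuousOn σ U :=
  Topology.IsInducing.subtypeVal.continuousOn_iff.2 hσ

theorem exists_pullback_section (ζ : PrincipalBundle S B) (f : C(B', B)) {U : Set B}
    {σ : B → ζ.Total} (hσ : ContinuousOn σ U) (hσp : ∀ b ∈ U, ζ.proj (σ b) = b) :
    ∃ σ' : B' → (ζ.pullback f).Total, ContinuousOn σ' (f ⁻¹' U) ∧
      (∀ b, (ζ.pullback f).proj (σ' b) = b) ∧ ∀ b ∈ f ⁻¹' U, (σ' b).1.2 = σ (f b) := by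
  classical
  choose t ht using ζ.proj_surjective
  let σ₁ : B → ζ.Total := fun b => if b ∈ U then σ b else t b
  have h₁ : ∀ b, b = ζ.proj (σ₁ b) := fun b => by
    by_cases hb : b ∈ U
    · simp only [σ₁, if_pos hb, hσp b hb]
    · simp only [σ₁, if_neg hb, ht]
  refine ⟨fun b => ⟨(b, σ₁ (f b)), h₁ _⟩, ?_, fun b => rfl, fun b hb => if_pos hb⟩
  refine continuousOn_pullback_mk (continuousOn_id.prodMk ?_)
  exact (hσ.comp f.continuous.continuousOn fun b hb => hb).congr fun b hb => if_pos hb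

variable [CompactlyCoherentSpace S] [KGroup S]

theorem continuousOn_act [RegularSpace B] (ξ : PrincipalBundle S B) {W T : Type*}
    [TopologicalSpace W] [CompactSpace W] [T2Space W] [TopologicalSpace T] {C : Set W}
    (hC : IsClosed C) {y : W → ξ.Total} (hy : ContinuousOn y C) {A : Set T} {p : T → W}
    (hp : ContinuousOn p A) (hpC : MapsTo p A C) {c : T → S} (hc : ContinuousOn c A) :
    ContinuousOn (fun t => ξ.act (y (p t)) (c t)) A := by
  have : CompactSpace C := isCompact_iff_compactSpace.1 hC.isCompact
  rw [continuousOn_iff_continuous_domRestrict] at hy hp hc ⊢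
  have h1 := ξ.continuous_act_prod hy
  exact h1.comp (f := fun t : A => ((⟨p t, hpC t.2⟩ : C), c t))
    ((hp.subtype_mk fun t => hpC t.2).prodMk hc)

/-- A bundle map is deformed near the end of a collar, along a homotopy of its values on a local
section. -/
theorem Hom.exists_eq_on_section [CompactSpace B] [T2Space B] [CompactSpace B'] [T2Space B']
    {ζ : PrincipalBundle S B'} {ξ : PrincipalBundle S B} {f : C(B', B)} (Φ : ζ.Hom ξ f)
    (v : C(B', ℝ)) {s₂ : B' → ζ.Total} {V : Set B'} (hV : IsOpen V)
    (hVv : ∀ b, 0 ≤ v b → b ∈ V) (hs₂ : ContinuousOn s₂ V)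
    (hs₂p : ∀ b ∈ V, ζ.proj (s₂ b) = b) {g : B' → ξ.Total}
    (H : LiftHtpy ξ.proj f {b | 0 ≤ v b} g fun b => Φ.toMap (s₂ b)) :
    ∃ Φ' : ζ.Hom ξ f, ∀ b, 2 / 3 ≤ v b → Φ'.toMap (s₂ b) = g b := by
  obtain ⟨H, hHc, hHg, hH0, hH1⟩ := H
  let c₂ : ζ.Total → S := fun t => ζ.diff (s₂ (ζ.proj t)) t
  have hc₂ : ContinuousOn c₂ (ζ.proj ⁻¹' V) := ζ.continuousOn_diff_of_isOpen hV hs₂ hs₂p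
  have hsc : ∀ t, ζ.proj t ∈ V → ζ.act (s₂ (ζ.proj t)) (c₂ t) = t := fun t ht =>
    ζ.act_diff (hs₂p _ ht)
  -- The time `2 - 3 * v` is 1 at `v = 1/3`, where `H` is `Φ ∘ s₂`, and at most 0 from `v = 2/3` on,
  -- where `H` is `g`. The factor `c₂ t` extends the values on the section equivariantly to the
  -- fibres.
  let F : ζ.Total → ξ.Total := fun t => if v (ζ.proj t) ≤ 1 / 3 then Φ.toMap t else
    ξ.act (H (ζ.proj t, 2 - 3 * v (ζ.proj t))) (c₂ t)
  have hF : Continuous F := by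
    rw [← continuousOn_univ]
    refine continuousOn_ite_le (v := fun t => v (ζ.proj t)) (by fun_prop)
      Φ.toMap.continuous.continuousOn ?_ ?_
    · have hcl : IsClosed {b | 1 / 3 ≤ v b} := isClosed_le continuous_const v.continuous
      refine ContinuousOn.mono (s := ζ.proj ⁻¹' {b | 1 / 3 ≤ v b}) ?_ inter_subset_right
      refine ξ.continuousOn_act (y := fun b => H (b, 2 - 3 * v b)) (p := ζ.proj) hcl ?_
        ζ.proj.continuous.continuousOn (fun t ht => ht) (hc₂.mono fun t ht => hVv _ ?_)
      · exact hHc.comp (by fun_prop) fun b hb => ⟨by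
          have : 1 / 3 ≤ v b := hb
          show 0 ≤ v b
          linarith, trivial⟩
      · have : 1 / 3 ≤ v (ζ.proj t) := ht
        linarith
    · intro t _ ht
      have h0 : 0 ≤ v (ζ.proj t) := by rw [ht]; norm_num
      rw [hH1 _ h0 _ (by rw [ht]; norm_num), ← Φ.map_act, hsc t (hVv _ h0)]
  refine ⟨⟨⟨F, hF⟩, ?_, ?_⟩, ?_⟩
  · intro t
    show ξ.proj (F t) = _
    simp only [F]
    split_ifs with h
    · exact Φ.proj_map t
    · rw [ξ.proj_act]
      exact hHg _ (show 0 ≤ v (ζ.proj t) by linarith) _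
  · intro t s
    show F (ζ.act t s) = ξ.act (F t) s
    simp only [F, ζ.proj_act]
    split_ifs with h
    · exact Φ.map_act t s
    · rw [← ξ.act_mul]
      refine congrArg _ ?_
      show ζ.diff _ _ = _
      rw [ζ.proj_act]
      exact ζ.diff_act (hs₂p _ (hVv _ (by linarith))) s
  · intro b hb
    have h0 : 0 ≤ v b := by linarith
    show F (s₂ b) = g b
    have hp := hs₂p b (hVv b h0)
    have hc : c₂ (s₂ b) = 1 := by
      show ζ.diff _ _ = 1
      rw [hp, ζ.diff_self]
    simp only [F, hp, hc, ξ.act_one]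
    rw [if_neg (by linarith), hH0 b h0 _ (by linarith)]

/-- The bundle over an empty base. -/
def ofIsEmpty (S : Type u) [TopologicalSpace S] [Group S] (B : Type u) [TopologicalSpace B]
    [IsEmpty B] : PrincipalBundle S B where
  Total := B
  proj := ContinuousMap.id B
  act t _ := t
  act_one _ := rfl
  act_mul _ _ _ := rfl
  proj_act _ _ := rfl
  exists_triv b := isEmptyElim b

end PrincipalBundle

/-! ### Descent of a principal bundle to a stage. -/

namespace CompactSystem

variable {S : Type u} [TopologicalSpace S] [Group S] [CompactlyCoherentSpace S] [KGroup S]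

open PrincipalBundle

/-- Induction on the number of trivializing open sets. A function `u` on a stage cuts the limit into
`u ≤ 1`, where the first `r` sets suffice and induction gives a bundle `ξ` at a stage, and `0 ≤ u`,
where `ζ` has a section. On the overlap this section is a lift into `ξ`; up to homotopy it comes
from a later stage, and the homotopy is absorbed by deforming the bundle map. There `ξ` is glued to
a trivial bundle along the lift. The limit and the index set are quantified inside because the
induction hypothesis is applied to a restricted system. -/
theorem exists_stage_bundle_of_cover (hS : HExtInto.{max u v} (univ : Set S)) (r : ℕ) :
    ∀ {X : Type u} [TopologicalSpace X] [CompactSpace X] [T2Space X] {J : Type v} [Preorder J]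
      [IsDirectedOrder J] [Nonempty J] (P : CompactSystem X J) (ζ : PrincipalBundle S X)
      (U : Fin r → Set X) (σ : Fin r → X → ζ.Total), (∀ i, IsOpen (U i)) →
      (∀ i, ContinuousOn (σ i) (U i)) → (∀ i, ∀ b ∈ U i, ζ.proj (σ i b) = b) →
      ⋃ i, U i = univ → ∃ m, ∃ ζm : PrincipalBundle S (P.space m),
        Nonempty (ζ.Hom ζm (P.proj m)) := by
  induction r with
  | zero =>
    intro X _ _ _ J _ _ _ P ζ U σ _ _ _ hU
    have : IsEmpty X := ⟨fun x => by
      obtain ⟨i, -⟩ := mem_iUnion.1 (hU ▸ mem_univ x)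
      exact i.elim0⟩
    have : IsEmpty ζ.Total := ⟨fun t => isEmptyElim (ζ.proj t)⟩
    obtain ⟨k, -, hk⟩ := P.exists_isEmpty (Classical.arbitrary J)
    exact ⟨k, ofIsEmpty S _, ⟨⟨⟨fun t => isEmptyElim t, continuous_iff_continuousAt.2 fun t =>
      isEmptyElim t⟩, fun t => isEmptyElim t, fun t => isEmptyElim t⟩⟩⟩
  | succ r ih =>
    intro X _ _ _ J _ _ _ P ζ U σ hUo hσ hσp hU
    let V₂ := U (Fin.last r)
    let s₂ := σ (Fin.last r)
    obtain ⟨m, f, hf0, hf1⟩ := P.exists_separation (A := (⋃ i : Fin r, U i.castSucc)ᶜ) (C := V₂ᶜ)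
      (isOpen_iUnion fun i => hUo _).isClosed_compl (hUo _).isClosed_compl (by
        rw [disjoint_left]
        intro x hx hx2
        obtain ⟨i, hi⟩ := mem_iUnion.1 (hU ▸ mem_univ x)
        refine i.lastCases (motive := fun i => x ∈ U i → False) hx2 (fun i hi => hx ?_) hi
        exact mem_iUnion.2 ⟨i, hi⟩)
    -- Since `f` is 1 off the first `r` sets and 0 off the last, `u` is 2 and -1 there respectively,
    -- and the band `0 ≤ u ≤ 1` remains for gluing.
    let u : C(P.space m, ℝ) := ⟨fun y => 3 * f y - 1, by fun_prop⟩
    have hu1 : ∀ x, u (P.proj m x) ≤ 1 → x ∈ ⋃ i : Fin r, U i.castSucc := by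
      intro x hx
      by_contra h
      have h1 : 3 * f (P.proj m x) - 1 ≤ 1 := hx
      rw [hf1 x h] at h1
      norm_num at h1
    have hu0 : ∀ x, 0 ≤ u (P.proj m x) → x ∈ V₂ := by
      intro x hx
      by_contra h
      have h1 : 0 ≤ 3 * f (P.proj m x) - 1 := hx
      rw [hf0 x h] at h1
      norm_num at h1
    let D : Set (P.space m) := {y | u y ≤ 1}
    have hD : IsClosed D := isClosed_le u.continuous continuous_const
    let P₁ := P.restrict m hD
    let X₁ := P.proj m ⁻¹' D
    have : CompactSpace X₁ :=
      isCompact_iff_compactSpace.1 (hD.preimage (P.proj m).continuous).isCompact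
    let ι : C(X₁, X) := ⟨Subtype.val, continuous_subtype_val⟩
    let ζ₁ := ζ.pullback ι
    choose σ' hσ'c hσ'p hσ' using fun i => ζ.exists_pullback_section ι (hσ i) (hσp i)
    obtain ⟨j, ξ, ⟨Φ⟩⟩ := ih P₁ ζ₁ (fun i => ι ⁻¹' U i.castSucc) (fun i => σ' i.castSucc)
      (fun i => (hUo _).preimage ι.continuous) (fun i => hσ'c _) (fun i b _ => hσ'p _ b)
      (eq_univ_of_forall fun x => by
        obtain ⟨i, hi⟩ := mem_iUnion.1 (hu1 x.1 x.2)
        exact mem_iUnion.2 ⟨i, hi⟩)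
    let s' := σ' (Fin.last r)
    have hs'c : ContinuousOn s' (ι ⁻¹' V₂) := hσ'c _
    have hs'p : ∀ b, ζ₁.proj (s' b) = b := hσ'p _
    let D₂ : Set (P₁.space j) := {y | 0 ≤ u (P.map m j j.2 y.1)}
    have hD₂ : IsClosed D₂ := isClosed_le continuous_const (by fun_prop)
    have hD₂' : ∀ x : X₁, x ∈ P₁.proj j ⁻¹' D₂ ↔ 0 ≤ u (P.proj m x) := fun x => by
      rw [← P.map_proj m j j.2]; rfl
    -- The section of `ζ` over the band, carried into `ξ` by `Φ`, is homotopic to a lift `τ` pulled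
    -- back from stage `k`.
    obtain ⟨k, hjk, τ, hτc, hτp, H⟩ := P₁.exists_stage_lift_on (ξ.secExt_proj hS)
      ξ.proj_surjective j hD₂ (ContinuousMap.id _) (σ := fun x => Φ.toMap (s' x))
      (Φ.toMap.continuous.comp_continuousOn (hs'c.mono fun x hx => hu0 _ ((hD₂' x).1 hx)))
      (fun x _ => by rw [Φ.proj_map, hs'p]; rfl)
    let v : C(X₁, ℝ) := ⟨fun x => u (P.proj m x), by fun_prop⟩
    have hA : P₁.proj j ⁻¹' D₂ = {b | 0 ≤ v b} := ext hD₂'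
    rw [hA] at H
    -- Gluing needs an equality, not a homotopy: `Φ'` takes the section exactly to the pullback of
    -- `τ` where `2/3 ≤ u`, and the pieces will overlap in `2/3 < u < 1`.
    obtain ⟨Φ', hΦ'⟩ := Φ.exists_eq_on_section v
      ((hUo (Fin.last r)).preimage ι.continuous) (fun b hb => hu0 _ hb) hs'c (fun b _ => hs'p b) H
    let R : Set (P.space k) := P.map m k k.2 ⁻¹' D
    let ρ : C(R, P₁.space j) := P₁.map j k hjk
    let Φk := Φ'.toPullback ρ (P₁.proj k) fun x => P₁.map_proj j k hjk x
    let lf : {t : ζ.Total // P.proj k (ζ.proj t) ∈ R} → ζ₁.Total := fun t =>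
      ⟨(⟨ζ.proj t, by
        have := t.2
        rw [mem_preimage, P.map_proj] at this
        exact this⟩, t), rfl⟩
    have hlf : Continuous lf := by fun_prop
    have hup : ∀ x, u (P.map m k k.2 (P.proj k x)) = u (P.proj m x) := fun x => by
      rw [P.map_proj]
    have h₂ : ∀ x, 2 / 3 < u (P.map m k k.2 (P.proj k x)) → x ∈ V₂ := fun x hx =>
      hu0 x (by rw [hup] at hx; linarith)
    refine ⟨k, exists_glue (P.proj k) (hD.preimage (P.map m k k.2).continuous)
      (O₁ := {y | u (P.map m k k.2 y) < 1}) (O₂ := {y | 2 / 3 < u (P.map m k k.2 y)})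
      (isOpen_lt (by fun_prop) continuous_const) (isOpen_lt continuous_const (by fun_prop))
      (fun y hy => (show u (P.map m k k.2 y) < 1 from hy).le)
      (eq_univ_of_forall fun y => ?_) ζ (ξ.pullback ρ)
      (fun t => Φk.toMap (lf t)) (by fun_prop) ?_ ?_ (s := fun y => ⟨(y, τ y), (hτp y).symm⟩)
      ?_ (fun y _ => rfl) (s₂ := s₂) ((hσ _).mono h₂) (fun b hb => hσp _ b (h₂ b hb)) ?_⟩
    · rcases lt_or_ge (u (P.map m k k.2 y)) 1 with h | h
      · exact Or.inl h
      · exact Or.inr (show 2 / 3 < u (P.map m k k.2 y) by linarith)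
    · intro t
      exact Φk.proj_map (lf t)
    · intro t s h
      refine (congrArg Φk.toMap ?_).trans (Φk.map_act (lf t) s)
      exact Subtype.ext (Prod.ext (Subtype.ext (ζ.proj_act _ _)) rfl)
    · refine continuousOn_pullback_mk (continuousOn_id.prodMk (hτc.mono ?_))
      rintro y ⟨-, hy⟩
      show 0 ≤ u (P.map m j j.2 (P.map j k hjk y.1))
      rw [P.map_map]
      have hy' : 2 / 3 < u (P.map m k k.2 y.1) := hy
      linarith
    · intro b hbR hb
      have hbV : b ∈ V₂ := h₂ b hb.2
      have hb' := hσp _ b hbV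
      have hbD : b ∈ X₁ := by
        show u (P.proj m b) ≤ 1
        rw [← hup]; exact le_of_lt hb.1
      have e1 : lf ⟨s₂ b, hbR⟩ = s' ⟨b, hbD⟩ := by
        refine Subtype.ext (Prod.ext ?_ ?_)
        · exact (Subtype.ext hb').trans (hs'p ⟨b, hbD⟩).symm
        · exact (hσ' (Fin.last r) ⟨b, hbD⟩ hbV).symm
      have e2 : (⟨P.proj k (ζ.proj (s₂ b)), hbR⟩ : R) = P₁.proj k ⟨b, hbD⟩ :=
        Subtype.ext (congrArg (P.proj k) hb')
      rw [e1]
      refine Subtype.ext (Prod.ext ?_ ?_)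
      · exact (congrArg (P₁.proj k) (hs'p ⟨b, hbD⟩)).trans e2.symm
      · refine (hΦ' ⟨b, hbD⟩ ?_).trans (congrArg (fun y : R => τ y) e2.symm)
        have := hb.2
        rw [mem_ofPred_eq, hup] at this
        exact this.le

/-- A principal bundle over the limit comes from a stage of the system. -/
theorem exists_stage_bundle (hS : HExtInto.{max u v} (univ : Set S)) {X : Type u}
    [TopologicalSpace X] [CompactSpace X] [T2Space X] {J : Type v} [Preorder J]
    [IsDirectedOrder J] [Nonempty J] (P : CompactSystem X J) (ζ : PrincipalBundle S X) :
    ∃ m, ∃ ζm : PrincipalBundle S (P.space m), Nonempty (ζ.Hom ζm (P.proj m)) := by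
  choose C hC σ c h using ζ.exists_isLocTriv
  obtain ⟨t, ht⟩ := finite_cover_nhds_interior hC
  let e := t.equivFin
  refine exists_stage_bundle_of_cover hS t.card P ζ (fun i => interior (C (e.symm i)))
    (fun i => σ (e.symm i)) (fun i => isOpen_interior)
    (fun i => (h _).continuousOn_sec.mono interior_subset)
    (fun i b hb => (h _).proj_sec b (interior_subset hb)) (eq_univ_of_forall fun x => ?_)
  obtain ⟨y, hy, hx⟩ := mem_iUnion₂.1 (ht.symm ▸ mem_univ x :
    x ∈ ⋃ y ∈ t, interior (C y))
  refine mem_iUnion.2 ⟨e ⟨y, hy⟩, ?_⟩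
  rw [e.symm_apply_apply]
  exact hx

end CompactSystem

/-- The underlying inverse system of compact Hausdorff spaces. -/
def InverseLimitPresentation.toSystem {X : Type u} [TopologicalSpace X] {J : Type v} [Preorder J]
    (P : InverseLimitPresentation X J) : CompactSystem X J where
  space := P.space
  map := P.map
  map_map := P.map_map
  proj := P.proj
  map_proj := P.map_proj
  proj_inj x y h := P.isHomeomorph.injective (Subtype.ext (funext h))
  exists_proj y hy := by
    obtain ⟨x, hx⟩ := P.isHomeomorph.surjective ⟨y, fun j i h => hy j i h⟩
    exact ⟨x, fun j => congrFun (congrArg Subtype.val hx) j⟩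

/-! ### The projectivization as a group in compactly generated spaces. -/

section PG

variable {G : Type u} [TopologicalSpace G] [Group G] [CompactlyCoherentSpace G] [KGroup G]

instance compactlyCoherentSpace_PG : CompactlyCoherentSpace (PG G) :=
  ⟨.of_continuous_prop fun f hf => by
    rw [isOpenQuotientMap_PG.isQuotientMap.continuous_iff]
    refine KContinuous.continuous fun K hK => ?_
    exact (hf _ (hK.image continuous_quot_mk)).comp continuous_quot_mk.continuousOn
      (mapsTo_image _ _)⟩

/-- Compact subsets of `PG G` are not assumed to lift to compact subsets of `G`, so the
multiplication is descended one factor at a time. Here the left factor is descended, while the right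
one is a compact family in `G`; openness of the quotient map keeps it a quotient map after a product
with `M`. -/
theorem continuous_mk_mul {M : Type*} [TopologicalSpace M] [CompactSpace M] [T2Space M]
    {g : M → G} (hg : Continuous g) :
    Continuous fun p : PG G × M => p.1 * (QuotientGroup.mk (g p.2) : PG G) := by
  have hq := (isOpenQuotientMap_PG (G := G)).prodMap (IsOpenQuotientMap.id (X := M))
  rw [hq.isQuotientMap.continuous_iff]
  have h1 : Continuous fun p : G × M => p.1 * g p.2 := by
    have hc : ∀ x : G, Continuous fun y : M => x * g y := fun x =>
      KGroup.continuous_mul_of_compact continuous_const hg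
    let c : G → C(M, G) := fun x => ⟨_, hc x⟩
    have hcc : Continuous c := by
      refine KContinuous.continuous fun L hL => ?_
      have : CompactSpace L := isCompact_iff_compactSpace.1 hL
      rw [continuousOn_iff_continuous_domRestrict]
      refine ContinuousMap.continuous_of_continuous_uncurry _ ?_
      exact KGroup.continuous_mul_of_compact (f := fun p : L × M => (p.1 : G))
        (g := fun p : L × M => g p.2) (by fun_prop) (by fun_prop)
    exact ContinuousMap.continuous_uncurry_of_continuous ⟨c, hcc⟩
  exact continuous_quot_mk.comp h1

/-- The other factor is descended. With `M` compact in `PG G`, joint continuity on `G × M` follows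
by currying from `continuous_mk_mul`, and the open quotient map then replaces `G` by `PG G`. -/
instance kGroup_PG [T2Space G] [T2Space (PG G)] : KGroup (PG G) where
  kcontinuous_inv := kcontinuous_of_continuous continuous_inv
  kcontinuous_mul := by
    intro K hK
    let M : Set (PG G) := Prod.fst '' K
    have hM : IsCompact M := hK.image continuous_fst
    have : CompactSpace M := isCompact_iff_compactSpace.1 hM
    have hc : ∀ g : G, Continuous fun y : M => (y : PG G) * (QuotientGroup.mk g : PG G) := fun g =>
      (continuous_mk_mul (M := Unit) (g := fun _ => g) continuous_const).comp
        (f := fun y : M => ((y : PG G), ())) (by fun_prop)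
    let c : G → C(M, PG G) := fun x => ⟨_, hc x⟩
    have hcc : Continuous c := by
      refine KContinuous.continuous fun L hL => ?_
      have : CompactSpace L := isCompact_iff_compactSpace.1 hL
      rw [continuousOn_iff_continuous_domRestrict]
      refine ContinuousMap.continuous_of_continuous_uncurry _ ?_
      exact (continuous_mk_mul (M := L) continuous_subtype_val).comp
        (f := fun p : L × M => ((p.2 : PG G), p.1)) (by fun_prop)
    have h1 : Continuous fun p : G × M => (p.2 : PG G) * (QuotientGroup.mk p.1 : PG G) :=
      ContinuousMap.continuous_uncurry_of_continuous ⟨c, hcc⟩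
    have h2 : Continuous fun p : PG G × M => (p.2 : PG G) * p.1 := by
      have hq := (isOpenQuotientMap_PG (G := G)).prodMap (IsOpenQuotientMap.id (X := M))
      rw [hq.isQuotientMap.continuous_iff]
      exact h1
    rw [continuousOn_iff_continuous_domRestrict]
    exact h2.comp (f := fun p : K => ((p : PG G × PG G).2,
      (⟨(p : PG G × PG G).1, mem_image_of_mem _ p.2⟩ : M))) (by fun_prop)

end PG

/-! ### Pushing associated bundles forward along bundle maps. -/

namespace Assoc

variable {S F : Type u} [TopologicalSpace S] [Group S] [TopologicalSpace F] [Group F]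
  {B B' : Type u} [TopologicalSpace B] [TopologicalSpace B'] {ζ : PrincipalBundle S B}
  {ζ' : PrincipalBundle S B'} {a : AutAction S F} {f : C(B', B)}

/-- The map of associated bundles induced by a bundle map: `[t, x] ↦ [Φ t, x]`. -/
noncomputable def fpush (Φ : ζ'.Hom ζ f) (p : Assoc ζ' a) : Assoc ζ a :=
  mk a (Φ.toMap (pt ζ' (proj p))) (coord (pt ζ' (proj p)) p)

theorem fpush_mk (Φ : ζ'.Hom ζ f) (t : ζ'.Total) (x : F) :
    fpush Φ (mk a t x) = mk a (Φ.toMap t) x := by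
  obtain ⟨s, hs⟩ := pt_act ζ' t
  simp only [fpush, proj_mk]
  rw [← hs]
  simp only [ζ'.proj_act, proj_pt, Φ.map_act, mk_act, coord_mk]

@[simp] theorem proj_fpush (Φ : ζ'.Hom ζ f) (p : Assoc ζ' a) : proj (fpush Φ p) = f (proj p) := by
  rw [fpush, proj_mk, Φ.proj_map, proj_pt]

theorem exists_rep (p : Assoc ζ a) : ∃ t x, mk a t x = p := by
  obtain ⟨⟨t, x⟩, rfl⟩ := Quotient.exists_rep p
  exact ⟨t, x, rfl⟩

theorem fpull_fpush (Φ : ζ'.Hom ζ f) (p : Assoc ζ' a) : fpull Φ (proj p) (fpush Φ p) = p := by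
  obtain ⟨t, x, rfl⟩ := exists_rep p
  rw [fpush_mk, proj_mk, fpull_mk]

theorem fpush_fpull (Φ : ζ'.Hom ζ f) {b : B'} {p : Assoc ζ a} (h : proj p = f b) :
    fpush Φ (fpull Φ b p) = p := by
  obtain ⟨t, rfl⟩ := ζ'.proj_surjective b
  obtain ⟨x, rfl⟩ := exists_mk p (Φ.toMap t) (by rw [h, Φ.proj_map])
  rw [fpull_mk, fpush_mk]

theorem fpush_inj (Φ : ζ'.Hom ζ f) {p q : Assoc ζ' a} (h : proj p = proj q)
    (hpq : fpush Φ p = fpush Φ q) : p = q := by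
  rw [← fpull_fpush Φ p, ← fpull_fpush Φ q, h, hpq]

theorem fpush_fone (Φ : ζ'.Hom ζ f) (b : B') : fpush Φ (fone a b) = fone a (f b) := by
  obtain ⟨t, rfl⟩ := ζ'.proj_surjective b
  rw [fone_proj, fpush_mk, ← fone_proj, Φ.proj_map]

theorem fpush_fpush {B'' : Type u} [TopologicalSpace B''] {ζ'' : PrincipalBundle S B''}
    {g : C(B'', B')} {k : C(B'', B)} (Φ : ζ'.Hom ζ f) (Ψ : ζ''.Hom ζ' g) (Χ : ζ''.Hom ζ k)
    (h : ∀ t, Φ.toMap (Ψ.toMap t) = Χ.toMap t) (p : Assoc ζ'' a) :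
    fpush Φ (fpush Ψ p) = fpush Χ p := by
  obtain ⟨t, x, rfl⟩ := exists_rep p
  rw [fpush_mk, fpush_mk, fpush_mk, h]

theorem continuous_fpush (Φ : ζ'.Hom ζ f) : Continuous (fpush Φ : Assoc ζ' a → Assoc ζ a) := by
  refine continuous_coinduced_dom.2 (KContinuous.continuous fun K hK => ?_)
  have hs := (CompactCoherentification.continuous_mk_symm (X := ζ'.Total × F))
  refine (continuousOn_mk hK (Φ.toMap.continuous.comp (continuous_fst.comp hs)).continuousOn
    (continuous_snd.comp hs).continuousOn).congr fun p _ => ?_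
  exact fpush_mk Φ _ _

theorem fmul_finv_self (p : Assoc ζ a) : fmul p (finv p) = fone a (proj p) := by
  obtain ⟨t, x, rfl⟩ := exists_rep p
  rw [finv_mk, fmul_mk, mul_inv_cancel, proj_mk, fone_proj]

theorem fmul_finv_fone (p : Assoc ζ a) : fmul p (finv (fone a (proj p))) = p := by
  obtain ⟨t, x, rfl⟩ := exists_rep p
  rw [proj_mk, fone_proj, finv_mk, fmul_mk, inv_one, mul_one]

end Assoc

/-! ### The collapsed cube -/

section Cube

variable (n : ℕ)

/-- A function on the cube that vanishes exactly on the boundary. -/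
def cubeBump (y : Fin n → unitInterval) : ℝ := ∏ i, (y i : ℝ) * (1 - y i)

/-- A map of the cube that collapses exactly the boundary to a point. -/
def collapse (y : Fin n → unitInterval) : ℝ × (Fin n → ℝ) :=
  (cubeBump n y, fun i => cubeBump n y * y i)

theorem continuous_cubeBump : Continuous (cubeBump n) := by unfold cubeBump; fun_prop

theorem continuous_collapse : Continuous (collapse n) := by
  have := continuous_cubeBump n
  unfold collapse; fun_prop

variable {n}

theorem cubeBump_eq_zero {y : Fin n → unitInterval} :
    cubeBump n y = 0 ↔ y ∈ Cube.boundary (Fin n) := by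
  simp only [cubeBump, Finset.prod_eq_zero_iff, Finset.mem_univ, true_and, mul_eq_zero,
    sub_eq_zero, Cube.boundary, mem_ofPred_eq]
  refine exists_congr fun i => or_congr ?_ ?_
  · exact ⟨fun h => Subtype.ext h, fun h => congrArg Subtype.val h⟩
  · exact ⟨fun h => Subtype.ext h.symm, fun h => (congrArg Subtype.val h).symm⟩

theorem collapse_eq {y y' : Fin n → unitInterval} (h : collapse n y = collapse n y') :
    y = y' ∨ y ∈ Cube.boundary (Fin n) ∧ y' ∈ Cube.boundary (Fin n) := by
  have h1 : cubeBump n y = cubeBump n y' := congrArg Prod.fst h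
  by_cases h0 : cubeBump n y = 0
  · exact Or.inr ⟨cubeBump_eq_zero.1 h0, cubeBump_eq_zero.1 (h1 ▸ h0)⟩
  · refine Or.inl (funext fun i => Subtype.ext ?_)
    have h2 : cubeBump n y * y i = cubeBump n y' * y' i := congrFun (congrArg Prod.snd h) i
    rw [← h1] at h2
    exact mul_left_cancel₀ h0 h2

theorem collapse_boundary {y y' : Fin n → unitInterval} (h : y ∈ Cube.boundary (Fin n))
    (h' : y' ∈ Cube.boundary (Fin n)) : collapse n y = collapse n y' := by
  simp only [collapse, cubeBump_eq_zero.2 h, cubeBump_eq_zero.2 h', zero_mul]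

variable (n)

/-- The quotient of the cube by its boundary. -/
abbrev CubeQuot : Type := range (collapse n)

instance : CompactSpace (CubeQuot n) :=
  isCompact_iff_compactSpace.1 (isCompact_range (continuous_collapse n))

variable {n}

/-- The quotient map. -/
def cubeMk (y : Fin n → unitInterval) : CubeQuot n := ⟨collapse n y, mem_range_self y⟩

theorem continuous_cubeMk : Continuous (cubeMk (n := n)) :=
  (continuous_collapse n).subtype_mk _

/-- A preimage in the cube. -/
noncomputable def cubeLift (q : CubeQuot n) : Fin n → unitInterval := q.2.choose

@[simp] theorem cubeMk_cubeLift (q : CubeQuot n) : cubeMk (cubeLift q) = q :=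
  Subtype.ext q.2.choose_spec

theorem cubeLift_cubeMk (y : Fin n → unitInterval) :
    cubeLift (cubeMk y) = y ∨
      cubeLift (cubeMk y) ∈ Cube.boundary (Fin n) ∧ y ∈ Cube.boundary (Fin n) :=
  collapse_eq (congrArg Subtype.val (cubeMk_cubeLift (cubeMk y)))

/-- The lift is a mere choice, but `F` does not see it: preimages are unique off the boundary, and
on the boundary `F` is constant for each `t`. The collapsing map times the identity of `T` is a
closed surjection of compact Hausdorff spaces, hence a quotient map. -/
theorem continuous_cubeLift {T Y : Type*} [TopologicalSpace T] [CompactSpace T] [T2Space T]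
    [TopologicalSpace Y] {F : (Fin n → unitInterval) × T → Y} (hF : Continuous F)
    (h : ∀ t, ∀ y ∈ Cube.boundary (Fin n), ∀ y' ∈ Cube.boundary (Fin n), F (y, t) = F (y', t)) :
    Continuous fun p : CubeQuot n × T => F (cubeLift p.1, p.2) := by
  have hc : Continuous fun p : (Fin n → unitInterval) × T => (cubeMk p.1, p.2) :=
    (continuous_cubeMk.comp continuous_fst).prodMk continuous_snd
  have hq : Topology.IsQuotientMap fun p : (Fin n → unitInterval) × T => (cubeMk p.1, p.2) :=
    hc.isClosedMap.isQuotientMap hc fun p => ⟨(cubeLift p.1, p.2), by simp⟩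
  rw [hq.continuous_iff]
  refine hF.congr fun p => ?_
  rcases cubeLift_cubeMk p.1 with h1 | h1
  · exact congrArg (fun y => F (y, p.2)) h1.symm
  · exact h _ _ h1.2 _ h1.1

variable [Nonempty (Fin n)]

theorem zero_mem_boundary : (0 : Fin n → unitInterval) ∈ Cube.boundary (Fin n) :=
  ⟨Classical.arbitrary _, Or.inl rfl⟩

variable (n) in
/-- The base point. -/
def cubeBase : CubeQuot n := cubeMk 0

theorem cubeMk_boundary {y : Fin n → unitInterval} (h : y ∈ Cube.boundary (Fin n)) :
    cubeMk y = cubeBase n := Subtype.ext (collapse_boundary h zero_mem_boundary)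

theorem cubeLift_cubeBase : cubeLift (cubeBase n) ∈ Cube.boundary (Fin n) := by
  rcases cubeLift_cubeMk (0 : Fin n → unitInterval) with h | h
  · exact h ▸ zero_mem_boundary
  · exact h.1

/-- Scaling the cube towards its corner 0, which is a boundary point as the dimension is positive,
gives a path from 1 to `g y`. -/
theorem mem_idComponent_of_boundary {M : Type*} [TopologicalSpace M] [Group M] [KGroup M]
    {g : (Fin n → unitInterval) → M} (hg : Continuous g) (h : ∀ y ∈ Cube.boundary (Fin n), g y = 1)
    (y : Fin n → unitInterval) : g y ∈ idComponent M := by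
  refine ⟨⟨⟨fun t => g fun i => t * y i, hg.comp (by fun_prop)⟩, ?_, ?_⟩⟩
  · exact h _ ⟨Classical.arbitrary _, Or.inl (zero_mul _)⟩
  · exact congrArg g (funext fun i => one_mul _)

end Cube

/-! ### Loops of sections as lifts over the collapsed cube. -/

section Loops

variable {S F : Type u} [TopologicalSpace S] [Group S] [TopologicalSpace F] [Group F]
  {B B' : Type u} [TopologicalSpace B] [TopologicalSpace B'] {ζ : PrincipalBundle S B}
  {ζ' : PrincipalBundle S B'} {a : AutAction S F} {f : C(B', B)} {n : ℕ}

open Assoc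

/-- Division by the value at the base point of the collapsed cube. -/
noncomputable def basedMap (τ : CubeQuot n × B' → Assoc ζ a) (p : CubeQuot n × B') : Assoc ζ a :=
  fmul (τ p) (finv (τ (cubeBase n, p.2)))

theorem basedMap_cubeBase {τ : CubeQuot n × B' → Assoc ζ a}
    (hτ : ∀ p, proj (τ p) = f p.2) (b : B') :
    basedMap τ (cubeBase n, b) = fone a (f b) :=
  (fmul_finv_self _).trans (by rw [hτ])

theorem basedMap_eq_self {τ : CubeQuot n × B' → Assoc ζ a}
    (hτ : ∀ p, proj (τ p) = f p.2)
    (h : ∀ b, τ (cubeBase n, b) = fone a (f b)) : basedMap τ = τ := by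
  funext p
  rw [basedMap, h, ← hτ p]
  exact fmul_finv_fone _

theorem continuous_basedMap [KGroup F] [RegularSpace B] [CompactSpace B'] {Z : Type*}
    [TopologicalSpace Z] [CompactSpace Z] {τ : (CubeQuot n × B') × Z → Assoc ζ a} (hc : Continuous τ)
    (hτ : ∀ p, proj (τ p) = f p.1.2) :
    Continuous fun p : (CubeQuot n × B') × Z => basedMap (fun r => τ (r, p.2)) p.1 := by
  refine continuous_fmul (Z := (CubeQuot n × B') × Z) (fun p => ?_) hc
    (continuous_finv (by fun_prop))
  rw [proj_finv, hτ, hτ]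

variable (Φ : ζ'.Hom ζ f)

theorem SectionGroup.ext_fpush {σ τ : SectionGroup ζ' a}
    (h : ∀ b, fpush Φ (σ.toMap b) = fpush Φ (τ.toMap b)) : σ = τ :=
  SectionGroup.ext fun b => fpush_inj Φ (by rw [σ.2, τ.2]) (h b)

variable [CompactSpace B'] [T2Space B']

theorem fpush_one (b : B') : fpush Φ ((1 : SectionGroup ζ' a).toMap b) = fone a (f b) :=
  fpush_fone Φ b

section Family

variable [CompactSpace B] [T2Space B] [ContinuousInv S]

/-- The family of sections that corresponds to a family of lifts of a map of bases. -/
noncomputable def sectionFamily {W : Type*} [TopologicalSpace W] [CompactSpace W]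
    (G : C(W × B', Assoc ζ a)) (hG : ∀ p, proj (G p) = f p.2) (w : W) : SectionGroup ζ' a where
  toMap := ⟨fun b => fpull Φ b (G (w, b)),
    continuous_fpull Φ continuous_id (fun b => hG (w, b)) (by fun_prop)⟩
  proj_toMap b := by simp

variable {W : Type*} [TopologicalSpace W] [CompactSpace W] (G : C(W × B', Assoc ζ a))
  (hG : ∀ p, proj (G p) = f p.2)

theorem continuous_sectionFamily : Continuous (sectionFamily Φ G hG) := by
  refine continuous_induced_rng.2 (ContinuousMap.continuous_of_continuous_uncurry _ ?_)
  exact continuous_fpull Φ (Z := W × B') continuous_snd hG G.continuous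

theorem fpush_sectionFamily (w : W) (b : B') :
    fpush Φ ((sectionFamily Φ G hG w).toMap b) = G (w, b) :=
  fpush_fpull Φ (hG (w, b))

theorem sectionFamily_eq_one {w : W} (h : ∀ b, G (w, b) = fone a (f b)) :
    sectionFamily Φ G hG w = 1 :=
  SectionGroup.ext_fpush Φ fun b => by rw [fpush_sectionFamily, fpush_one, h]

end Family

variable [KGroup F]

/-- The map `(I^n / ∂I^n) × B' → T ×_S F` that corresponds to a loop of sections. -/
noncomputable def pushLoop (ℓ : GenLoop (Fin n) (idComponent (SectionGroup ζ' a)) 1) :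
    C(CubeQuot n × B', Assoc ζ a) where
  toFun p := fpush Φ ((ℓ (cubeLift p.1)).1.toMap p.2)
  continuous_toFun := by
    refine continuous_cubeLift (T := B') (F := fun p => fpush Φ ((ℓ p.1).1.toMap p.2)) ?_ ?_
    · refine (continuous_fpush Φ).comp (continuous_eval.comp (Continuous.prodMk ?_ continuous_snd))
      exact SectionGroup.continuous_toMap.comp (continuous_subtype_val.comp
        (ℓ.1.continuous.comp continuous_fst))
    · intro b y hy y' hy'
      dsimp only
      rw [GenLoop.boundary ℓ y hy, GenLoop.boundary ℓ y' hy']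

theorem pushLoop_apply (ℓ : GenLoop (Fin n) (idComponent (SectionGroup ζ' a)) 1)
    (y : Fin n → unitInterval) (b : B') :
    pushLoop Φ ℓ (cubeMk y, b) = fpush Φ ((ℓ y).1.toMap b) := by
  show fpush Φ ((ℓ (cubeLift (cubeMk y))).1.toMap b) = _
  rcases cubeLift_cubeMk y with h | h
  · rw [h]
  · rw [GenLoop.boundary ℓ y h.2, GenLoop.boundary ℓ _ h.1]

theorem proj_pushLoop (ℓ : GenLoop (Fin n) (idComponent (SectionGroup ζ' a)) 1)
    (p : CubeQuot n × B') : proj (pushLoop Φ ℓ p) = f p.2 := by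
  show proj (fpush Φ ((ℓ (cubeLift p.1)).1.toMap p.2)) = _
  rw [proj_fpush, SectionGroup.proj_toMap]

theorem liftHtpy_pushLoop {ℓ₀ ℓ₁ : GenLoop (Fin n) (idComponent (SectionGroup ζ' a)) 1}
    (h : GenLoop.Homotopic ℓ₀ ℓ₁) :
    LiftHtpy (proj : Assoc ζ a → B) (fun p : CubeQuot n × B' => f p.2) univ (pushLoop Φ ℓ₀)
      (pushLoop Φ ℓ₁) := by
  obtain ⟨H⟩ := h
  have hc : Continuous fun p : CubeQuot n × (B' × unitInterval) =>
      fpush Φ ((H (p.2.2, cubeLift p.1)).1.toMap p.2.1) := by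
    refine continuous_cubeLift (T := B' × unitInterval)
      (F := fun p => fpush Φ ((H (p.2.2, p.1)).1.toMap p.2.1)) ?_ ?_
    · refine (continuous_fpush Φ).comp (continuous_eval.comp (Continuous.prodMk ?_ (by fun_prop)))
      exact SectionGroup.continuous_toMap.comp (continuous_subtype_val.comp
        (H.continuous.comp (by fun_prop)))
    · intro p y hy y' hy'
      dsimp only
      rw [H.eq_fst p.2 hy, H.eq_fst p.2 hy']
      exact congrArg (fun σ => fpush Φ ((σ : idComponent (SectionGroup ζ' a)).1.toMap p.1))
        ((GenLoop.boundary ℓ₀ y hy).trans (GenLoop.boundary ℓ₀ y' hy').symm)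
  have h1 := CompactSystem.liftHtpy_path (π := (proj : Assoc ζ a → B))
    (g := fun p : CubeQuot n × B' => f p.2)
    (f := fun p : (CubeQuot n × B') × unitInterval =>
      fpush Φ ((H (p.2, cubeLift p.1.1)).1.toMap p.1.2))
    (hc.comp (f := fun p : (CubeQuot n × B') × unitInterval => (p.1.1, (p.1.2, p.2)))
      (by fun_prop)) (fun p => by rw [proj_fpush, SectionGroup.proj_toMap])
  refine h1.congr (fun p _ => ?_) fun p _ => ?_
  · rw [H.apply_zero]; rfl
  · rw [H.apply_one]; rfl

theorem pushLoop_cubeBase [Nonempty (Fin n)]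
    (ℓ : GenLoop (Fin n) (idComponent (SectionGroup ζ' a)) 1) (b : B') :
    pushLoop Φ ℓ (cubeBase n, b) = fone a (f b) := by
  show fpush Φ ((ℓ (cubeLift (cubeBase n))).1.toMap b) = _
  rw [GenLoop.boundary ℓ _ cubeLift_cubeBase]
  exact fpush_one Φ b

theorem basedMap_pushLoop [Nonempty (Fin n)]
    (ℓ : GenLoop (Fin n) (idComponent (SectionGroup ζ' a)) 1) :
    basedMap (pushLoop Φ ℓ) = pushLoop Φ ℓ :=
  basedMap_eq_self (proj_pushLoop Φ ℓ) (pushLoop_cubeBase Φ ℓ)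

variable [CompactSpace B] [T2Space B] [ContinuousInv S] [Nonempty (Fin n)]

/-- By adjunction the lift is a family of sections over the cube. The boundary goes to the base
point, hence to the unit section, and then the whole family lies in the identity component
automatically. -/
theorem exists_pushLoop_eq (τ : C(CubeQuot n × B', Assoc ζ a)) (hτ : ∀ p, proj (τ p) = f p.2)
    (h : ∀ b, τ (cubeBase n, b) = fone a (f b)) :
    ∃ ℓ : GenLoop (Fin n) (idComponent (SectionGroup ζ' a)) 1, pushLoop Φ ℓ = τ := by
  have hcm := continuous_cubeMk (n := n)
  let G : C((Fin n → unitInterval) × B', Assoc ζ a) := ⟨fun p => τ (cubeMk p.1, p.2), by fun_prop⟩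
  have hG : ∀ p, proj (G p) = f p.2 := fun p => hτ _
  have h1 : ∀ y ∈ Cube.boundary (Fin n), sectionFamily Φ G hG y = 1 := fun y hy =>
    sectionFamily_eq_one Φ G hG fun b => by
      show τ (cubeMk y, b) = _
      rw [cubeMk_boundary hy, h]
  have hc := continuous_sectionFamily Φ G hG
  refine ⟨⟨⟨fun y => ⟨sectionFamily Φ G hG y, mem_idComponent_of_boundary hc h1 y⟩,
    hc.subtype_mk _⟩, fun y hy => Subtype.ext (h1 y hy)⟩, ?_⟩
  ext ⟨q, b⟩
  rw [← cubeMk_cubeLift q, pushLoop_apply]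
  exact fpush_sectionFamily Φ G hG _ b

/-- The homotopies furnished by the extension property ignore the base point. Fibrewise division, at
each time, by the value at the base point turns a free homotopy into one relative to the boundary of
the cube. -/
theorem homotopic_of_liftHtpy {ℓ₀ ℓ₁ : GenLoop (Fin n) (idComponent (SectionGroup ζ' a)) 1}
    {τ₀ τ₁ : CubeQuot n × B' → Assoc ζ a}
    (H : LiftHtpy (proj : Assoc ζ a → B) (fun p : CubeQuot n × B' => f p.2) univ τ₀ τ₁)
    (h₀ : ∀ p, pushLoop Φ ℓ₀ p = basedMap τ₀ p) (h₁ : ∀ p, pushLoop Φ ℓ₁ p = basedMap τ₁ p) :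
    GenLoop.Homotopic ℓ₀ ℓ₁ := by
  obtain ⟨H, hHc, hHg, hH0, hH1⟩ := H
  let L : (CubeQuot n × B') × unitInterval → Assoc ζ a := fun p => H (p.1, p.2)
  have hLc : Continuous L := hHc.comp_continuous (by fun_prop) fun p => ⟨trivial, trivial⟩
  have hLp : ∀ p, proj (L p) = f p.1.2 := fun p => hHg _ trivial _
  let L' : (CubeQuot n × B') × unitInterval → Assoc ζ a := fun p =>
    basedMap (fun r => L (r, p.2)) p.1
  have hL'c : Continuous L' := continuous_basedMap hLc hLp
  have hcm := continuous_cubeMk (n := n)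
  let G : C((unitInterval × (Fin n → unitInterval)) × B', Assoc ζ a) :=
    ⟨fun p => L' ((cubeMk p.1.2, p.2), p.1.1), by fun_prop⟩
  have hG : ∀ p, proj (G p) = f p.2 := fun p =>
    (proj_fmul _ _).trans (hLp ((cubeMk p.1.2, p.2), p.1.1))
  have h1 : ∀ t, ∀ y ∈ Cube.boundary (Fin n), sectionFamily Φ G hG (t, y) = 1 := fun t y hy =>
    sectionFamily_eq_one Φ G hG fun b => by
      show L' ((cubeMk y, b), t) = _
      rw [cubeMk_boundary hy]
      exact basedMap_cubeBase (f := f) (fun p => hLp (p, t)) b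
  have hc := continuous_sectionFamily Φ G hG
  refine ⟨⟨⟨⟨fun z => ⟨sectionFamily Φ G hG z, mem_idComponent_of_boundary
    (g := fun y => sectionFamily Φ G hG (z.1, y)) (hc.comp (by fun_prop)) (h1 z.1) z.2⟩,
    hc.subtype_mk _⟩, fun y => Subtype.ext ?_, fun y => Subtype.ext ?_⟩, fun t y hy => ?_⟩⟩
  · refine SectionGroup.ext_fpush Φ fun b => (fpush_sectionFamily Φ G hG _ b).trans ?_
    refine Eq.trans ?_ (pushLoop_apply Φ ℓ₀ y b)
    rw [h₀]
    exact congrArg (fun τ => basedMap τ (cubeMk y, b)) (funext fun r => hH0 r trivial _ le_rfl)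
  · refine SectionGroup.ext_fpush Φ fun b => (fpush_sectionFamily Φ G hG _ b).trans ?_
    refine Eq.trans ?_ (pushLoop_apply Φ ℓ₁ y b)
    rw [h₁]
    exact congrArg (fun τ => basedMap τ (cubeMk y, b)) (funext fun r => hH1 r trivial _ le_rfl)
  · refine Eq.trans (Subtype.ext (h1 t y hy)) (GenLoop.boundary ℓ₀ y hy).symm

end Loops

/-! ### Rationalization -/

namespace BracketGroup

/-- The element `r ⊗ x` of the rationalization. -/
def ratTmul {A : BracketGroup.{u}} {n : ℕ+} (r : ℚ) (x : A.deg n) : A.rat.deg n :=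
  (r ⊗ₜ[ℤ] x : ℚ ⊗[ℤ] A.deg n)

theorem rat_induction {A : BracketGroup.{u}} {n : ℕ+} {C : A.rat.deg n → Prop} (zero : C 0)
    (tmul : ∀ r x, C (ratTmul r x)) (add : ∀ x y, C x → C y → C (x + y)) (x : A.rat.deg n) : C x :=
  TensorProduct.induction_on (motive := C) x zero tmul add

theorem rat_bracket_tmul (A : BracketGroup.{u}) {p q : ℕ+} (r s : ℚ) (x : A.deg p) (y : A.deg q) :
    A.rat.bracket p q (ratTmul r x) (ratTmul s y) = ratTmul (r * s) (A.bracket p q x y) := rfl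

theorem ratMap_tmul {A : BracketGroup.{u}} {A' : BracketGroup.{v}} (f : GradedMap A A') {n : ℕ+}
    (r : ℚ) (x : A.deg n) : ratMap f n (ratTmul r x) = ratTmul r (f n x) := rfl

theorem PreservesBracket.ratMap {A : BracketGroup.{u}} {A' : BracketGroup.{v}} {f : GradedMap A A'}
    (hf : PreservesBracket f) :
    PreservesBracket fun n => (BracketGroup.ratMap f n).toAddMonoidHom := by
  intro p q x y
  show BracketGroup.ratMap f (p + q) (A.rat.bracket p q x y) =
    A'.rat.bracket p q (BracketGroup.ratMap f p x) (BracketGroup.ratMap f q y)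
  induction x using rat_induction with
  | zero => simp
  | add x x' hx hx' =>
    rw [map_add, AddMonoidHom.add_apply, map_add, hx, hx', map_add, map_add,
      AddMonoidHom.add_apply]
  | tmul r x =>
    induction y using rat_induction with
    | zero => simp
    | add y y' hy hy' => rw [map_add, map_add, hy, hy', map_add, map_add]
    | tmul s y =>
      rw [rat_bracket_tmul, ratMap_tmul, ratMap_tmul, ratMap_tmul, rat_bracket_tmul, hf]

theorem IsIso.ratMap {A : BracketGroup.{u}} {A' : BracketGroup.{v}} {f : GradedMap A A'}
    (hf : IsIso f) : IsIso fun n => (BracketGroup.ratMap f n).toAddMonoidHom := by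
  refine ⟨fun n => ?_, hf.2.ratMap⟩
  let e := LinearEquiv.ofBijective (f n).toIntLinearMap (hf.1 n)
  exact (LinearEquiv.lTensor ℚ e).bijective

end BracketGroup

/-! ### The limit of the homotopy groups -/

/-- The bundle map from a pullback. -/
def PrincipalBundle.pullbackProj {S : Type u} [TopologicalSpace S] [Group S] {B B' : Type u}
    [TopologicalSpace B] [TopologicalSpace B'] (ζ : PrincipalBundle S B) (f : C(B', B)) :
    (ζ.pullback f).Hom ζ f where
  toMap := ⟨fun p => p.1.2, by fun_prop⟩
  proj_map p := p.2.symm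
  map_act _ _ := rfl

/-- The image of a loop under a homomorphism. -/
def mapLoop {M N : Type*} [TopologicalSpace M] [Group M] [TopologicalSpace N] [Group N]
    (φ : KHom M N) {n : ℕ} (ℓ : GenLoop (Fin n) M 1) : GenLoop (Fin n) N 1 :=
  ⟨⟨fun y => φ.toMonoidHom (ℓ y), φ.kcontinuous.continuous_comp ℓ.1.continuous⟩, fun y hy => by
    show φ.toMonoidHom (ℓ y) = 1
    rw [GenLoop.boundary ℓ y hy, map_one]⟩

theorem piMap_piMk {M N : Type u} [TopologicalSpace M] [Group M] [KGroup M] [TopologicalSpace N]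
    [Group N] [KGroup N] (φ : KHom M N) {n : ℕ+} (ℓ : GenLoop (Fin n) M 1) :
    piMap φ n (piMk ℓ) = piMk (mapLoop φ ℓ) := rfl

theorem piMk_eq {M : Type u} [TopologicalSpace M] [Group M] {n : ℕ+}
    {ℓ ℓ' : GenLoop (Fin n) M 1} : piMk ℓ = piMk ℓ' ↔ GenLoop.Homotopic ℓ ℓ' :=
  ⟨fun h => Quotient.exact (s := GenLoop.Homotopic.setoid (Fin n) (1 : M)) h,
    fun h => Quotient.sound (s := GenLoop.Homotopic.setoid (Fin n) (1 : M)) h⟩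

section Limit

variable {S : Type u} [TopologicalSpace S] [Group S] [ContinuousInv S] {F : Type u}
  [TopologicalSpace F] [Group F] [KGroup F] (a : AutAction S F)

/-- In terms of lifts into one fixed associated bundle, pulling sections back is precomposition with
the map of bases. This translates the direct system of homotopy groups into the inverse system of
spaces. -/
theorem pushLoop_pull {B B' B'' : Type u} [TopologicalSpace B] [TopologicalSpace B']
    [CompactSpace B'] [T2Space B'] [TopologicalSpace B''] [CompactSpace B''] [T2Space B'']
    {ζ'' : PrincipalBundle S B''} {ζ' : PrincipalBundle S B'} {ζ : PrincipalBundle S B}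
    {f : C(B', B)} {g : C(B'', B')} {k : C(B'', B)} (Φ : ζ'.Hom ζ f) (Ψ : ζ''.Hom ζ' g)
    (Χ : ζ''.Hom ζ k) (h : ∀ t, Φ.toMap (Ψ.toMap t) = Χ.toMap t) {n : ℕ}
    (ℓ : GenLoop (Fin n) (idComponent (SectionGroup ζ' a)) 1) (p : CubeQuot n × B'') :
    pushLoop Χ (mapLoop (SectionGroup.pull a Ψ).idComponentMap ℓ) p =
      pushLoop Φ ℓ (p.1, g p.2) := by
  show Assoc.fpush Χ (Assoc.fpull Ψ p.2 ((ℓ (cubeLift p.1)).1.toMap (g p.2))) =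
    Assoc.fpush Φ ((ℓ (cubeLift p.1)).1.toMap (g p.2))
  rw [← Assoc.fpush_fpush Φ Ψ Χ h, Assoc.fpush_fpull Ψ (SectionGroup.proj_toMap _ _)]

variable {X : Type u} [TopologicalSpace X] [CompactSpace X] [T2Space X] {J : Type v} [Preorder J]
  [IsDirectedOrder J] (P : InverseLimitPresentation X J) (m : J)
  (ζm : PrincipalBundle S (P.space m)) {ζ : PrincipalBundle S X} (Ψ : ζ.Hom ζm (P.proj m))

theorem limitMap_of {n : ℕ+} (j : {j : J // m ≤ j})
    (x : (sectionSamelson a (stageBundle P m ζm j)).deg n) :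
    limitMap P m ζm a Ψ n ((stageSystem P m ζm a).of j x) =
      sectionSamelsonMap a (toStage P m ζm Ψ j) n x := rfl

/-- Both arguments are represented at a common stage, and there pullback is a homomorphism, so it
preserves commutators. -/
theorem limitMap_preservesBracket :
    BracketGroup.PreservesBracket (limitMap P m ζm a Ψ) := by
  intro p q x y
  obtain ⟨i, b, _, c, _, rfl, -, rfl, -⟩ := (stageSystem P m ζm a).exists_rep x x y y
  refine (congrArg (limitMap P m ζm a Ψ (p + q))
    (BracketGroup.System.limBracket_of _ i b c)).trans ?_
  exact piMap_samelson _ p q b c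

/-- A class over the limit is a lift of the projection to stage `m`; up to homotopy it is pulled
back from a later stage. The lift found there need not be based, but dividing by its values at the
base point makes it a loop of sections whose pullback is still in the given class. -/
theorem limitMap_surjective (hF : HExtInto.{max u v} (univ : Set F)) (n : ℕ+) :
    Function.Surjective (limitMap P m ζm a Ψ n) := by
  have : Nonempty J := ⟨m⟩
  intro x
  obtain ⟨ℓ, rfl⟩ := piMk_surjective x
  obtain ⟨k, hmk, τ, hτ, H⟩ := P.toSystem.exists_stage_lift (Assoc.secExt_proj ζm a hF) m
    (ContinuousMap.id _) (pushLoop Ψ ℓ) (proj_pushLoop Ψ ℓ)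
  let Θ : (stageBundle P m ζm ⟨k, hmk⟩).Hom ζm (P.map m k hmk) := ζm.pullbackProj _
  have hτb : Continuous fun p => basedMap τ p :=
    (continuous_basedMap (f := P.map m k hmk) (Z := Unit) (τ := fun p => τ p.1) (by fun_prop)
      fun p => hτ p.1).comp (f := fun p => (p, ())) (by fun_prop)
  obtain ⟨ℓ', hℓ'⟩ := exists_pushLoop_eq Θ ⟨_, hτb⟩
    (fun p => (Assoc.proj_fmul _ _).trans (hτ p)) (basedMap_cubeBase hτ)
  refine ⟨(stageSystem P m ζm a).of ⟨k, hmk⟩ (piMk ℓ'), ?_⟩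
  refine (limitMap_of a P m ζm Ψ ⟨k, hmk⟩ _).trans ((piMap_piMk _ ℓ').trans (piMk_eq.2 ?_))
  refine homotopic_of_liftHtpy Ψ H (fun p => ?_) fun p => ?_
  · refine (pushLoop_pull a Θ (toStage P m ζm Ψ ⟨k, hmk⟩) Ψ (fun t => rfl) ℓ' p).trans ?_
    rw [hℓ']
    rfl
  · rw [basedMap_pushLoop]

/-- Two classes, represented at a common stage, that agree over the limit give homotopic lifts over
the limit, hence homotopic lifts over a later stage, so they are identified in the direct limit. -/
theorem limitMap_injective (hF : HExtInto.{max u v} (univ : Set F)) (n : ℕ+) :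
    Function.Injective (limitMap P m ζm a Ψ n) := by
  have : Nonempty J := ⟨m⟩
  intro x y hxy
  obtain ⟨k, b, c, _, _, rfl, rfl, -, -⟩ := (stageSystem P m ζm a).exists_rep x y x y
  obtain ⟨ℓ₀, rfl⟩ := piMk_surjective b
  obtain ⟨ℓ₁, rfl⟩ := piMk_surjective c
  have h1 : GenLoop.Homotopic
      (mapLoop (SectionGroup.pull a (toStage P m ζm Ψ k)).idComponentMap ℓ₀)
      (mapLoop (SectionGroup.pull a (toStage P m ζm Ψ k)).idComponentMap ℓ₁) := piMk_eq.1 hxy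
  let Θ : ∀ j : {j : J // m ≤ j}, (stageBundle P m ζm j).Hom ζm (P.map m j j.2) := fun j =>
    ζm.pullbackProj _
  have e : ∀ ℓ, ∀ p : CubeQuot n × X, pushLoop (Θ k) ℓ (p.1, P.proj k p.2) = pushLoop Ψ
      (mapLoop (SectionGroup.pull a (toStage P m ζm Ψ k)).idComponentMap ℓ) p := fun ℓ p =>
    (pushLoop_pull a (Θ k) (toStage P m ζm Ψ k) Ψ (fun t => rfl) ℓ p).symm
  have hb : (fun p : CubeQuot n × X => P.map m k k.2 (P.proj k p.2)) = fun p => P.proj m p.2 :=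
    funext fun p => P.map_proj m k k.2 p.2
  obtain ⟨l, hkl, H⟩ := P.toSystem.exists_stage_homotopy (Assoc.secExt_proj ζm a hF) k
    (P.map m k k.2) (pushLoop (Θ k) ℓ₀) (pushLoop (Θ k) ℓ₁) (proj_pushLoop (Θ k) ℓ₀)
    (proj_pushLoop (Θ k) ℓ₁) (by
      show LiftHtpy _ (fun p : CubeQuot n × X => P.map m k k.2 (P.proj k p.2)) univ _ _
      rw [hb]
      exact (liftHtpy_pushLoop Ψ h1).congr (fun p _ => e ℓ₀ p) fun p _ => e ℓ₁ p)
  let l' : {j : J // m ≤ j} := ⟨l, k.2.trans hkl⟩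
  refine (BracketGroup.System.of_map _ k l' hkl _).trans (Eq.trans ?_
    (BracketGroup.System.of_map _ k l' hkl _).symm)
  refine congrArg ((stageSystem P m ζm a).of l') (piMk_eq.2 ?_)
  have hb' : (fun p : CubeQuot n × P.space l => P.map m k k.2 (P.map k l hkl p.2)) =
      fun p => P.map m l l'.2 p.2 := funext fun p => P.map_map m k l k.2 hkl p.2
  have e' : ∀ ℓ, ∀ p : CubeQuot n × P.space l, pushLoop (Θ l')
      (mapLoop (SectionGroup.pull a (stageMap P m ζm k l' hkl)).idComponentMap ℓ) p =
        pushLoop (Θ k) ℓ (p.1, P.map k l hkl p.2) := fun ℓ p =>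
    pushLoop_pull a (Θ k) (stageMap P m ζm k l' hkl) (Θ l') (fun t => rfl) ℓ p
  -- Both lifts come from loops and are already based, so the division at the base point changes
  -- neither.
  refine homotopic_of_liftHtpy (Θ l') (τ₀ := pushLoop (Θ l') _) (τ₁ := pushLoop (Θ l') _) ?_
    (fun p => congrFun (basedMap_pushLoop (Θ l') _).symm p)
    (fun p => congrFun (basedMap_pushLoop (Θ l') _).symm p)
  rw [← hb']
  exact H.congr (fun p _ => e' ℓ₀ p) fun p _ => e' ℓ₁ p

theorem limitMap_isIso (hF : HExtInto.{max u v} (univ : Set F)) :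
    BracketGroup.IsIso (limitMap P m ζm a Ψ) :=
  ⟨fun n => ⟨limitMap_injective a P m ζm Ψ hF n, limitMap_surjective a P m ζm Ψ hF n⟩,
    limitMap_preservesBracket a P m ζm Ψ⟩

end Limit

end GaugeLimit

end

/-! ### Gauge groups and projective gauge groups. -/

open GaugeLimit in
theorem proposition8p1 {X : Type u} [MetricSpace X] [CompactSpace X] {J : Type v} [Preorder J]
    [IsDirectedOrder J] [Nonempty J] (P : InverseLimitPresentation X J)
    {G : Type u} [TopologicalSpace G] [Group G] [T2Space G] [CompactlyCoherentSpace G] [KGroup G]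
    (hG : HasCWType G) :
    (∀ ζ : PrincipalBundle G X,
      (∃ (m : J) (ζm : PrincipalBundle G (P.space m)), Nonempty (ζ.Hom ζm (P.proj m))) ∧
      ∀ (m : J) (ζm : PrincipalBundle G (P.space m)) (Ψ : ζ.Hom ζm (P.proj m)),
        (∀ n, Function.Bijective (gaugeLimitMap P m ζm Ψ n)) ∧
        BracketGroup.IsIso fun n =>
          (BracketGroup.ratMap (gaugeLimitMap P m ζm Ψ) n).toAddMonoidHom) ∧
    (T2Space (PG G) → HasCWType (PG G) → ∀ ζ : PrincipalBundle (PG G) X,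
      (∃ (m : J) (ζm : PrincipalBundle (PG G) (P.space m)), Nonempty (ζ.Hom ζm (P.proj m))) ∧
      ∀ (m : J) (ζm : PrincipalBundle (PG G) (P.space m)) (Ψ : ζ.Hom ζm (P.proj m)),
        (∀ n, Function.Bijective (projGaugeLimitMap P m ζm Ψ n)) ∧
        BracketGroup.IsIso fun n =>
          (BracketGroup.ratMap (projGaugeLimitMap P m ζm Ψ) n).toAddMonoidHom) := by
  -- The structure group decides the descent of the bundle, the fibre that of the sections. In the
  -- projective case the former is `PG G`, while the latter is still `G`, so both CW types enter.
  refine ⟨fun ζ => ⟨P.toSystem.exists_stage_bundle hG.hExtInto ζ, fun m ζm Ψ => ?_⟩,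
    fun _ hPG ζ => ⟨P.toSystem.exists_stage_bundle hPG.hExtInto ζ, fun m ζm Ψ => ?_⟩⟩
  · have h := limitMap_isIso (conjAction G) P m ζm Ψ hG.hExtInto
    exact ⟨h.1, h.ratMap⟩
  · have h := limitMap_isIso (projConjAction G) P m ζm Ψ hG.hExtInto
    exact ⟨h.1, h.ratMap⟩
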